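/- For $\mu,\lambda\in\mathbb R$, $\sigma>0$, let $f_{SN}(x;\mu,\sigma,\lambda)=\frac{2}{\sigma}\,\phi\!\left(\frac{x-\mu}{\sigma}\right)\Phi\!\left(\lambda\frac{x-\mu}{\sigma}\right)$ be the skew-normal density, where $\phi$ and $\Phi$ are the standard normal density and distribution function. For $p\ge 1$ let $\Gamma_p$ be the set of $\Psi=(\pi_k,\mu_k,\sigma_k,\lambda_k)_{k\le p}$ with $\pi_k\ge 0$, $\sum_k\pi_k=1$, $\sigma_k>0$, $\mu_k,\lambda_k\in\mathbb R$, and put $f(x;\Psi)=\sum_{k=1}^p\pi_kf_{SN}(x;\mu_k,\sigma_k,\lambda_k)$. We identify $\Psi$ with the mixing distribution $\sum_k\pi_k\delta_{(\mu_k,\sigma_k^2,\lambda_k)}$. Let $\Psi_0\in\Gamma_{p_0}$ have all proportions $\pi_{0k}>0$ and be such that any two distinct components $j\ne k$ with $\mu_{0j}=\mu_{0k}$ and $\sigma_{0j}=\sigma_{0k}$ have $\lambda_{0j}\ne0$, $\lambda_{0k}\neq 0$ and $|\lambda_{0j}|\ne|\lambda_{0k}|$. Let $X_1,X_2,\dots$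 be i.i.d. with density $f(\cdot;\Psi_0)$, and let $p\ell_n(\Psi)=\sum_{i=1}^n\log f(X_i;\Psi)+\sum_kp_n(\sigma_k)+\sum_k\tilde p_n(\lambda_k)$, where the penalty functions $p_n:(0,\infty)\to\mathbb R$ and $\tilde p_n:\mathbb R\to\mathbb R$ (which may depend on the sample) satisfy, almost surely: - (C1) $p_n(\sigma)=o(n)$ for every $\sigma>0$, and $\sup_{\sigma>0}\max\{0,p_n(\sigma)\}=o(n)$; - (C2) for all large $n$, $p_n(\sigma)\le(\log n)^2\log\sigma$ whenever $0<\sigma<n^{-1}\log n$; - (C3) for all large $n$, $\tilde p_n$ is continuous, attains its maximum at $0$, $\tilde p_n(0)=0$, and $\tilde p_n(\lambda)\to-\infty$ as $|\lambda|\to\infty$; moreover $\tilde p_n(\lambda)=o(n)$ for every fixed $\lambda$. Then, almost surely, the following holds for every real $c$: every sequence $\Psi_n\in\Gamma_{p_0}$ (which may depend on the sample) with $p\ell_n(\Psi_n)-p\ell_n(\Psi_0)\ge c$ for all large $n$ converges to $\Psi_0$, in the sense that the mixing distributions converge in distribution and, after relabelling the components of $\Psi_n$, all proportions and all parameters $\mu_k,\sigma_k,\lambda_k$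 converge to those of $\Psi_0$. In particular, the penalized maximum likelihood estimator is strongly consistent: almost surely, every sequence $\Psi_n$ such that, for all large $n$, $\Psi_n$ maximizes $p\ell_n$ over $\Gamma_{p_0}$ converges to $\Psi_0$ in this sense. -/

import Mathlib

open MeasureTheory ProbabilityTheory Filter Topology Asymptotics

namespace SkewNormal

noncomputable section

/-- The skew-normal density with location `m`, scale `s > 0` and shape `l`:
`(2 / s) φ((x - m) / s) Φ(l (x - m) / s)`. -/
def snDensity (m s l x : ℝ) : ℝ :=
  2 / s * gaussianPDFReal 0 1 ((x - m) / s) * cdf (gaussianReal 0 1) (l * ((x - m) / s))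

/-- A skew-normal mixture with `p` components: mixing proportions `weight`, and component
locations, scales and shapes. Proportions may vanish and components may coincide. -/
structure Mixture (p : ℕ) where
  weight : Fin p → ℝ
  loc : Fin p → ℝ
  scale : Fin p → ℝ
  shape : Fin p → ℝ
  weight_nonneg : ∀ k, 0 ≤ weight k
  weight_sum : ∑ k, weight k = 1
  scale_pos : ∀ k, 0 < scale k

namespace Mixture

variable {p : ℕ}

/-- The density `f(x; Ψ)` of the mixture. -/
def density (Ψ : Mixture p) (x : ℝ) : ℝ :=
  ∑ k, Ψ.weight k * snDensity (Ψ.loc k) (Ψ.scale k) (Ψ.shape k) x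

/-- The mixture law on `ℝ`. -/
def law (Ψ : Mixture p) : Measure ℝ :=
  volume.withDensity fun x => ENNReal.ofReal (Ψ.density x)

/-- The mixing distribution `∑ k, π_k δ_{θ_k}`, with `θ_k = (μ_k, σ_k², λ_k)`. -/
def mixingMeasure (Ψ : Mixture p) : Measure (ℝ × ℝ × ℝ) :=
  ∑ k, ENNReal.ofReal (Ψ.weight k) • Measure.dirac (Ψ.loc k, Ψ.scale k ^ 2, Ψ.shape k)

instance (Ψ : Mixture p) : IsProbabilityMeasure Ψ.mixingMeasure := by
  constructor
  simp only [mixingMeasure, Measure.coe_finsetSum, Finset.sum_apply, Measure.smul_apply,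
    measure_univ, smul_eq_mul, mul_one]
  rw [← ENNReal.ofReal_sum_of_nonneg fun k _ => Ψ.weight_nonneg k, Ψ.weight_sum,
    ENNReal.ofReal_one]

/-- The mixing distribution as a point of the space of probability measures, which carries the
topology of convergence in distribution. -/
def mixing (Ψ : Mixture p) : ProbabilityMeasure (ℝ × ℝ × ℝ) :=
  ⟨Ψ.mixingMeasure, inferInstance⟩

/-- `Ψ` has exactly `p` components and is determined, among the mixing distributions with at most
`p` components, by its density: all proportions are positive, and distinct components with the
same location and scale have nonzero shapes of different absolute values (in particular, the
component parameters are pairwise distinct). The restriction on shapes is needed because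
`Φ(t) + Φ(-t) = 1` makes the equal mixture of the shapes `l` and `-l` the component of shape `0`. -/
def IsProper (Ψ : Mixture p) : Prop :=
  (∀ k, 0 < Ψ.weight k) ∧
    ∀ j k, j ≠ k → Ψ.loc j = Ψ.loc k → Ψ.scale j = Ψ.scale k →
      Ψ.shape j ≠ 0 ∧ |Ψ.shape j| ≠ |Ψ.shape k|

/-- The log-likelihood of the observations `x 0, …, x (n - 1)`. -/
def logLik (x : ℕ → ℝ) (n : ℕ) (Ψ : Mixture p) : ℝ :=
  ∑ i ∈ Finset.range n, Real.log (Ψ.density (x i))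

/-- The penalized log-likelihood, with penalty `penS` on scales and `penL` on shapes. -/
def penLogLik (penS penL : ℕ → ℝ → ℝ) (x : ℕ → ℝ) (n : ℕ) (Ψ : Mixture p) : ℝ :=
  Ψ.logLik x n + (∑ k, penS n (Ψ.scale k) + ∑ k, penL n (Ψ.shape k))

/-- Convergence of mixtures `Ψ n` to `Ψ₀`: the mixing distributions converge in distribution and,
after relabelling the components of each `Ψ n`, all proportions and parameters converge. -/
def ConvergesTo (Ψ : ℕ → Mixture p) (Ψ₀ : Mixture p) : Prop :=
  Tendsto (fun n => (Ψ n).mixing) atTop (𝓝 Ψ₀.mixing) ∧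
    ∃ τ : ℕ → Equiv.Perm (Fin p), ∀ k,
      Tendsto (fun n => (Ψ n).weight (τ n k)) atTop (𝓝 (Ψ₀.weight k)) ∧
      Tendsto (fun n => (Ψ n).loc (τ n k)) atTop (𝓝 (Ψ₀.loc k)) ∧
      Tendsto (fun n => (Ψ n).scale (τ n k)) atTop (𝓝 (Ψ₀.scale k)) ∧
      Tendsto (fun n => (Ψ n).shape (τ n k)) atTop (𝓝 (Ψ₀.shape k))

end Mixture

/-- First condition on the scale penalty: `p_n(σ) = o(n)` for each `σ > 0`, and
`sup_{σ > 0} max {0, p_n(σ)} = o(n)`. -/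
def CondC1 (penS : ℕ → ℝ → ℝ) : Prop :=
  (∀ s, 0 < s → (fun n => penS n s) =o[atTop] fun n : ℕ => (n : ℝ)) ∧
    ∀ ε, 0 < ε → ∀ᶠ n : ℕ in atTop, ∀ s, 0 < s → max 0 (penS n s) ≤ ε * n

/-- Second condition: for large `n`, `p_n(σ) ≤ (log n)² log σ` when `0 < σ < (log n) / n`. -/
def CondC2 (penS : ℕ → ℝ → ℝ) : Prop :=
  ∀ᶠ n : ℕ in atTop, ∀ s, 0 < s → s < Real.log n / n →
    penS n s ≤ Real.log n ^ 2 * Real.log s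

/-- Condition on the shape penalty: for large `n`, `p_n` is continuous, is maximal at `0` with
`p_n(0) = 0`, and tends to `-∞` as `|λ| → ∞`; and `p_n(λ) = o(n)` for each fixed `λ`. -/
def CondC3 (penL : ℕ → ℝ → ℝ) : Prop :=
  (∀ᶠ n : ℕ in atTop, Continuous (penL n) ∧ (∀ l, penL n l ≤ penL n 0) ∧ penL n 0 = 0 ∧
      Tendsto (penL n) (cocompact ℝ) atBot) ∧
    ∀ l, (fun n => penL n l) =o[atTop] fun n : ℕ => (n : ℝ)

end

end SkewNormal

namespace SkewNormal

local notation "φ" => gaussianPDFReal 0 1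
local notation "Φ" => cdf (gaussianReal 0 1)

/-! ### The standard normal density and distribution function -/

/-! The proof is Wald's consistency argument in a compactified parameter space. Let proportions
range over `[0, 1]` and locations, scales and shapes over the extended reals. Every sequence of
mixtures then has a convergent subsequence, and it suffices to show that a limit of near-maximizers
is `Ψ₀` up to relabelling. Let `N` be the set of components whose scales do not tend to `0`, and `f`
the pointwise limit of their weighted sum. Components in `N` that escape to infinity contribute
nothing, and infinite shapes give half-normal densities, so `f` is a bounded subprobability density.

Components outside `N` make the likelihood unbounded. For `δ > 0`, `Mixture.log_density_le` bounds
the log-density by `log (f_N + δ)` plus a term `log (1 + g_k / δ)` for each spike `g_k`. A spike of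
scale `s` matters only within distance `√s` of its centre. A Chernoff bound and Borel–Cantelli
(`ae_countBound`) show that every window of radius `w` holds `O(n w + log n)` observations. The gain
is therefore at most a small multiple of `n` plus `O(log n) (1 + |log s|)`. If `s < log n / n`, the
penalty `(log n)² log s` absorbs the logarithm of `s`; otherwise `|log s| ≤ log n` and the gain is
`o(n)` anyway. This is `spike_bound`.

For the components in `N`, a uniform law of large numbers is needed over a family with unbounded
locations and shapes. A skew-normal density is a difference of two monotone functions whose bounds
depend on the scale alone (`exists_monotone_snDensity`), and so is the logarithm of `δ` plus a
nonnegative difference of this kind. Hence the Glivenko–Cantelli theorem suffices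
(`UniformLLN.log_sub`).

Combining the two, `∫ f₀ log f₀ ≤ ∫ f₀ log (f + δ)` for every `δ > 0`, where `f₀` is the true
density. The information inequality in Hellinger form (`Mixture.ae_eq_density_of_integral_log_le`)
then gives `f = f₀` almost everywhere.

It remains to identify the mixing distribution, with half-normal components admitted in the limit
(`exists_equiv_of_density_eq`). On a ray, each density is a combination of functions `exp (-a (x -
m)²) (1 - Φ (k (x - m)))`. Such functions are linearly independent: they decay like a Gaussian with
exponent `a + k² / 2` and centre `m`, and those sharing both are, after rescaling, Laplace
transforms of distinct centred Gaussians. The resulting relations, the signs of the coefficients and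
the count of at most `p` components force a bijection with the components of `Ψ₀`. All `p`
components are used, so none has degenerated. -/

lemma pdf_eq (t : ℝ) : φ t = (√(2 * Real.pi))⁻¹ * Real.exp (-t ^ 2 / 2) := by
  simp [gaussianPDFReal]

lemma pdf_pos (t : ℝ) : 0 < φ t := gaussianPDFReal_pos 0 1 t one_ne_zero

lemma continuous_pdf : Continuous φ := by
  have : φ = fun t => (√(2 * Real.pi))⁻¹ * Real.exp (-t ^ 2 / 2) := funext pdf_eq
  rw [this]; fun_prop

lemma pdf_neg (t : ℝ) : φ (-t) = φ t := by simp [pdf_eq]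

lemma two_mul_inv_sqrt_two_pi_le_one : 2 * (√(2 * Real.pi))⁻¹ ≤ 1 := by
  have h : 2 ≤ √(2 * Real.pi) := by
    apply Real.le_sqrt_of_sq_le
    nlinarith [Real.pi_gt_three]
  rw [← div_eq_mul_inv, div_le_one (by linarith)]
  exact h

lemma two_mul_pdf_le (t : ℝ) : 2 * φ t ≤ Real.exp (-t ^ 2 / 2) := by
  rw [pdf_eq, ← mul_assoc]
  exact mul_le_of_le_one_left (Real.exp_nonneg _) two_mul_inv_sqrt_two_pi_le_one

lemma two_mul_pdf_le_one (t : ℝ) : 2 * φ t ≤ 1 :=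
  (two_mul_pdf_le t).trans (Real.exp_le_one_iff.2 (by nlinarith [sq_nonneg t]))

lemma tendsto_pdf_cobounded : Tendsto φ (cocompact ℝ) (𝓝 0) := by
  have h1 : Tendsto (fun t : ℝ => Real.exp (-t ^ 2 / 2)) (cocompact ℝ) (𝓝 0) := by
    refine Real.tendsto_exp_atBot.comp ?_
    have h2 : Tendsto (fun t : ℝ => t ^ 2) (cocompact ℝ) atTop := by
      have := (tendsto_norm_cocompact_atTop (E := ℝ)).comp tendsto_id
      have h3 := (tendsto_pow_atTop (two_ne_zero)).comp this
      refine h3.congr fun t => ?_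
      simp
    have h4 : Tendsto (fun t : ℝ => -(t ^ 2 / 2)) (cocompact ℝ) atBot :=
      tendsto_neg_atTop_atBot.comp (h2.atTop_div_const two_pos)
    exact h4.congr fun t => by ring
  refine squeeze_zero (fun t => (pdf_pos t).le) (fun t => ?_) h1
  have := two_mul_pdf_le t
  have := pdf_pos t
  linarith

lemma sqrt_add_le {a b : ℝ} (ha : 0 ≤ a) (hb : 0 ≤ b) : √(a + b) ≤ √a + √b := by
  rw [Real.sqrt_le_left (by positivity)]
  nlinarith [Real.mul_self_sqrt ha, Real.mul_self_sqrt hb, Real.sqrt_nonneg a, Real.sqrt_nonneg b,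
    mul_nonneg (Real.sqrt_nonneg a) (Real.sqrt_nonneg b)]

lemma tail_eq (x : ℝ) : 1 - Φ x = ∫ u in Set.Ioi x, φ u := by
  rw [cdf_eq_real, ← probReal_compl_eq_one_sub measurableSet_Iic, Set.compl_Iic, Measure.real,
    gaussianReal_apply_eq_integral 0 one_ne_zero, ENNReal.toReal_ofReal]
  exact integral_nonneg fun t => (pdf_pos t).le

lemma tail_pos (x : ℝ) : 0 < 1 - Φ x := by
  rw [tail_eq]
  refine (setIntegral_pos_iff_support_of_nonneg_ae ?_ ?_).2 ?_
  · exact Eventually.of_forall fun t => (pdf_pos t).le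
  · exact (integrable_gaussianPDFReal 0 1).integrableOn
  · have : Function.support φ = Set.univ := by
      ext t; simp [(pdf_pos t).ne']
    simp [this]

lemma noAtoms_std (x : ℝ) : gaussianReal 0 1 {x} = 0 := by
  rw [gaussianReal_apply 0 one_ne_zero]
  exact setLIntegral_measure_zero _ _ (by simp)

lemma cdf_neg (x : ℝ) : Φ (-x) = 1 - Φ x := by
  have h : (gaussianReal 0 1).map (fun x => -x) = gaussianReal 0 1 := by
    rw [gaussianReal_map_neg]; simp
  have h1 : gaussianReal 0 1 (Set.Iic (-x)) = gaussianReal 0 1 (Set.Ici x) := by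
    conv_lhs => rw [← h]
    rw [Measure.map_apply measurable_neg measurableSet_Iic]
    congr 1; ext y; simp
  have h2 : gaussianReal 0 1 (Set.Ici x) = gaussianReal 0 1 (Set.Ioi x) := by
    rw [← Set.Ioi_union_left]
    exact le_antisymm ((measure_union_le _ _).trans (by rw [noAtoms_std x, add_zero]))
      (measure_mono Set.subset_union_left)
  rw [cdf_eq_real, cdf_eq_real, ← probReal_compl_eq_one_sub measurableSet_Iic, Set.compl_Iic,
    Measure.real, h1, h2, Measure.real]

lemma cdf_pos (x : ℝ) : 0 < Φ x := by
  have := tail_pos (-x)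
  rw [cdf_neg] at this; linarith

lemma cdf_lt_one (x : ℝ) : Φ x < 1 := by linarith [tail_pos x]

lemma cdf_zero : Φ 0 = 1 / 2 := by
  have := cdf_neg 0
  rw [neg_zero] at this; linarith

lemma cdf_lipschitz (x y : ℝ) : |Φ x - Φ y| ≤ |x - y| := by
  have key : ∀ x y : ℝ, x ≤ y → Φ y - Φ x ≤ y - x := by
    intro x y hxy
    have h1 : Φ y - Φ x = ∫ u in Set.Ioc x y, φ u := by
      have h := setIntegral_union (f := φ) (μ := volume)
        (Set.Ioc_disjoint_Ioi le_rfl : Disjoint (Set.Ioc x y) (Set.Ioi y)) measurableSet_Ioi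
        (integrable_gaussianPDFReal 0 1).integrableOn
        (integrable_gaussianPDFReal 0 1).integrableOn
      rw [Set.Ioc_union_Ioi_eq_Ioi hxy, ← tail_eq, ← tail_eq] at h
      linarith
    rw [h1]
    have h2 : ∫ u in Set.Ioc x y, φ u ≤ ∫ u in Set.Ioc x y, (1 : ℝ) := by
      refine setIntegral_mono (integrable_gaussianPDFReal 0 1).integrableOn ?_ fun t => ?_
      · simp
      · linarith [two_mul_pdf_le_one t, pdf_pos t]
    simpa [hxy] using h2
  rcases le_total x y with h | h
  · have h' := monotone_cdf (gaussianReal 0 1) h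
    rw [abs_sub_comm, abs_of_nonneg (by linarith), abs_sub_comm, abs_of_nonneg (by linarith)]
    exact key x y h
  · have h' := monotone_cdf (gaussianReal 0 1) h
    rw [abs_of_nonneg (by linarith), abs_of_nonneg (by linarith)]
    exact key y x h

lemma continuous_cdf_std : Continuous Φ := by
  refine LipschitzWith.continuous (K := 1) (LipschitzWith.of_dist_le_mul fun x y => ?_)
  simpa [Real.dist_eq] using cdf_lipschitz x y

/-! ### Skew-normal densities -/

variable {m s l x : ℝ}

lemma snDensity_pos (hs : 0 < s) : 0 < snDensity m s l x := by
  unfold snDensity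
  have := pdf_pos ((x - m) / s)
  have := cdf_pos (l * ((x - m) / s))
  positivity

lemma continuous_snDensity (m s l : ℝ) : Continuous (snDensity m s l) := by
  unfold snDensity
  have := continuous_pdf
  have := continuous_cdf_std
  fun_prop

lemma snDensity_le_pdf (hs : 0 < s) : snDensity m s l x ≤ 2 / s * φ ((x - m) / s) := by
  unfold snDensity
  have := pdf_pos ((x - m) / s)
  exact mul_le_of_le_one_right (by positivity) (cdf_lt_one _).le

lemma snDensity_le_exp (hs : 0 < s) :
    snDensity m s l x ≤ 1 / s * Real.exp (-(x - m) ^ 2 / (2 * s ^ 2)) := by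
  refine (snDensity_le_pdf hs).trans ?_
  have h := two_mul_pdf_le ((x - m) / s)
  have h2 : -((x - m) / s) ^ 2 / 2 = -(x - m) ^ 2 / (2 * s ^ 2) := by field_simp
  rw [h2] at h
  calc 2 / s * φ ((x - m) / s) = 1 / s * (2 * φ ((x - m) / s)) := by ring
    _ ≤ _ := by gcongr

lemma snDensity_le_inv (hs : 0 < s) : snDensity m s l x ≤ 1 / s := by
  refine (snDensity_le_exp hs).trans (mul_le_of_le_one_right (by positivity) ?_)
  rw [Real.exp_le_one_iff, neg_div]
  have : 0 ≤ (x - m) ^ 2 / (2 * s ^ 2) := by positivity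
  linarith

lemma integrable_pdf_comp (m : ℝ) (hs : 0 < s) : Integrable fun x => 2 / s * φ ((x - m) / s) := by
  have h := ((integrable_gaussianPDFReal 0 1).comp_div hs.ne').comp_sub_right m
  exact h.const_mul _

lemma integrable_snDensity (m l : ℝ) (hs : 0 < s) : Integrable (snDensity m s l) := by
  refine (integrable_pdf_comp m hs).mono' (continuous_snDensity m s l).aestronglyMeasurable ?_
  refine Eventually.of_forall fun x => ?_
  rw [Real.norm_of_nonneg (snDensity_pos hs).le]
  exact snDensity_le_pdf hs

/-- By the symmetry `t ↦ -t`, `φ(t) Φ(l t)` and `φ(t) (1 - Φ(l t))` have the same integral, and they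
add up to `φ`; so each integrates to `1 / 2`. -/
lemma integral_snDensity (m l : ℝ) (hs : 0 < s) : ∫ x, snDensity m s l x = 1 := by
  set g : ℝ → ℝ := fun t => φ t * Φ (l * t) with hg
  have h1 : ∫ x, snDensity m s l x = 2 / s * (s * ∫ t, g t) := by
    have h2 : snDensity m s l = fun x => 2 / s * g ((x - m) / s) := by
      ext x; simp [snDensity, g, mul_assoc]
    rw [h2, integral_const_mul, integral_sub_right_eq_self (fun x => g (x / s)) m,
      Measure.integral_comp_div, abs_of_pos hs, smul_eq_mul]
  have hint : Integrable g := by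
    refine (integrable_gaussianPDFReal 0 1).mono' ?_ ?_
    · have := continuous_pdf
      have := continuous_cdf_std
      exact (by fun_prop : Continuous g).aestronglyMeasurable
    · refine Eventually.of_forall fun t => ?_
      have h1 := pdf_pos t
      have h2 := cdf_pos (l * t)
      rw [Real.norm_of_nonneg (by positivity)]
      exact mul_le_of_le_one_right h1.le (cdf_lt_one _).le
  have h3 : ∫ t, g t = ∫ t, (φ t - g t) := by
    rw [← integral_neg_eq_self]
    congr 1; ext t
    simp only [g, pdf_neg, mul_neg, cdf_neg]; ring
  rw [integral_sub (integrable_gaussianPDFReal 0 1) hint,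
    integral_gaussianPDFReal_eq_one 0 one_ne_zero] at h3
  have h4 : ∫ t, g t = 1 / 2 := by linarith
  rw [h1, h4]; field_simp

/-! ### Mixture densities -/

namespace Mixture

variable {p : ℕ} (Ψ : Mixture p)

lemma weight_le_one (k : Fin p) : Ψ.weight k ≤ 1 := by
  rw [← Ψ.weight_sum]
  exact Finset.single_le_sum (fun i _ => Ψ.weight_nonneg i) (Finset.mem_univ k)

lemma density_pos (x : ℝ) : 0 < Ψ.density x := by
  obtain ⟨k, hk⟩ : ∃ k, 0 < Ψ.weight k := by
    by_contra! h
    have := Finset.sum_nonpos fun k (_ : k ∈ Finset.univ) => h k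
    rw [Ψ.weight_sum] at this; linarith
  refine Finset.sum_pos'
    (fun i _ => mul_nonneg (Ψ.weight_nonneg i) (snDensity_pos (Ψ.scale_pos i)).le)
    ⟨k, Finset.mem_univ k, mul_pos hk (snDensity_pos (Ψ.scale_pos k))⟩

lemma continuous_density : Continuous Ψ.density :=
  continuous_finsetSum _ fun _ _ => continuous_const.mul (continuous_snDensity _ _ _)

lemma integrable_density : Integrable Ψ.density :=
  integrable_finsetSum _ fun k _ => (integrable_snDensity _ _ (Ψ.scale_pos k)).const_mul _

lemma integral_density : ∫ x, Ψ.density x = 1 := by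
  unfold density
  rw [integral_finsetSum _ fun k _ => (integrable_snDensity _ _ (Ψ.scale_pos k)).const_mul _]
  simp_rw [integral_const_mul, integral_snDensity _ _ (Ψ.scale_pos _), mul_one]
  exact Ψ.weight_sum

lemma exists_density_le : ∃ B, 0 < B ∧ ∀ x, Ψ.density x ≤ B := by
  refine ⟨∑ k, 1 / Ψ.scale k + 1, ?_, fun x => ?_⟩
  · have : 0 ≤ ∑ k, 1 / Ψ.scale k := Finset.sum_nonneg fun k _ =>
      (one_div_pos.2 (Ψ.scale_pos k)).le
    linarith
  · have : Ψ.density x ≤ ∑ k, 1 / Ψ.scale k := by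
      refine Finset.sum_le_sum fun k _ => ?_
      have h1 := snDensity_le_inv (m := Ψ.loc k) (l := Ψ.shape k) (x := x) (Ψ.scale_pos k)
      have h2 := (snDensity_pos (m := Ψ.loc k) (l := Ψ.shape k) (x := x) (Ψ.scale_pos k)).le
      exact (mul_le_of_le_one_left h2 (Ψ.weight_le_one k)).trans h1
    linarith

instance : IsProbabilityMeasure Ψ.law := by
  constructor
  rw [law, withDensity_apply _ MeasurableSet.univ, Measure.restrict_univ,
    ← ofReal_integral_eq_lintegral_ofReal Ψ.integrable_density
      (Eventually.of_forall fun x => (Ψ.density_pos x).le), Ψ.integral_density, ENNReal.ofReal_one]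

lemma law_absolutelyContinuous : Ψ.law ≪ volume := withDensity_absolutelyContinuous _ _

lemma integral_law (g : ℝ → ℝ) : ∫ x, g x ∂Ψ.law = ∫ x, Ψ.density x * g x := by
  rw [law, integral_withDensity_eq_integral_toReal_smul₀
    Ψ.continuous_density.measurable.ennreal_ofReal.aemeasurable (by simp)]
  simp_rw [ENNReal.toReal_ofReal (Ψ.density_pos _).le, smul_eq_mul]

lemma integrable_law_iff (g : ℝ → ℝ) :
    Integrable g Ψ.law ↔ Integrable fun x => Ψ.density x * g x := by
  rw [law, integrable_withDensity_iff_integrable_smul₀'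
    Ψ.continuous_density.measurable.ennreal_ofReal.aemeasurable (by simp)]
  simp_rw [ENNReal.toReal_ofReal (Ψ.density_pos _).le, smul_eq_mul]

/-- The square root is subadditive and the root of a Gaussian is a wider Gaussian. This makes the
expected log-likelihood finite, and it controls the extra `δ` in the Hellinger argument, where `f +
δ` itself is not integrable. -/
lemma integrable_sqrt_density : Integrable fun x => √(Ψ.density x) := by
  have h : Integrable fun x =>
      ∑ k, √(1 / Ψ.scale k) * Real.exp (-(4 * Ψ.scale k ^ 2)⁻¹ * (x - Ψ.loc k) ^ 2) := by
    refine integrable_finsetSum _ fun k _ => Integrable.const_mul ?_ _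
    have := Ψ.scale_pos k
    exact (integrable_exp_neg_mul_sq (by positivity : 0 < (4 * Ψ.scale k ^ 2)⁻¹)).comp_sub_right _
  refine h.mono' (Real.continuous_sqrt.comp Ψ.continuous_density).aestronglyMeasurable ?_
  refine Eventually.of_forall fun x => ?_
  rw [Real.norm_of_nonneg (Real.sqrt_nonneg _)]
  have hsub : ∀ s : Finset (Fin p), ∀ a : Fin p → ℝ, (∀ k, 0 ≤ a k) →
      √(∑ k ∈ s, a k) ≤ ∑ k ∈ s, √(a k) := by
    intro s a ha
    induction s using Finset.cons_induction with
    | empty => simp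
    | cons i s hi ih =>
      rw [Finset.sum_cons, Finset.sum_cons]
      exact (sqrt_add_le (ha i) (Finset.sum_nonneg fun k _ => ha k)).trans (by gcongr)
  refine (hsub Finset.univ _ fun k =>
    mul_nonneg (Ψ.weight_nonneg k) (snDensity_pos (Ψ.scale_pos k)).le).trans ?_
  refine Finset.sum_le_sum fun k _ => ?_
  have hs := Ψ.scale_pos k
  have h1 := snDensity_le_exp (m := Ψ.loc k) (l := Ψ.shape k) (x := x) hs
  have h2 := (snDensity_pos (m := Ψ.loc k) (l := Ψ.shape k) (x := x) hs).le
  have h3 := (mul_le_of_le_one_left h2 (Ψ.weight_le_one k)).trans h1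
  refine (Real.sqrt_le_sqrt h3).trans ?_
  rw [Real.sqrt_mul (by positivity), ← Real.exp_half]
  refine le_of_eq ?_
  congr 2
  field_simp
  ring

/-- Where `f ≤ 1` one has `f |log f| ≤ 2 √f`; where `f ≥ 1`, boundedness of `f` bounds the
logarithm. -/
lemma integrable_log_density : Integrable (fun x => Real.log (Ψ.density x)) Ψ.law := by
  rw [integrable_law_iff]
  obtain ⟨B, hB, hle⟩ := Ψ.exists_density_le
  have hint : Integrable fun x => 2 * √(Ψ.density x) + |Real.log B| * Ψ.density x :=
    (Ψ.integrable_sqrt_density.const_mul 2).add (Ψ.integrable_density.const_mul _)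
  refine hint.mono' ?_ ?_
  · exact (Ψ.continuous_density.mul
      (Ψ.continuous_density.log fun x => (Ψ.density_pos x).ne')).aestronglyMeasurable
  refine Eventually.of_forall fun x => ?_
  have hpos := Ψ.density_pos x
  rw [Real.norm_eq_abs, abs_mul, abs_of_pos hpos]
  rcases le_total (Ψ.density x) 1 with h | h
  · have h1 := Real.abs_log_mul_self_rpow_lt (Ψ.density x) (1 / 2) hpos h (by norm_num)
    rw [← Real.sqrt_eq_rpow, abs_mul, abs_of_nonneg (Real.sqrt_nonneg _)] at h1
    have h2 := Real.mul_self_sqrt hpos.le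
    have h3 := Real.sqrt_pos.2 hpos
    have h4 : Ψ.density x * |Real.log (Ψ.density x)| ≤ 2 * √(Ψ.density x) := by
      calc _ = √(Ψ.density x) * (|Real.log (Ψ.density x)| * √(Ψ.density x)) := by
            linear_combination -|Real.log (Ψ.density x)| * h2
        _ ≤ √(Ψ.density x) * (1 / (1 / 2)) := by gcongr
        _ = _ := by ring
    have : 0 ≤ |Real.log B| * Ψ.density x := by positivity
    linarith
  · have h1 : |Real.log (Ψ.density x)| ≤ |Real.log B| := by
      rw [abs_of_nonneg (Real.log_nonneg h)]
      exact (Real.log_le_log hpos (hle x)).trans (le_abs_self _)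
    have : 0 ≤ 2 * √(Ψ.density x) := by positivity
    nlinarith

end Mixture

/-! ### Skew-normal densities with extended parameters -/

/-- The factor `Φ(l t)` for an extended real shape `l`. -/
noncomputable def skewFactor (l : EReal) (t : ℝ) : ℝ :=
  if l = ⊤ then (if 0 < t then 1 else 0)
  else if l = ⊥ then (if t < 0 then 1 else 0)
  else Φ (l.toReal * t)

lemma skewFactor_coe (l t : ℝ) : skewFactor l t = Φ (l * t) := by
  simp [skewFactor]

lemma skewFactor_neg (l : EReal) (t : ℝ) : skewFactor (-l) t = skewFactor l (-t) := by
  induction l with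
  | bot => simp [skewFactor]
  | top => simp [skewFactor]
  | coe l => rw [← EReal.coe_neg, skewFactor_coe, skewFactor_coe]; simp

/-- The skew-normal density with location `m`, scale `s` and extended real shape `l`; for infinite
shapes this is a half-normal density. -/
noncomputable def skewDensity (m s : ℝ) (l : EReal) (x : ℝ) : ℝ :=
  2 / s * φ ((x - m) / s) * skewFactor l ((x - m) / s)

lemma skewDensity_coe (m s l x : ℝ) : skewDensity m s l x = snDensity m s l x := by
  simp [skewDensity, snDensity, skewFactor_coe]

/-- The point `t₀ = 0` is excluded because for infinite shapes the limit jumps there and the product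
`l i * t i` is indeterminate. -/
lemma tendsto_skewFactor {ι : Type*} {F : Filter ι} {l : ι → ℝ} {t : ι → ℝ} {l₀ : EReal} {t₀ : ℝ}
    (hl : Tendsto (fun i => (l i : EReal)) F (𝓝 l₀)) (ht : Tendsto t F (𝓝 t₀)) (h₀ : t₀ ≠ 0) :
    Tendsto (fun i => Φ (l i * t i)) F (𝓝 (skewFactor l₀ t₀)) := by
  induction l₀ with
  | coe l₀ =>
    rw [skewFactor_coe]
    exact (continuous_cdf_std.tendsto _).comp ((EReal.tendsto_coe.1 hl).mul ht)
  | top =>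
    have hl' : Tendsto l F atTop := EReal.tendsto_coe_nhds_top_iff.1 hl
    rcases lt_or_gt_of_ne h₀ with h | h
    · have h1 : skewFactor ⊤ t₀ = 0 := by simp [skewFactor, h.le]
      rw [h1]
      exact (tendsto_cdf_atBot _).comp (hl'.atTop_mul_neg h ht)
    · have h1 : skewFactor ⊤ t₀ = 1 := by simp [skewFactor, h]
      rw [h1]
      exact (tendsto_cdf_atTop _).comp (hl'.atTop_mul_pos h ht)
  | bot =>
    have hl' : Tendsto l F atBot := EReal.tendsto_coe_nhds_bot_iff.1 hl
    rcases lt_or_gt_of_ne h₀ with h | h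
    · have h1 : skewFactor ⊥ t₀ = 1 := by simp [skewFactor, h]
      rw [h1]
      exact (tendsto_cdf_atTop _).comp (hl'.atBot_mul_neg h ht)
    · have h1 : skewFactor ⊥ t₀ = 0 := by simp [skewFactor, h.le]
      rw [h1]
      exact (tendsto_cdf_atBot _).comp (hl'.atBot_mul_pos h ht)

lemma tendsto_snDensity_of_scale_atTop {ι : Type*} {F : Filter ι} {m s l : ι → ℝ}
    (hs : Tendsto s F atTop) (x : ℝ) :
    Tendsto (fun i => snDensity (m i) (s i) (l i) x) F (𝓝 0) := by
  have h1 : Tendsto (fun i => 1 / s i) F (𝓝 0) := by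
    simp only [one_div]; exact hs.inv_tendsto_atTop
  refine squeeze_zero' ?_ ?_ h1
  · filter_upwards [hs.eventually_gt_atTop 0] with i hi using (snDensity_pos hi).le
  · filter_upwards [hs.eventually_gt_atTop 0] with i hi using snDensity_le_inv hi

lemma tendsto_snDensity_of_loc {ι : Type*} {F : Filter ι} {m s l : ι → ℝ} {s₀ : ℝ} (h₀ : 0 < s₀)
    (hs : Tendsto s F (𝓝 s₀)) (hm : Tendsto (fun i => |m i|) F atTop) (x : ℝ) :
    Tendsto (fun i => snDensity (m i) (s i) (l i) x) F (𝓝 0) := by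
  have h1 : Tendsto (fun i => |x - m i| * (s i)⁻¹) F atTop := by
    refine Tendsto.atTop_mul_pos (inv_pos.2 h₀) ?_ (hs.inv₀ h₀.ne')
    refine tendsto_atTop_mono (fun i => ?_) (tendsto_atTop_add_const_right F (-|x|) hm)
    have := abs_sub_abs_le_abs_sub (m i) x
    rw [abs_sub_comm] at this
    linarith
  have h2 : Tendsto (fun i => (x - m i) / s i) F (cocompact ℝ) := by
    refine tendsto_norm_atTop_iff_cobounded.1 ?_ |>.mono_right (Metric.cobounded_eq_cocompact).le
    refine h1.congr' ?_
    filter_upwards [hs.eventually (lt_mem_nhds h₀)] with i hi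
    rw [Real.norm_eq_abs, abs_div, abs_of_pos hi, div_eq_mul_inv]
  have h3 : Tendsto (fun i => 2 / s i * φ ((x - m i) / s i)) F (𝓝 (2 / s₀ * 0)) :=
    (tendsto_const_nhds.div hs h₀.ne').mul (tendsto_pdf_cobounded.comp h2)
  rw [mul_zero] at h3
  refine squeeze_zero' ?_ ?_ h3
  · filter_upwards [hs.eventually (lt_mem_nhds h₀)] with i hi using (snDensity_pos hi).le
  · filter_upwards [hs.eventually (lt_mem_nhds h₀)] with i hi using snDensity_le_pdf hi

lemma tendsto_snDensity {ι : Type*} {F : Filter ι} {m s l : ι → ℝ} {m₀ s₀ : ℝ} {l₀ : EReal}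
    (h₀ : 0 < s₀) (hm : Tendsto m F (𝓝 m₀)) (hs : Tendsto s F (𝓝 s₀))
    (hl : Tendsto (fun i => (l i : EReal)) F (𝓝 l₀)) {x : ℝ} (hx : x ≠ m₀) :
    Tendsto (fun i => snDensity (m i) (s i) (l i) x) F (𝓝 (skewDensity m₀ s₀ l₀ x)) := by
  have ht : Tendsto (fun i => (x - m i) / s i) F (𝓝 ((x - m₀) / s₀)) :=
    (tendsto_const_nhds.sub hm).div hs h₀.ne'
  refine ((tendsto_const_nhds.div hs h₀.ne').mul ((continuous_pdf.tendsto _).comp ht)).mul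
    (tendsto_skewFactor hl ht ?_)
  exact div_ne_zero (sub_ne_zero.2 hx) h₀.ne'

/-- The pointwise limit of skew-normal densities whose location, scale and shape tend to the
extended reals `θ.1`, `θ.2.1 ≠ 0` and `θ.2.2`. -/
noncomputable def limDensity (θ : EReal × EReal × EReal) (x : ℝ) : ℝ :=
  if θ.1 = ⊤ ∨ θ.1 = ⊥ ∨ θ.2.1 = ⊤ then 0 else skewDensity θ.1.toReal θ.2.1.toReal θ.2.2 x

/-- An infinite location has `toReal` equal to `0`, so the point `0` is then excluded needlessly;
only a null set is lost. -/
lemma tendsto_snDensity_limDensity {ι : Type*} {F : Filter ι} {m s l : ι → ℝ}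
    {θ : EReal × EReal × EReal} (h₀ : 0 < θ.2.1)
    (hθ : Tendsto (fun i => ((m i : EReal), (s i : EReal), (l i : EReal))) F (𝓝 θ)) {x : ℝ}
    (hx : x ≠ θ.1.toReal) :
    Tendsto (fun i => snDensity (m i) (s i) (l i) x) F (𝓝 (limDensity θ x)) := by
  obtain ⟨m₀, s₀, l₀⟩ := θ
  have hm : Tendsto (fun i => (m i : EReal)) F (𝓝 m₀) :=
    (continuous_fst.tendsto _).comp hθ
  have hs : Tendsto (fun i => (s i : EReal)) F (𝓝 s₀) :=
    ((continuous_fst.comp continuous_snd).tendsto _).comp hθ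
  have hl : Tendsto (fun i => (l i : EReal)) F (𝓝 l₀) :=
    ((continuous_snd.comp continuous_snd).tendsto _).comp hθ
  simp only at h₀ hx
  induction s₀ with
  | bot => simp at h₀
  | top =>
    have : limDensity (m₀, ⊤, l₀) x = 0 := by simp [limDensity]
    rw [this]
    exact tendsto_snDensity_of_scale_atTop (EReal.tendsto_coe_nhds_top_iff.1 hs) x
  | coe s₀ =>
    have h₀' : 0 < s₀ := by exact_mod_cast h₀
    have hs' := EReal.tendsto_coe.1 hs
    induction m₀ with
    | bot =>
      have : limDensity (⊥, (s₀ : EReal), l₀) x = 0 := by simp [limDensity]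
      rw [this]
      exact tendsto_snDensity_of_loc h₀' hs'
        (tendsto_abs_atBot_atTop.comp (EReal.tendsto_coe_nhds_bot_iff.1 hm)) x
    | top =>
      have : limDensity (⊤, (s₀ : EReal), l₀) x = 0 := by simp [limDensity]
      rw [this]
      exact tendsto_snDensity_of_loc h₀' hs'
        (tendsto_abs_atTop_atTop.comp (EReal.tendsto_coe_nhds_top_iff.1 hm)) x
    | coe m₀ =>
      have : limDensity ((m₀ : EReal), (s₀ : EReal), l₀) x = skewDensity m₀ s₀ l₀ x := by
        simp [limDensity]
      rw [this]
      exact tendsto_snDensity h₀' (EReal.tendsto_coe.1 hm) hs' hl (by simpa using hx)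

/-! ### Laplace transforms of sums of centred Gaussians -/

/-- The Gaussian tail as a Laplace transform. -/
lemma tail_eq_laplace {k : ℝ} (hk : 0 < k) (y : ℝ) :
    Real.exp (k ^ 2 * y ^ 2 / 2) * (1 - Φ (k * y)) =
      (√(2 * Real.pi))⁻¹ / k *
        ∫ r in Set.Ioi 0, Real.exp (-y * r) * Real.exp (-(2 * k ^ 2)⁻¹ * r ^ 2) := by
  have h1 : ∫ u in Set.Ioi (k * y), φ u = k⁻¹ * ∫ r in Set.Ioi 0, φ (k * y + r / k) := by
    rw [← integral_indicator measurableSet_Ioi, ← integral_indicator measurableSet_Ioi,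
      ← integral_add_left_eq_self _ (k * y)]
    have h2 := Measure.integral_comp_div (fun u => (Set.Ioi (k * y)).indicator φ (k * y + u)) k
    rw [abs_of_pos hk, smul_eq_mul] at h2
    have h3 : ∫ u, (Set.Ioi (k * y)).indicator φ (k * y + u) =
        k⁻¹ * ∫ u, (Set.Ioi (k * y)).indicator φ (k * y + u / k) := by
      rw [h2]; field_simp
    rw [h3]
    congr 2
    ext u
    simp only [Set.indicator, Set.mem_Ioi, lt_add_iff_pos_right]
    congr 1
    rw [eq_iff_iff, div_pos_iff_of_pos_right hk]
  rw [tail_eq, h1]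
  have h4 : ∀ r, φ (k * y + r / k) = (√(2 * Real.pi))⁻¹ * Real.exp (-(k ^ 2 * y ^ 2 / 2)) *
      (Real.exp (-y * r) * Real.exp (-(2 * k ^ 2)⁻¹ * r ^ 2)) := by
    intro r
    rw [pdf_eq, mul_assoc, ← Real.exp_add, ← Real.exp_add]
    congr 2
    field_simp
    ring
  simp_rw [h4, integral_const_mul]
  have h5 : Real.exp (k ^ 2 * y ^ 2 / 2) * Real.exp (-(k ^ 2 * y ^ 2 / 2)) = 1 := by
    rw [← Real.exp_add]; simp
  linear_combination ((√(2 * Real.pi))⁻¹ / k *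
        ∫ r in Set.Ioi 0, Real.exp (-y * r) * Real.exp (-(2 * k ^ 2)⁻¹ * r ^ 2)) * h5

lemma integrableOn_laplace {g : ℝ → ℝ} {B y : ℝ} (hg : Continuous g) (hB : ∀ r, |g r| ≤ B)
    (hy : 0 < y) (a : ℝ) : IntegrableOn (fun r => Real.exp (-y * r) * g r) (Set.Ioi a) := by
  have h := (integrableOn_exp_mul_Ioi (neg_lt_zero.2 hy) a).mul_const B
  refine h.mono' (by fun_prop) (Eventually.of_forall fun r => ?_)
  rw [norm_mul, Real.norm_of_nonneg (Real.exp_nonneg _)]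
  gcongr
  exact hB r

lemma abs_laplace_le {g : ℝ → ℝ} {B y : ℝ} (hB : ∀ r, |g r| ≤ B)
    (hy : 0 < y) (a : ℝ) :
    |∫ r in Set.Ioi a, Real.exp (-y * r) * g r| ≤ B * Real.exp (-y * a) / y := by
  have h := (integrableOn_exp_mul_Ioi (neg_lt_zero.2 hy) a).mul_const B
  refine (norm_integral_le_of_norm_le (f := fun r => Real.exp (-y * r) * g r) h (Eventually.of_forall fun r => ?_)).trans (le_of_eq ?_)
  · rw [norm_mul, Real.norm_of_nonneg (Real.exp_nonneg _)]
    gcongr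
    exact hB r
  · rw [integral_mul_const, integral_exp_mul_Ioi (neg_lt_zero.2 hy)]
    field_simp

/-- A Laplace transform of a bounded continuous function that is positive near `0` is not
exponentially small. -/
lemma not_isBigO_laplace {g : ℝ → ℝ} {B ε η : ℝ} (hg : Continuous g) (hB : ∀ r, |g r| ≤ B)
    (hη : 0 < η) (hηε : η ≤ ε) (hpos : ∀ r, 0 < r → r < η → 0 < g r) :
    ¬ (fun y => ∫ r in Set.Ioi 0, Real.exp (-y * r) * g r) =O[atTop]
      fun y => Real.exp (-ε * y) := by
  intro hO
  obtain ⟨C, hC⟩ := hO.bound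
  set c := ∫ r in Set.Ioc 0 (η / 2), g r with hc
  have hcpos : 0 < c := by
    have h := intervalIntegral.intervalIntegral_pos_of_pos_on (f := g) (a := 0) (b := η / 2)
      (hg.intervalIntegrable _ _) (fun r hr => hpos r hr.1 (by linarith [hr.2])) (by linarith)
    rwa [intervalIntegral.integral_of_le (by linarith)] at h
  -- On `(0, η / 2]` the transform is at least `c exp (-η y / 2)`, while the tail beyond `η` and the
  -- assumed bound are both `O(exp (-η y))`. Hence `c ≤ (B + C) exp (-η y / 2)` for all large `y`,
  -- which is impossible since `c > 0`.
  have hlim : Tendsto (fun y : ℝ => (B + C) * Real.exp (-(η / 2) * y)) atTop (𝓝 ((B + C) * 0)) := by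
    refine Tendsto.const_mul _ (Real.tendsto_exp_atBot.comp ?_)
    exact tendsto_id.const_mul_atTop_of_neg (by linarith)
  rw [mul_zero] at hlim
  have hB0 : 0 ≤ B := (abs_nonneg _).trans (hB 0)
  refine absurd (ge_of_tendsto hlim (b := c) ?_) (not_le.2 hcpos)
  filter_upwards [hC, eventually_ge_atTop 1] with y hy hy1
  have hy0 : 0 < y := by linarith
  have hint := fun a => integrableOn_laplace hg hB hy0 a
  have hC0 : 0 ≤ C := by
    by_contra! h
    have := (norm_nonneg _).trans hy
    rw [Real.norm_of_nonneg (Real.exp_nonneg _)] at this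
    nlinarith [Real.exp_pos (-ε * y)]
  have hsplit : ∫ r in Set.Ioi 0, Real.exp (-y * r) * g r =
      (∫ r in Set.Ioc 0 (η / 2), Real.exp (-y * r) * g r) +
      (∫ r in Set.Ioc (η / 2) η, Real.exp (-y * r) * g r) +
      ∫ r in Set.Ioi η, Real.exp (-y * r) * g r := by
    have hs := fun a b (hab : a ≤ b) => setIntegral_union (μ := volume)
      (f := fun r => Real.exp (-y * r) * g r)
      (Set.Ioc_disjoint_Ioi le_rfl : Disjoint (Set.Ioc a b) (Set.Ioi b)) measurableSet_Ioi
      ((hint a).mono_set Set.Ioc_subset_Ioi_self) (hint b)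
    have h1 := hs 0 (η / 2) (by linarith)
    have h2 := hs (η / 2) η (by linarith)
    rw [Set.Ioc_union_Ioi_eq_Ioi (by linarith)] at h1 h2
    rw [h1, h2]; ring
  have hfirst : Real.exp (-(η / 2) * y) * c ≤
      ∫ r in Set.Ioc 0 (η / 2), Real.exp (-y * r) * g r := by
    rw [hc, ← integral_const_mul]
    refine setIntegral_mono_on ((hg.integrableOn_Ioc).const_mul _)
      ((hint 0).mono_set Set.Ioc_subset_Ioi_self) measurableSet_Ioc fun r hr => ?_
    have := hpos r hr.1 (by linarith [hr.2])
    gcongr ?_ * _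
    rw [Real.exp_le_exp]
    nlinarith [hr.2]
  have hsecond : 0 ≤ ∫ r in Set.Ioc (η / 2) η, Real.exp (-y * r) * g r := by
    rw [integral_Ioc_eq_integral_Ioo]
    refine setIntegral_nonneg measurableSet_Ioo fun r hr => ?_
    have := hpos r (by linarith [hr.1]) hr.2
    positivity
  have hthird := (abs_le.1 (abs_laplace_le hB hy0 η)).1
  have hthird' : B * Real.exp (-y * η) / y ≤ B * Real.exp (-y * η) :=
    div_le_self (by positivity) hy1
  rw [Real.norm_eq_abs, Real.norm_of_nonneg (Real.exp_nonneg _)] at hy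
  have hup := (le_abs_self _).trans hy
  have hε : C * Real.exp (-ε * y) ≤ C * Real.exp (-y * η) := by
    gcongr ?_ * ?_
    rw [Real.exp_le_exp]; nlinarith
  have hkey : Real.exp (-(η / 2) * y) * c ≤ (B + C) * Real.exp (-y * η) := by linarith
  have hexp : Real.exp (-y * η) = Real.exp (-(η / 2) * y) * Real.exp (-(η / 2) * y) := by
    rw [← Real.exp_add]; congr 1; ring
  rw [hexp] at hkey
  have he := Real.exp_pos (-(η / 2) * y)
  nlinarith

/-- The functions `u ↦ exp (c u)` are distinct characters of the additive group `ℝ`, hence linearly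
independent by Dedekind's theorem. -/
lemma exp_sum_eq_zero {ι : Type*} {J : Finset ι} {b c : ι → ℝ} (hc : Set.InjOn c J)
    (h : ∀ u : ℝ, ∑ j ∈ J, b j * Real.exp (c j * u) = 0) : ∀ j ∈ J, b j = 0 := by
  let χ : ι → (Multiplicative ℝ →* ℝ) := fun j =>
    { toFun := fun u => Real.exp (c j * u.toAdd)
      map_one' := by simp
      map_mul' := fun u v => by simp [mul_add, Real.exp_add] }
  have hχ : Function.Injective fun j : J => χ j := by
    intro i j hij
    have h1 := DFunLike.congr_fun hij (Multiplicative.ofAdd (1 : ℝ))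
    simp only [χ, MonoidHom.coe_mk, OneHom.coe_mk, toAdd_ofAdd, mul_one] at h1
    exact Subtype.ext (hc i.2 j.2 (Real.exp_injective h1))
  have hli := (linearIndependent_monoidHom (Multiplicative ℝ) ℝ).comp _ hχ
  rw [Fintype.linearIndependent_iff] at hli
  intro j hj
  refine hli (fun j => b j) ?_ ⟨j, hj⟩
  ext u
  simp only [Function.comp_apply, Finset.sum_apply, Pi.smul_apply, smul_eq_mul, Pi.zero_apply]
  rw [← h u.toAdd, ← Finset.sum_coe_sort J]
  rfl

/-- In the variable `u = r ^ 2` the sum is analytic and not identically zero, so `0` is not an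
accumulation point of its zeros and its sign is constant just to the right of `0`. -/
lemma gaussian_sum_sign {ι : Type*} {J : Finset ι} {b c : ι → ℝ} (hc : Set.InjOn c J)
    (hb : ∃ j ∈ J, b j ≠ 0) {ε : ℝ} (hε : 0 < ε) :
    ∃ η, 0 < η ∧ η ≤ ε ∧ ((∀ r, 0 < r → r < η → 0 < ∑ j ∈ J, b j * Real.exp (c j * r ^ 2)) ∨
      ∀ r, 0 < r → r < η → ∑ j ∈ J, b j * Real.exp (c j * r ^ 2) < 0) := by
  set K : ℝ → ℝ := fun u => ∑ j ∈ J, b j * Real.exp (c j * u) with hK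
  have hcont : Continuous K := by fun_prop
  have han : AnalyticOnNhd ℝ K Set.univ := by
    intro u _
    refine Finset.analyticAt_fun_sum _ fun j _ => ?_
    exact analyticAt_const.mul ((analyticAt_const.mul analyticAt_id).rexp)
  have hne : ∀ᶠ u in 𝓝[≠] (0 : ℝ), K u ≠ 0 := by
    rcases (han 0 trivial).eventually_eq_zero_or_eventually_ne_zero with h | h
    · exfalso
      have h0 := han.eqOn_zero_of_preconnected_of_eventuallyEq_zero isPreconnected_univ trivial h
      obtain ⟨j, hj, hbj⟩ := hb
      exact hbj (exp_sum_eq_zero hc (fun u => h0 (Set.mem_univ u)) j hj)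
    · exact h
  have hne' : ∀ᶠ u in 𝓝[>] (0 : ℝ), K u ≠ 0 :=
    hne.filter_mono (nhdsWithin_mono _ fun u hu => ne_of_gt hu)
  obtain ⟨δ, hδ, hKδ⟩ := (mem_nhdsGT_iff_exists_Ioo_subset).1 hne'
  have hδ : 0 < δ := hδ
  refine ⟨min ε (√δ), lt_min hε (Real.sqrt_pos.2 hδ), min_le_left _ _, ?_⟩
  have hsq : ∀ r, 0 < r → r < min ε (√δ) → r ^ 2 ∈ Set.Ioo 0 δ := fun r hr hr' =>
    ⟨by positivity, (Real.lt_sqrt hr.le).1 (hr'.trans_le (min_le_right _ _))⟩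
  have hsign : (∀ u ∈ Set.Ioo 0 δ, 0 < K u) ∨ ∀ u ∈ Set.Ioo 0 δ, K u < 0 := by
    by_contra! hcon
    obtain ⟨⟨u, hu, hKu⟩, v, hv, hKv⟩ := hcon
    obtain ⟨w, hw, hw0⟩ := (isPreconnected_Ioo.image K hcont.continuousOn).ordConnected.out
      ⟨u, hu, rfl⟩ ⟨v, hv, rfl⟩ ⟨hKu, hKv⟩
    exact hKδ hw hw0
  exact hsign.imp (fun h r hr hr' => h _ (hsq r hr hr')) fun h r hr hr' => h _ (hsq r hr hr')

lemma laplace_gaussian_sum_eq_zero {ι : Type*} {J : Finset ι} {b c : ι → ℝ} (hc : Set.InjOn c J)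
    (hneg : ∀ j ∈ J, c j ≤ 0) {ε : ℝ} (hε : 0 < ε)
    (h : (fun y => ∫ r in Set.Ioi 0, Real.exp (-y * r) * ∑ j ∈ J, b j * Real.exp (c j * r ^ 2))
      =O[atTop] fun y => Real.exp (-ε * y)) : ∀ j ∈ J, b j = 0 := by
  by_contra! hb
  obtain ⟨η, hη, hηε, hsign⟩ := gaussian_sum_sign hc hb hε
  have hbound : ∀ r, |∑ j ∈ J, b j * Real.exp (c j * r ^ 2)| ≤ ∑ j ∈ J, |b j| := by
    intro r
    refine (Finset.abs_sum_le_sum_abs _ _).trans (Finset.sum_le_sum fun j hj => ?_)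
    rw [abs_mul, Real.abs_exp]
    refine mul_le_of_le_one_right (abs_nonneg _) (Real.exp_le_one_iff.2 ?_)
    exact mul_nonpos_of_nonpos_of_nonneg (hneg j hj) (sq_nonneg r)
  rcases hsign with hs | hs
  · exact not_isBigO_laplace (by fun_prop) hbound hη hηε hs h
  · refine not_isBigO_laplace (g := fun r => -∑ j ∈ J, b j * Real.exp (c j * r ^ 2))
      (by fun_prop) (fun r => by rw [abs_neg]; exact hbound r) hη hηε
      (fun r hr hr' => neg_pos.2 (hs r hr hr')) ?_
    simpa only [mul_neg, integral_neg] using h.neg_left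

/-- Distinct scaled Mills ratios are linearly independent modulo exponentially small functions. -/
lemma mills_sum_eq_zero_of_pos {ι : Type*} {J : Finset ι} {b k : ι → ℝ} (hk : Set.InjOn k J)
    (hpos : ∀ j ∈ J, 0 < k j) {ε : ℝ} (hε : 0 < ε)
    (h : (fun y => ∑ j ∈ J, b j * (Real.exp (k j ^ 2 * y ^ 2 / 2) * (1 - Φ (k j * y))))
      =O[atTop] fun y => Real.exp (-ε * y)) : ∀ j ∈ J, b j = 0 := by
  have hc : Set.InjOn (fun j => -(2 * k j ^ 2)⁻¹) J := by
    intro i hi j hj hij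
    have hi' := hpos i hi
    have hj' := hpos j hj
    have h1 : 2 * k i ^ 2 = 2 * k j ^ 2 := inv_injective (neg_injective hij)
    exact hk hi hj ((sq_eq_sq₀ hi'.le hj'.le).1 (by linarith))
  have key := laplace_gaussian_sum_eq_zero (b := fun j => b j * ((√(2 * Real.pi))⁻¹ / k j)) hc
    (fun j _ => by simp; positivity) hε ?_
  · intro j hj
    have h1 := key j hj
    have h2 : (√(2 * Real.pi))⁻¹ / k j ≠ 0 := by
      have := hpos j hj
      have := Real.pi_pos
      positivity
    exact (mul_eq_zero.1 h1).resolve_right h2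
  · refine h.congr' ?_ EventuallyEq.rfl
    filter_upwards [eventually_gt_atTop 0] with y hy
    simp_rw [Finset.mul_sum]
    rw [integral_finsetSum]
    · refine Finset.sum_congr rfl fun j hj => ?_
      rw [tail_eq_laplace (hpos j hj), ← mul_assoc, ← integral_const_mul]
      congr 1; ext r; ring
    · intro j _
      refine integrableOn_laplace (B := |b j * ((√(2 * Real.pi))⁻¹ / k j)|) (by fun_prop)
        (fun r => ?_) hy 0
      rw [abs_mul, Real.abs_exp]
      refine mul_le_of_le_one_right (abs_nonneg _) (Real.exp_le_one_iff.2 ?_)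
      have : 0 ≤ (2 * k j ^ 2)⁻¹ * r ^ 2 := by positivity
      linarith

lemma tendsto_mills {k : ℝ} (hk : 0 < k) :
    Tendsto (fun y => Real.exp (k ^ 2 * y ^ 2 / 2) * (1 - Φ (k * y))) atTop (𝓝 0) := by
  have h1 : Tendsto (fun y : ℝ => (√(2 * Real.pi))⁻¹ / k * y⁻¹) atTop (𝓝 0) := by
    simpa using tendsto_inv_atTop_zero.const_mul ((√(2 * Real.pi))⁻¹ / k)
  refine squeeze_zero' ?_ ?_ h1
  · exact Eventually.of_forall fun y => mul_nonneg (Real.exp_nonneg _) (tail_pos _).le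
  · filter_upwards [eventually_gt_atTop 0] with y hy
    rw [tail_eq_laplace hk]
    have h2 := (le_abs_self _).trans
      (abs_laplace_le (g := fun r => Real.exp (-(2 * k ^ 2)⁻¹ * r ^ 2)) (B := 1) (fun r => ?_) hy 0)
    · gcongr
      simpa using h2
    · rw [Real.abs_exp, Real.exp_le_one_iff]
      have : 0 ≤ (2 * k ^ 2)⁻¹ * r ^ 2 := by positivity
      linarith

/-- The rate `k = 0` has no Laplace representation, but its term is the constant `1 / 2`, whereas
all other terms tend to `0`. Passing to the limit kills its coefficient and leaves the case of
positive rates. -/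
lemma mills_sum_eq_zero {ι : Type*} {J : Finset ι} {b k : ι → ℝ} (hk : Set.InjOn k J)
    (hnonneg : ∀ j ∈ J, 0 ≤ k j) {ε : ℝ} (hε : 0 < ε)
    (h : (fun y => ∑ j ∈ J, b j * (Real.exp (k j ^ 2 * y ^ 2 / 2) * (1 - Φ (k j * y))))
      =O[atTop] fun y => Real.exp (-ε * y)) : ∀ j ∈ J, b j = 0 := by
  classical
  have hexp : Tendsto (fun y : ℝ => Real.exp (-ε * y)) atTop (𝓝 0) :=
    Real.tendsto_exp_atBot.comp (tendsto_id.const_mul_atTop_of_neg (by linarith))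
  have hlim := h.trans_tendsto hexp
  have hlim' : Tendsto
      (fun y => ∑ j ∈ J, b j * (Real.exp (k j ^ 2 * y ^ 2 / 2) * (1 - Φ (k j * y)))) atTop
      (𝓝 (∑ j ∈ J, b j * if k j = 0 then 1 / 2 else 0)) := by
    refine tendsto_finsetSum _ fun j hj => Tendsto.const_mul _ ?_
    split_ifs with h0
    · simp only [h0, zero_mul, cdf_zero]
      norm_num
    · exact tendsto_mills (lt_of_le_of_ne (hnonneg j hj) (Ne.symm h0))
  have hzero : ∀ j ∈ J, k j = 0 → b j = 0 := by
    intro j hj hkj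
    have h1 := tendsto_nhds_unique hlim hlim'
    rw [Finset.sum_eq_single_of_mem j hj] at h1
    · rw [if_pos hkj] at h1; linarith
    · intro i hi hij
      rw [if_neg, mul_zero]
      exact fun h0 => hij (hk hi hj (h0.trans hkj.symm))
  have hrest := mills_sum_eq_zero_of_pos (J := J.filter fun j => k j ≠ 0) (b := b)
    (hk.mono (Finset.coe_subset.2 (Finset.filter_subset _ _))) (fun j hj => ?_) hε ?_
  · intro j hj
    by_cases h0 : k j = 0
    · exact hzero j hj h0
    · exact hrest j (Finset.mem_filter.2 ⟨hj, h0⟩)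
  · rw [Finset.mem_filter] at hj
    exact lt_of_le_of_ne (hnonneg j hj.1) (Ne.symm hj.2)
  · refine h.congr_left fun y => ?_
    rw [Finset.sum_filter]
    refine Finset.sum_congr rfl fun j hj => ?_
    split_ifs with h0
    · rfl
    · rw [hzero j hj (not_not.1 h0), zero_mul]

/-! ### Linear independence of Gaussian functions times Gaussian tails -/

/-- The function `exp(-a (x - m)²) (1 - Φ(k (x - m)))`, for `j = (m, a, k)`. -/
noncomputable def gaussianTail (j : ℝ × ℝ × ℝ) (x : ℝ) : ℝ :=
  Real.exp (-j.2.1 * (x - j.1) ^ 2) * (1 - Φ (j.2.2 * (x - j.1)))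

/-- `f` is exponentially small at `∞`. -/
def ExpSmall (f : ℝ → ℝ) : Prop :=
  ∃ ε, 0 < ε ∧ f =O[atTop] fun y => Real.exp (-ε * y)

lemma ExpSmall.add {f g : ℝ → ℝ} (hf : ExpSmall f) (hg : ExpSmall g) :
    ExpSmall fun y => f y + g y := by
  obtain ⟨ε, hε, hf⟩ := hf
  obtain ⟨δ, hδ, hg⟩ := hg
  have key : ∀ a b : ℝ, a ≤ b →
      (fun y => Real.exp (-b * y)) =O[atTop] fun y => Real.exp (-a * y) := by
    intro a b hab
    refine IsBigO.of_bound 1 ?_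
    filter_upwards [eventually_ge_atTop 0] with y hy
    rw [one_mul, Real.norm_of_nonneg (Real.exp_nonneg _), Real.norm_of_nonneg (Real.exp_nonneg _),
      Real.exp_le_exp]
    nlinarith
  exact ⟨min ε δ, lt_min hε hδ, (hf.trans (key _ _ (min_le_left _ _))).add
    (hg.trans (key _ _ (min_le_right _ _)))⟩

lemma expSmall_zero : ExpSmall fun _ => 0 := ⟨1, one_pos, isBigO_zero _ _⟩

lemma ExpSmall.sum {ι : Type*} {J : Finset ι} {f : ι → ℝ → ℝ} (h : ∀ j ∈ J, ExpSmall (f j)) :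
    ExpSmall fun y => ∑ j ∈ J, f j y := by
  induction J using Finset.cons_induction with
  | empty => simpa using expSmall_zero
  | cons i J hi ih =>
    simp_rw [Finset.sum_cons]
    exact (h i (Finset.mem_cons_self _ _)).add (ih fun j hj => h j (Finset.mem_cons_of_mem hj))

lemma mills_isBigO_one {k : ℝ} (hk : 0 ≤ k) :
    (fun y => Real.exp (k ^ 2 * y ^ 2 / 2) * (1 - Φ (k * y))) =O[atTop] fun _ => (1 : ℝ) := by
  rcases hk.eq_or_lt with rfl | hk
  · simp only [zero_mul, cdf_zero]
    exact isBigO_of_le' (c := 1) _ fun y => by norm_num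
  · exact (tendsto_mills hk).isBigO_one ℝ

/-- Up to a bounded Mills ratio, the tail is `exp (-β (x - m) ^ 2)` with `β = a + k ^ 2 / 2`.
Relative to exponent `β₀` and centre `m₀` it is negligible at `+∞` if its exponent is larger, or if
the exponents agree and its centre lies further left. -/
lemma expSmall_gaussianTail {m₀ β₀ m a k : ℝ} (ha : 0 < a) (hk : 0 ≤ k)
    (hlt : β₀ < a + k ^ 2 / 2 ∨ β₀ = a + k ^ 2 / 2 ∧ m < m₀) :
    ExpSmall fun y => Real.exp (β₀ * y ^ 2) * gaussianTail (m, a, k) (y + m₀) := by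
  set β := a + k ^ 2 / 2 with hβ
  have hβpos : 0 < β := by positivity
  set d := m₀ - m with hd
  obtain ⟨ε, hε, hexp⟩ : ∃ ε, 0 < ε ∧ ∀ᶠ y in atTop, β₀ * y ^ 2 - β * (y + d) ^ 2 ≤ -ε * y := by
    rcases hlt with h | ⟨h, hm⟩
    · refine ⟨1, one_pos, ?_⟩
      filter_upwards [eventually_ge_atTop ((1 + 2 * β * |d|) / (β - β₀)),
        eventually_ge_atTop 0] with y hy hy0
      rw [div_le_iff₀ (by linarith)] at hy
      have h1 : -(|d| * y) ≤ d * y := by nlinarith [neg_abs_le d]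
      nlinarith [sq_nonneg d, mul_nonneg hβpos.le (sq_nonneg d)]
    · refine ⟨2 * β * d, by have : 0 < d := by linarith
                            positivity, Eventually.of_forall fun y => ?_⟩
      rw [h]
      nlinarith [mul_nonneg hβpos.le (sq_nonneg d)]
  refine ⟨ε, hε, ?_⟩
  have hshift : Tendsto (fun y : ℝ => y + d) atTop atTop :=
    tendsto_atTop_add_const_right _ _ tendsto_id
  have h1 := (mills_isBigO_one hk).comp_tendsto hshift
  have h2 : (fun y => Real.exp (β₀ * y ^ 2 - β * (y + d) ^ 2)) =O[atTop]
      fun y => Real.exp (-ε * y) := by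
    refine IsBigO.of_bound 1 ?_
    filter_upwards [hexp] with y hy
    rw [one_mul, Real.norm_of_nonneg (Real.exp_nonneg _), Real.norm_of_nonneg (Real.exp_nonneg _),
      Real.exp_le_exp]
    exact hy
  refine (h2.mul h1).congr_left ?_ |>.trans
    (by simpa using isBigO_refl (fun y => Real.exp (-ε * y)) atTop)
  intro y
  simp only [Function.comp_apply, gaussianTail]
  have hyd : y + m₀ - m = y + d := by rw [hd]; ring
  rw [hyd, ← mul_assoc, ← mul_assoc, ← Real.exp_add, ← Real.exp_add]
  congr 2
  rw [hβ]; ring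

/-- Among the terms with nonzero coefficient, take those of slowest decay: least exponent `a + k ^ 2
/ 2`, then rightmost centre. After recentring and rescaling, all others are exponentially small, and
the selected ones are Mills ratios with distinct rates, since `a` is determined by `k` and the
common exponent. -/
lemma gaussianTail_sum_eq_zero {J : Finset (ℝ × ℝ × ℝ)} {b : ℝ × ℝ × ℝ → ℝ}
    (ha : ∀ j ∈ J, 0 < j.2.1) (hk : ∀ j ∈ J, 0 ≤ j.2.2)
    (h : ∀ᶠ x in atTop, ∑ j ∈ J, b j * gaussianTail j x = 0) : ∀ j ∈ J, b j = 0 := by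
  classical
  by_contra! hb
  obtain ⟨j₁, hj₁, hbj₁⟩ := hb
  set J' := J.filter fun j => b j ≠ 0 with hJ'
  obtain ⟨j₀, hj₀, hmax⟩ := J'.exists_max_image
    (fun j => toLex (-(j.2.1 + j.2.2 ^ 2 / 2), j.1)) ⟨j₁, Finset.mem_filter.2 ⟨hj₁, hbj₁⟩⟩
  set m₀ := j₀.1 with hm₀
  set β₀ := j₀.2.1 + j₀.2.2 ^ 2 / 2 with hβ₀
  set G := J'.filter fun j => j.1 = m₀ ∧ j.2.1 + j.2.2 ^ 2 / 2 = β₀ with hG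
  set R := J'.filter fun j => ¬ (j.1 = m₀ ∧ j.2.1 + j.2.2 ^ 2 / 2 = β₀) with hR
  have hmemJ : ∀ j ∈ J', j ∈ J := fun j hj => (Finset.mem_filter.1 hj).1
  have hsmall : ExpSmall fun y => ∑ j ∈ R, b j * (Real.exp (β₀ * y ^ 2) *
      gaussianTail j (y + m₀)) := by
    refine ExpSmall.sum fun j hj => ?_
    obtain ⟨hjJ', hjne⟩ := Finset.mem_filter.1 hj
    have hle := hmax j hjJ'
    rw [Prod.Lex.toLex_le_toLex] at hle
    have hsm := expSmall_gaussianTail (m₀ := m₀) (β₀ := β₀) (m := j.1) (ha j (hmemJ j hjJ'))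
      (hk j (hmemJ j hjJ')) ?_
    · obtain ⟨ε, hε, hO⟩ := hsm
      exact ⟨ε, hε, hO.const_mul_left _⟩
    · rcases hle with hlt | ⟨heq, hle⟩
      · left; simpa using hlt
      · right
        have heq' : j.2.1 + j.2.2 ^ 2 / 2 = β₀ := neg_injective heq
        exact ⟨heq'.symm, lt_of_le_of_ne hle fun h => hjne ⟨h, heq'⟩⟩
  have hgroup : ∀ᶠ y in atTop, ∑ j ∈ R, b j * (Real.exp (β₀ * y ^ 2) * gaussianTail j (y + m₀)) =
      -∑ j ∈ G, b j * (Real.exp (j.2.2 ^ 2 * y ^ 2 / 2) * (1 - Φ (j.2.2 * y))) := by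
    have hshift : Tendsto (fun y : ℝ => y + m₀) atTop atTop :=
      tendsto_atTop_add_const_right _ _ tendsto_id
    filter_upwards [hshift.eventually h] with y hy
    have h1 : ∑ j ∈ J', b j * gaussianTail j (y + m₀) = 0 := by
      rw [← hy, hJ', Finset.sum_filter]
      refine Finset.sum_congr rfl fun j _ => ?_
      split_ifs with h0
      · rfl
      · rw [not_not.1 h0, zero_mul]
    rw [← Finset.sum_filter_add_sum_filter_not J'
      (fun j => j.1 = m₀ ∧ j.2.1 + j.2.2 ^ 2 / 2 = β₀), ← hG, ← hR] at h1
    have h2 : ∑ j ∈ G, b j * (Real.exp (j.2.2 ^ 2 * y ^ 2 / 2) * (1 - Φ (j.2.2 * y))) =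
        Real.exp (β₀ * y ^ 2) * ∑ j ∈ G, b j * gaussianTail j (y + m₀) := by
      rw [Finset.mul_sum]
      refine Finset.sum_congr rfl fun j hj => ?_
      obtain ⟨hjm, hjβ⟩ := (Finset.mem_filter.1 hj).2
      rw [gaussianTail, hjm, add_sub_cancel_right, ← hjβ]
      have : Real.exp (j.2.2 ^ 2 * y ^ 2 / 2) =
          Real.exp ((j.2.1 + j.2.2 ^ 2 / 2) * y ^ 2) * Real.exp (-j.2.1 * y ^ 2) := by
        rw [← Real.exp_add]; congr 1; ring
      rw [this]; ring
    have h3 : ∑ j ∈ R, b j * (Real.exp (β₀ * y ^ 2) * gaussianTail j (y + m₀)) =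
        Real.exp (β₀ * y ^ 2) * ∑ j ∈ R, b j * gaussianTail j (y + m₀) := by
      rw [Finset.mul_sum]
      exact Finset.sum_congr rfl fun j _ => by ring
    rw [h2, h3]
    linear_combination Real.exp (β₀ * y ^ 2) * h1
  obtain ⟨ε, hε, hO⟩ := hsmall
  have hO' := (hO.congr' hgroup EventuallyEq.rfl).neg_left
  simp only [neg_neg] at hO'
  have hinj : Set.InjOn (fun j : ℝ × ℝ × ℝ => j.2.2) G := by
    intro i hi j hj hij
    obtain ⟨hi1, hi2⟩ := (Finset.mem_filter.1 hi).2
    obtain ⟨hj1, hj2⟩ := (Finset.mem_filter.1 hj).2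
    simp only at hij
    rw [hij] at hi2
    exact Prod.ext (hi1.trans hj1.symm) (Prod.ext (by linarith) hij)
  have hz := mills_sum_eq_zero hinj
    (fun j hj => hk j (hmemJ j (Finset.mem_filter.1 hj).1)) hε hO' j₀
    (Finset.mem_filter.2 ⟨hj₀, rfl, rfl⟩)
  exact (Finset.mem_filter.1 hj₀).2 hz

/-- Version for indexed families in which several terms may be the same function: only the total
coefficient of each function must vanish. -/
lemma gaussianTail_fiber_sum_eq_zero {κ : Type*} [Fintype κ] {key : κ → ℝ × ℝ × ℝ} {c : κ → ℝ}
    (ha : ∀ i, 0 < (key i).2.1) (hk : ∀ i, 0 ≤ (key i).2.2)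
    (h : ∀ᶠ x in atTop, ∑ i, c i * gaussianTail (key i) x = 0) (j : ℝ × ℝ × ℝ) :
    ∑ i, (if key i = j then c i else 0) = 0 := by
  classical
  have hz := gaussianTail_sum_eq_zero (J := Finset.univ.image key)
    (b := fun j => ∑ i, if key i = j then c i else 0) (by simpa using ha) (by simpa using hk) ?_
  · by_cases hj : j ∈ Finset.univ.image key
    · exact hz j hj
    · refine Finset.sum_eq_zero fun i _ => if_neg fun hi => hj ?_
      exact Finset.mem_image.2 ⟨i, Finset.mem_univ i, hi⟩
  · filter_upwards [h] with x hx
    refine Eq.trans ?_ hx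
    simp_rw [Finset.sum_mul]
    rw [Finset.sum_comm]
    refine Finset.sum_congr rfl fun i _ => ?_
    rw [Finset.sum_eq_single_of_mem (key i) (Finset.mem_image_of_mem _ (Finset.mem_univ i))]
    · simp
    · intro j _ hj
      rw [if_neg (Ne.symm hj), zero_mul]

/-! ### Linear relations between skew-normal densities -/

/-- Twice the limit at `∞` of `skewFactor l`. -/
noncomputable def limitFactor (l : EReal) : ℝ := if 0 < l then 2 else if l = 0 then 1 else 0

/-- The coefficient of the Gaussian tail in `skewFactor l` near `∞`. -/
noncomputable def tailCoeff (l : EReal) : ℝ :=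
  if l = ⊤ ∨ l = ⊥ ∨ l = 0 then 0 else if 0 < l then -1 else 1

lemma limitFactor_add_neg (l : EReal) : limitFactor l + limitFactor (-l) = 2 := by
  rcases lt_trichotomy l 0 with h | h | h
  · have h' : 0 < -l := by simpa using EReal.neg_lt_neg_iff.2 h
    simp [limitFactor, h', h.not_gt, h.ne]
  · simp [limitFactor, h]; norm_num
  · have h' : ¬ 0 < -l := by
      have : -l < 0 := by simpa using EReal.neg_lt_neg_iff.2 h
      exact this.not_gt
    have h'' : -l ≠ 0 := by
      have : -l < 0 := by simpa using EReal.neg_lt_neg_iff.2 h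
      exact this.ne
    simp [limitFactor, h, h', h'']

/-- The constant is written as a multiple of `1 - Φ (0 * t) = 1 / 2`, so that both terms are
Gaussian tails. For infinite shapes `toReal` is `0`, which is harmless because `tailCoeff` vanishes.
-/
lemma skewFactor_eq_of_pos (l : EReal) {t : ℝ} (ht : 0 < t) :
    skewFactor l t = limitFactor l * (1 - Φ (0 * t)) + tailCoeff l * (1 - Φ (|l.toReal| * t)) := by
  rw [zero_mul, cdf_zero]
  induction l with
  | top => simp [skewFactor, limitFactor, tailCoeff, ht]; norm_num
  | bot => simp [skewFactor, limitFactor, tailCoeff, ht.le]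
  | coe l =>
    rw [skewFactor_coe]
    rcases lt_trichotomy l 0 with h | h | h
    · have h1 : ¬ (0 : EReal) < (l : EReal) := by
        simpa using h.le
      simp [limitFactor, tailCoeff, h1, h.ne, abs_of_neg h, cdf_neg]
    · simp [limitFactor, tailCoeff, h, cdf_zero]; norm_num
    · have h1 : (0 : EReal) < (l : EReal) := by simpa using h
      simp [limitFactor, tailCoeff, h1, h.ne', abs_of_pos h]; norm_num

lemma skewDensity_eq_gaussianTail {m s x : ℝ} (l : EReal) (hs : 0 < s) (hx : m < x) :
    skewDensity m s l x = 2 / s * (√(2 * Real.pi))⁻¹ *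
      (limitFactor l * gaussianTail (m, (2 * s ^ 2)⁻¹, 0) x +
        tailCoeff l * gaussianTail (m, (2 * s ^ 2)⁻¹, |l.toReal| / s) x) := by
  rw [skewDensity, skewFactor_eq_of_pos l (div_pos (sub_pos.2 hx) hs), pdf_eq]
  simp only [gaussianTail, zero_mul]
  have h1 : -((x - m) / s) ^ 2 / 2 = -(2 * s ^ 2)⁻¹ * (x - m) ^ 2 := by field_simp
  have h2 : |l.toReal| * ((x - m) / s) = |l.toReal| / s * (x - m) := by ring
  rw [h1, h2]; ring

section Relations

variable {ι : Type*} [Fintype ι] {a m s : ι → ℝ} {l : ι → EReal}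

lemma skew_relation_atTop (hs : ∀ i, 0 < s i)
    (h : ∀ᶠ x in atTop, ∑ i, a i * skewDensity (m i) (s i) (l i) x = 0) {μ σ : ℝ} (hσ : 0 < σ) :
    ∑ i, (if m i = μ ∧ s i = σ then a i * limitFactor (l i) else 0) = 0 ∧
    ∀ t : ℝ, 0 < t →
      ∑ i, (if m i = μ ∧ s i = σ ∧ |(l i).toReal| = t then a i * tailCoeff (l i) else 0) = 0 := by
  have hκ : (√(2 * Real.pi))⁻¹ ≠ 0 := by
    have := Real.pi_pos
    positivity
  set key : ι ⊕ ι → ℝ × ℝ × ℝ := Sum.elim (fun i => (m i, (2 * s i ^ 2)⁻¹, 0))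
    (fun i => (m i, (2 * s i ^ 2)⁻¹, |(l i).toReal| / s i)) with hkey
  set c : ι ⊕ ι → ℝ :=
    Sum.elim (fun i => a i * (2 / s i * (√(2 * Real.pi))⁻¹) * limitFactor (l i))
    (fun i => a i * (2 / s i * (√(2 * Real.pi))⁻¹) * tailCoeff (l i)) with hc
  have hfib := gaussianTail_fiber_sum_eq_zero (key := key) (c := c)
    (by rintro (i | i) <;> have := hs i <;> simp [key] <;> positivity)
    (by rintro (i | i) <;> have := hs i <;> simp [key] <;> positivity) (by
      have hlarge : ∀ᶠ x in atTop, ∀ i, m i < x := eventually_all.2 fun i => eventually_gt_atTop _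
      filter_upwards [h, hlarge] with x hx hxm
      rw [← hx, Fintype.sum_sum_type, ← Finset.sum_add_distrib]
      refine Finset.sum_congr rfl fun i _ => ?_
      rw [skewDensity_eq_gaussianTail (l i) (hs i) (hxm i)]
      simp only [c, key, Sum.elim_inl, Sum.elim_inr]
      ring)
  have hscale : ∀ i, (2 * s i ^ 2)⁻¹ = (2 * σ ^ 2)⁻¹ ↔ s i = σ := by
    intro i
    rw [inv_inj, mul_right_inj' two_ne_zero, sq_eq_sq₀ (hs i).le hσ.le]
  have hfactor : 2 / σ * (√(2 * Real.pi))⁻¹ ≠ 0 := mul_ne_zero (by positivity) hκ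
  -- A tail term of rate `0` would have the same key as a constant term, but it occurs only for
  -- shapes `0` and `±∞`, where its coefficient is zero. Thus the two kinds of relation do not mix.
  have hl0 : ∀ i, |(l i).toReal| / s i = 0 → tailCoeff (l i) = 0 := by
    intro i hi
    have h0 : (l i).toReal = 0 := by
      rcases div_eq_zero_iff.1 hi with h | h
      · exact abs_eq_zero.1 h
      · exact absurd h (hs i).ne'
    rw [tailCoeff, if_pos]
    rcases EReal.toReal_eq_zero_iff.1 h0 with h | h | h <;> simp [h]
  constructor
  · have h1 := hfib (μ, (2 * σ ^ 2)⁻¹, 0)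
    rw [Fintype.sum_sum_type] at h1
    have h2 : ∑ i, (if key (Sum.inr i) = (μ, (2 * σ ^ 2)⁻¹, 0) then c (Sum.inr i) else 0) = 0 := by
      refine Finset.sum_eq_zero fun i _ => ?_
      split_ifs with hi
      · simp only [key, Sum.elim_inr, Prod.mk.injEq] at hi
        simp only [c, Sum.elim_inr, hl0 i hi.2.2, mul_zero]
      · rfl
    rw [h2, add_zero] at h1
    refine (mul_eq_zero.1 (?_ : 2 / σ * (√(2 * Real.pi))⁻¹ * _ = 0)).resolve_left hfactor
    refine Eq.trans ?_ h1
    rw [Finset.mul_sum]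
    refine Finset.sum_congr rfl fun i _ => ?_
    simp only [key, c, Sum.elim_inl, Prod.mk.injEq, and_true, hscale]
    split_ifs with hi
    · rw [hi.2]; ring
    · ring
  · intro t ht
    have h1 := hfib (μ, (2 * σ ^ 2)⁻¹, t / σ)
    rw [Fintype.sum_sum_type] at h1
    have h2 : ∑ i, (if key (Sum.inl i) = (μ, (2 * σ ^ 2)⁻¹, t / σ) then c (Sum.inl i) else 0)
        = 0 := by
      refine Finset.sum_eq_zero fun i _ => if_neg fun hi => ?_
      simp only [key, Sum.elim_inl, Prod.mk.injEq] at hi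
      exact (div_pos ht hσ).ne hi.2.2
    rw [h2, zero_add] at h1
    refine (mul_eq_zero.1 (?_ : 2 / σ * (√(2 * Real.pi))⁻¹ * _ = 0)).resolve_left hfactor
    refine Eq.trans ?_ h1
    rw [Finset.mul_sum]
    refine Finset.sum_congr rfl fun i _ => ?_
    have hiff : (m i = μ ∧ s i = σ ∧ |(l i).toReal| / s i = t / σ) ↔
        (m i = μ ∧ s i = σ ∧ |(l i).toReal| = t) := by
      refine and_congr_right fun _ => and_congr_right fun h => ?_
      rw [h, div_left_inj' hσ.ne']
    simp only [key, c, Sum.elim_inr, Prod.mk.injEq, hscale, hiff]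
    split_ifs with hi
    · rw [hi.2.1]; ring
    · ring

lemma continuousAt_skewDensity {m s x : ℝ} (l : EReal) (hs : 0 < s) (hx : x ≠ m) :
    ContinuousAt (skewDensity m s l) x := by
  have h1 : ContinuousAt (fun y : ℝ => (y - m) / s) x := by fun_prop
  have h0 : (x - m) / s ≠ 0 := div_ne_zero (sub_ne_zero.2 hx) hs.ne'
  have h2 : ContinuousAt (skewFactor l) ((x - m) / s) := by
    induction l with
    | coe l =>
      have : skewFactor l = fun t => Φ (l * t) := funext fun t => skewFactor_coe l t
      rw [this]
      exact (continuous_cdf_std.comp (continuous_const.mul continuous_id)).continuousAt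
    | top =>
      rcases lt_or_gt_of_ne h0 with h | h
      · refine (continuousAt_const (y := (0 : ℝ))).congr ?_
        filter_upwards [gt_mem_nhds h] with t ht using by simp [skewFactor, ht.le]
      · refine (continuousAt_const (y := (1 : ℝ))).congr ?_
        filter_upwards [lt_mem_nhds h] with t ht using by simp [skewFactor, ht]
    | bot =>
      rcases lt_or_gt_of_ne h0 with h | h
      · refine (continuousAt_const (y := (1 : ℝ))).congr ?_
        filter_upwards [gt_mem_nhds h] with t ht using by simp [skewFactor, ht]
      · refine (continuousAt_const (y := (0 : ℝ))).congr ?_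
        filter_upwards [lt_mem_nhds h] with t ht using by simp [skewFactor, ht.le]
  exact (continuousAt_const.mul (continuous_pdf.continuousAt.comp h1)).mul
    (ContinuousAt.comp (g := skewFactor l) h2 h1)

/-- The sum is continuous away from the locations, and a set of full measure is dense. -/
lemma skew_relation_of_ae (hs : ∀ i, 0 < s i)
    (h : ∀ᵐ x, ∑ i, a i * skewDensity (m i) (s i) (l i) x = 0) {x : ℝ} (hx : ∀ i, x ≠ m i) :
    ∑ i, a i * skewDensity (m i) (s i) (l i) x = 0 := by
  have hcont : ContinuousAt (fun x => ∑ i, a i * skewDensity (m i) (s i) (l i) x) x :=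
    tendsto_finsetSum _ fun i _ =>
      (continuousAt_const.mul (continuousAt_skewDensity (l i) (hs i) (hx i)))
  have hdense : Dense {x | ∑ i, a i * skewDensity (m i) (s i) (l i) x = 0} :=
    Measure.dense_of_ae h
  by_contra hne
  obtain ⟨y, hy, hy0⟩ := (mem_closure_iff_nhds.1 (hdense x)) _ (hcont.eventually_ne hne)
  exact hy hy0

/-- Linear relations between skew-normal densities with extended shapes. -/
lemma skew_relation (hs : ∀ i, 0 < s i)
    (h : ∀ᵐ x, ∑ i, a i * skewDensity (m i) (s i) (l i) x = 0) (μ : ℝ) {σ : ℝ} (hσ : 0 < σ) :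
    ∑ i, (if m i = μ ∧ s i = σ then a i else 0) = 0 ∧
    ∑ i, (if m i = μ ∧ s i = σ then a i * limitFactor (l i) else 0) = 0 ∧
    ∀ t : ℝ, 0 < t →
      ∑ i, (if m i = μ ∧ s i = σ ∧ |(l i).toReal| = t then a i * tailCoeff (l i) else 0) = 0 := by
  have hray := skew_relation_atTop hs (a := a) (m := m) (l := l) (by
    have hlarge : ∀ᶠ x in atTop, ∀ i, m i < x := eventually_all.2 fun i => eventually_gt_atTop _
    filter_upwards [hlarge] with x hx using skew_relation_of_ae hs h fun i => (hx i).ne') (μ := μ) hσ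
  -- Reflection `x ↦ -x` changes the signs of locations and shapes, which gives the relation at
  -- `-∞`. Adding the two limit relations and using `limitFactor l + limitFactor (-l) = 2` yields
  -- the relation between the total weights.
  have hrefl := skew_relation_atTop hs (a := a) (m := fun i => -m i) (l := fun i => -l i) (by
    have hlarge : ∀ᶠ x in atTop, ∀ i, -m i < x := eventually_all.2 fun i => eventually_gt_atTop _
    filter_upwards [hlarge] with x hx
    refine Eq.trans ?_ (skew_relation_of_ae hs h (x := -x) fun i =>
      (by linarith [hx i] : -x < m i).ne)
    refine Finset.sum_congr rfl fun i _ => ?_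
    rw [skewDensity, skewDensity, skewFactor_neg]
    have h1 : (x - -m i) / s i = -((-x - m i) / s i) := by ring
    rw [h1, neg_neg, pdf_neg]) (μ := -μ) hσ
  refine ⟨?_, hray⟩
  have h1 := hray.1
  have h2 := hrefl.1
  simp only [neg_inj] at h2
  have h3 : ∑ i, (if m i = μ ∧ s i = σ then a i else 0) * 2 = 0 := by
    refine Eq.trans ?_ (congrArg₂ (· + ·) h1 h2 |>.trans (add_zero 0))
    rw [← Finset.sum_add_distrib]
    refine Finset.sum_congr rfl fun i _ => ?_
    split_ifs
    · rw [← limitFactor_add_neg (l i)]; ring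
    · ring
  rw [← Finset.sum_mul] at h3
  linarith

end Relations

/-! ### Identifiability -/

lemma tailCoeff_coe_sq {t : ℝ} (ht : t ≠ 0) : tailCoeff t * tailCoeff t = 1 := by
  by_cases h : 0 < t
  · simp [tailCoeff, ht, h]
  · simp [tailCoeff, ht, h]

lemma tailCoeff_neg_coe {t : ℝ} (ht : t ≠ 0) : tailCoeff (-t : ℝ) = -tailCoeff t := by
  rcases lt_or_gt_of_ne ht with h | h
  · have h1 : ¬ (0 < t) := h.not_gt
    have h2 : (0 : EReal) < ((-t : ℝ) : EReal) := by exact_mod_cast neg_pos.2 h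
    have h3 : ((-t : ℝ) : EReal) ≠ 0 := h2.ne'
    simp only [tailCoeff, EReal.coe_ne_top, EReal.coe_ne_bot, h3, h2]
    simp [ht, h1]
  · have h2 : ((-t : ℝ) : EReal) < 0 := by exact_mod_cast neg_neg_iff_pos.2 h
    have h3 : ((-t : ℝ) : EReal) ≠ 0 := h2.ne
    simp only [tailCoeff, EReal.coe_ne_top, EReal.coe_ne_bot, h3, h2.not_gt]
    simp [ht, h]

lemma eq_or_eq_neg_of_abs_toReal {l : EReal} {t : ℝ} (ht : t ≠ 0) (h : |l.toReal| = |t|) :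
    l = (t : EReal) ∨ l = ((-t : ℝ) : EReal) := by
  induction l with
  | top => simp [eq_comm, ht] at h
  | bot => simp [eq_comm, ht] at h
  | coe l => exact (abs_eq_abs.1 h).imp (congrArg _) (congrArg _)

variable {p : ℕ} {Ψ₀ : Mixture p} {T : Type*} [Fintype T] {w m s : T → ℝ} {l : T → EReal}

lemma mixture_relation (hs : ∀ k, 0 < s k)
    (h : ∀ᵐ x, ∑ k, w k * skewDensity (m k) (s k) (l k) x = Ψ₀.density x) (μ : ℝ) {σ : ℝ}
    (hσ : 0 < σ) :
    ∑ k, (if m k = μ ∧ s k = σ then w k else 0) =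
      ∑ j, (if Ψ₀.loc j = μ ∧ Ψ₀.scale j = σ then Ψ₀.weight j else 0) ∧
    ∑ k, (if m k = μ ∧ s k = σ then w k * limitFactor (l k) else 0) =
      ∑ j, (if Ψ₀.loc j = μ ∧ Ψ₀.scale j = σ then
        Ψ₀.weight j * limitFactor (Ψ₀.shape j) else 0) ∧
    ∀ t : ℝ, 0 < t →
      ∑ k, (if m k = μ ∧ s k = σ ∧ |(l k).toReal| = t then w k * tailCoeff (l k) else 0) =
      ∑ j, (if Ψ₀.loc j = μ ∧ Ψ₀.scale j = σ ∧ |Ψ₀.shape j| = t then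
        Ψ₀.weight j * tailCoeff (Ψ₀.shape j) else 0) := by
  have hrel := skew_relation (ι := T ⊕ Fin p) (a := Sum.elim w fun j => -Ψ₀.weight j)
    (m := Sum.elim m Ψ₀.loc) (s := Sum.elim s Ψ₀.scale)
    (l := Sum.elim l fun j => (Ψ₀.shape j : EReal)) (by
      rintro (k | j)
      · exact hs k
      · exact Ψ₀.scale_pos j) (by
      filter_upwards [h] with x hx
      simp only [Fintype.sum_sum_type, Sum.elim_inl, Sum.elim_inr, hx, skewDensity_coe,
        Mixture.density, neg_mul, Finset.sum_neg_distrib, add_neg_cancel]) μ hσ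
  simp only [Fintype.sum_sum_type, Sum.elim_inl, Sum.elim_inr, EReal.toReal_coe] at hrel
  have hneg : ∀ (q : Fin p → Prop) [DecidablePred q] (c : Fin p → ℝ),
      ∑ j, (if q j then -c j else 0) = -∑ j, (if q j then c j else 0) := by
    intro q _ c
    rw [← Finset.sum_neg_distrib]
    exact Finset.sum_congr rfl fun j _ => by split_ifs <;> simp
  simp only [neg_mul, hneg, add_neg_eq_zero] at hrel
  refine ⟨?_, hrel.2⟩
  rw [← add_neg_eq_zero, ← hneg _ Ψ₀.weight]
  exact hrel.1

/-- A proper mixture is determined by its density among the mixtures of at most as many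
skew-normal or half-normal components. -/
theorem exists_equiv_of_density_eq (h₀ : Ψ₀.IsProper) (hcard : Fintype.card T ≤ p)
    (hs : ∀ k, 0 < s k) (hw : ∀ k, 0 ≤ w k)
    (h : ∀ᵐ x, ∑ k, w k * skewDensity (m k) (s k) (l k) x = Ψ₀.density x) :
    ∃ e : Fin p ≃ T, ∀ j, w (e j) = Ψ₀.weight j ∧ m (e j) = Ψ₀.loc j ∧
      s (e j) = Ψ₀.scale j ∧ l (e j) = Ψ₀.shape j := by
  have hrel := fun j => mixture_relation hs h (Ψ₀.loc j) (Ψ₀.scale_pos j)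
  -- By properness, `j` is the only component of `Ψ₀` with its location, scale and absolute shape.
  have hsum_tail : ∀ j, Ψ₀.shape j ≠ 0 →
      ∑ k, (if m k = Ψ₀.loc j ∧ s k = Ψ₀.scale j ∧ |(l k).toReal| = |Ψ₀.shape j| then
        w k * tailCoeff (l k) else 0) = Ψ₀.weight j * tailCoeff (Ψ₀.shape j) := by
    intro j hj
    rw [(hrel j).2.2 _ (abs_pos.2 hj), Fintype.sum_eq_single j]
    · simp
    · intro i hij
      refine if_neg fun hi => ?_
      exact (h₀.2 i j hij hi.1 hi.2.1).2 hi.2.2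
  have hgroup : ∀ j, Ψ₀.shape j = 0 → ∀ i, i ≠ j →
      ¬ (Ψ₀.loc i = Ψ₀.loc j ∧ Ψ₀.scale i = Ψ₀.scale j) := fun j hj i hij hi =>
    (h₀.2 j i (Ne.symm hij) hi.1.symm hi.2.symm).1 hj
  have hex : ∀ j, ∃ k, m k = Ψ₀.loc j ∧ s k = Ψ₀.scale j ∧
      (Ψ₀.shape j ≠ 0 → l k = Ψ₀.shape j) := by
    intro j
    by_cases hj : Ψ₀.shape j = 0
    · have h1 : ∑ k, (if m k = Ψ₀.loc j ∧ s k = Ψ₀.scale j then w k else 0) = Ψ₀.weight j := by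
        rw [(hrel j).1, Fintype.sum_eq_single j fun i hij => if_neg (hgroup j hj i hij)]
        simp
      by_contra! hcon
      rw [Finset.sum_eq_zero] at h1
      · exact (h₀.1 j).ne h1
      · exact fun k _ => if_neg fun hk => (hcon k hk.1 hk.2).1 hj
    -- Only the shapes `λ` and `-λ` enter this relation, with opposite tail coefficients. As the
    -- weights are nonnegative, the shape `-λ` alone cannot produce the required sign, so some
    -- component has shape exactly `λ`.
    · by_contra! hcon
      have h1 := congrArg (· * tailCoeff (Ψ₀.shape j)) (hsum_tail j hj)
      simp only [mul_assoc, tailCoeff_coe_sq hj, mul_one] at h1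
      have h2 : (∑ k, (if m k = Ψ₀.loc j ∧ s k = Ψ₀.scale j ∧ |(l k).toReal| = |Ψ₀.shape j| then
        w k * tailCoeff (l k) else 0)) * tailCoeff (Ψ₀.shape j) ≤ 0 := by
        rw [Finset.sum_mul]
        refine Finset.sum_nonpos fun k _ => ?_
        split_ifs with hk
        · rcases eq_or_eq_neg_of_abs_toReal hj hk.2.2 with hl | hl
          · exact absurd hl (hcon k hk.1 hk.2.1).2
          · rw [hl, tailCoeff_neg_coe hj, mul_assoc, neg_mul, tailCoeff_coe_sq hj]
            linarith [hw k]
        · simp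
      rw [h1] at h2
      exact absurd (h₀.1 j) (not_lt.2 h2)
  choose κ hκm hκs hκl using hex
  have hinj : Function.Injective κ := by
    intro i j hij
    by_contra hne
    have hm : Ψ₀.loc i = Ψ₀.loc j := by rw [← hκm, ← hκm, hij]
    have hs' : Ψ₀.scale i = Ψ₀.scale j := by rw [← hκs, ← hκs, hij]
    have h1 := h₀.2 i j hne hm hs'
    have h2 := h₀.2 j i (Ne.symm hne) hm.symm hs'.symm
    have h3 : (Ψ₀.shape i : EReal) = Ψ₀.shape j := by rw [← hκl i h1.1, ← hκl j h2.1, hij]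
    exact h1.2 (congrArg _ (EReal.coe_injective h3))
  -- There are at most `p` candidates, so none is left unmatched. From here on each relation has a
  -- single term on either side.
  have hbij : Function.Bijective κ := by
    rw [Fintype.bijective_iff_injective_and_card]
    refine ⟨hinj, le_antisymm (Fintype.card_le_of_injective κ hinj) ?_⟩
    simpa using hcard
  have hgroup' : ∀ j k, k ≠ κ j → m k = Ψ₀.loc j → s k = Ψ₀.scale j →
      Ψ₀.shape j ≠ 0 ∧ |(l k).toReal| ≠ |Ψ₀.shape j| := by
    intro j k hk hm hs'
    obtain ⟨i, rfl⟩ := hbij.2 k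
    have hij : i ≠ j := fun h => hk (congrArg κ h)
    rw [hκm] at hm
    rw [hκs] at hs'
    have h1 := h₀.2 i j hij hm hs'
    refine ⟨(h₀.2 j i (Ne.symm hij) hm.symm hs'.symm).1, ?_⟩
    rw [hκl i h1.1]
    exact h1.2
  refine ⟨Equiv.ofBijective κ hbij, fun j => ?_⟩
  simp only [Equiv.ofBijective_apply]
  by_cases hj : Ψ₀.shape j = 0
  · have hsingle : ∀ c : T → ℝ, ∑ k, (if m k = Ψ₀.loc j ∧ s k = Ψ₀.scale j then c k else 0) =
        c (κ j) := by
      intro c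
      rw [Fintype.sum_eq_single (κ j)]
      · simp [hκm, hκs]
      · exact fun k hk => if_neg fun h => (hgroup' j k hk h.1 h.2).1 hj
    have hsingle₀ : ∀ c : Fin p → ℝ,
        ∑ i, (if Ψ₀.loc i = Ψ₀.loc j ∧ Ψ₀.scale i = Ψ₀.scale j then c i else 0) = c j := by
      intro c
      rw [Fintype.sum_eq_single j fun i hij => if_neg (hgroup j hj i hij)]
      simp
    obtain ⟨h1, h2, -⟩ := hrel j
    rw [hsingle, hsingle₀] at h1
    rw [hsingle, hsingle₀, h1, hj, EReal.coe_zero] at h2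
    refine ⟨h1, hκm j, hκs j, ?_⟩
    -- `limitFactor` takes the value `1` only at shape `0`, so the limit relation rules out nonzero
    -- and infinite shapes.
    have h3 := mul_left_cancel₀ (h₀.1 j).ne' h2
    by_contra hne
    rw [hj, EReal.coe_zero] at hne
    simp only [limitFactor, lt_irrefl, if_false, if_true, hne] at h3
    split_ifs at h3 <;> norm_num at h3
  · have hl := hκl j hj
    refine ⟨?_, hκm j, hκs j, hl⟩
    have h1 := hsum_tail j hj
    rw [Fintype.sum_eq_single (κ j)] at h1
    · rw [if_pos ⟨hκm j, hκs j, by rw [hl, EReal.toReal_coe]⟩, hl] at h1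
      refine mul_right_cancel₀ (fun h0 => ?_) h1
      have := tailCoeff_coe_sq hj
      rw [h0] at this
      norm_num at this
    · exact fun k hk => if_neg fun h => (hgroup' j k hk h.1 h.2.1).2 h.2.2

/-! ### Uniform bounds for the number of observations in short intervals -/

/-- The number of the first `n` terms of `x` that lie in `A`. -/
noncomputable def countIn (x : ℕ → ℝ) (n : ℕ) (A : Set ℝ) : ℝ :=
  ∑ i ∈ Finset.range n, A.indicator (fun _ => (1 : ℝ)) (x i)

lemma countIn_nonneg (x : ℕ → ℝ) (n : ℕ) (A : Set ℝ) : 0 ≤ countIn x n A :=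
  Finset.sum_nonneg fun _ _ => Set.indicator_nonneg (fun _ _ => zero_le_one) _

lemma countIn_le (x : ℕ → ℝ) (n : ℕ) (A : Set ℝ) : countIn x n A ≤ n := by
  have h : countIn x n A ≤ ∑ i ∈ Finset.range n, (1 : ℝ) :=
    Finset.sum_le_sum fun i _ => Set.indicator_le_self' (fun _ _ => zero_le_one) _
  simpa using h

lemma countIn_eq_card (x : ℕ → ℝ) (n : ℕ) (A : Set ℝ) [DecidablePred fun i => x i ∈ A] :
    countIn x n A = ((Finset.range n).filter fun i => x i ∈ A).card := by
  rw [Finset.card_filter, countIn]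
  push_cast
  exact Finset.sum_congr rfl fun i _ => by by_cases hi : x i ∈ A <;> simp [hi]

/-- The cells of length `log n / n` that partition the real line. -/
def cell (n : ℕ) (j : ℤ) : Set ℝ :=
  Set.Ico (j • (Real.log n / n)) ((j + 1) • (Real.log n / n))

section Count

variable {Ω : Type*} [MeasurableSpace Ω] {P : Measure Ω}
  {X : ℕ → Ω → ℝ} {ν : Measure ℝ} [IsProbabilityMeasure ν]

lemma exp_sub_one_le (x : ℝ) : Real.exp x - 1 ≤ x * Real.exp x := by
  have h1 := Real.add_one_le_exp (-x)
  have h2 : Real.exp (-x) * Real.exp x = 1 := by rw [← Real.exp_add]; simp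
  nlinarith [Real.exp_pos x]

lemma mgf_indicator_le (hX : ∀ i, HasLaw (X i) ν P) {A : Set ℝ} (hA : MeasurableSet A) (i : ℕ) :
    mgf (fun ω => A.indicator (fun _ => (1 : ℝ)) (X i ω)) P 1 ≤ Real.exp (2 * ν.real A) := by
  have h1 : mgf (fun ω => A.indicator (fun _ => (1 : ℝ)) (X i ω)) P 1 =
      ∫ x, Real.exp (A.indicator (fun _ => (1 : ℝ)) x) ∂ν := by
    rw [mgf, ← (hX i).map_eq, integral_map (hX i).aemeasurable]
    · simp
    · exact ((measurable_const.indicator hA).exp).aestronglyMeasurable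
  have h2 : ∀ x, Real.exp (A.indicator (fun _ => (1 : ℝ)) x) =
      1 + A.indicator (fun _ => Real.exp 1 - 1) x := by
    intro x
    by_cases hx : x ∈ A <;> simp [hx]
  rw [h1]
  simp_rw [h2]
  rw [integral_add (integrable_const _) ((integrable_const _).indicator hA),
    integral_indicator hA]
  simp only [integral_const, probReal_univ, smul_eq_mul, mul_one, measureReal_restrict_apply_univ]
  have h3 := Real.exp_one_lt_three
  have h4 := Real.add_one_le_exp (2 * ν.real A)
  have h5 : 0 ≤ ν.real A := measureReal_nonneg
  nlinarith

/-- Markov's inequality is applied to `exp N - 1` rather than `exp N`: the bound is then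
proportional to the mass of `A`, and can be summed over the infinitely many cells of a partition. -/
lemma measure_count_ge_le [IsProbabilityMeasure P] (hX : ∀ i, HasLaw (X i) ν P) (hindep : iIndepFun X P) {A : Set ℝ}
    (hA : MeasurableSet A) (n : ℕ) {k : ℝ} :
    (Real.exp k - 1) *
      P.real {ω | k ≤ countIn (fun i => X i ω) n A} ≤
      2 * n * ν.real A * Real.exp (2 * n * ν.real A) := by
  set Y : ℕ → Ω → ℝ := fun i ω => A.indicator (fun _ => (1 : ℝ)) (X i ω) with hY
  set N : Ω → ℝ := ∑ i ∈ Finset.range n, Y i with hN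
  have hind : Measurable (A.indicator fun _ => (1 : ℝ)) := measurable_const.indicator hA
  have hYm : ∀ i, AEMeasurable (Y i) P := fun i => hind.comp_aemeasurable (hX i).aemeasurable
  have hNm : AEMeasurable N P := by
    rw [hN]; exact Finset.aemeasurable_sum _ fun i _ => hYm i
  have hYi : iIndepFun Y P := hindep.comp (fun _ => A.indicator fun _ => (1 : ℝ)) fun _ => hind
  have hcard : ∀ ω, countIn (fun i => X i ω) n A = N ω := by
    intro ω
    rw [countIn, hN, Finset.sum_apply]
  have hN0 : ∀ ω, 0 ≤ N ω := fun ω => by rw [← hcard]; exact countIn_nonneg _ _ _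
  have hNn : ∀ ω, N ω ≤ n := fun ω => by rw [← hcard]; exact countIn_le _ _ _
  have hmgf : mgf N P 1 ≤ Real.exp (2 * n * ν.real A) := by
    rw [hN, hYi.mgf_sum₀ hYm]
    refine (Finset.prod_le_prod (fun i _ => mgf_nonneg)
      fun i _ => mgf_indicator_le hX hA i).trans (le_of_eq ?_)
    rw [Finset.prod_const, Finset.card_range, ← Real.exp_nat_mul]
    congr 1; ring
  have hint : Integrable (fun ω => Real.exp (N ω)) P := by
    refine Integrable.of_bound (C := Real.exp n) (hNm.exp).aestronglyMeasurable ?_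
    refine Eventually.of_forall fun ω => ?_
    rw [Real.norm_of_nonneg (Real.exp_nonneg _)]
    exact Real.exp_le_exp.2 (hNn ω)
  have hmarkov := mul_meas_ge_le_integral_of_nonneg (μ := P) (f := fun ω => Real.exp (N ω) - 1)
    (Eventually.of_forall fun ω => sub_nonneg.2 (Real.one_le_exp (hN0 ω)))
    (hint.sub (integrable_const 1)) (Real.exp k - 1)
  have hset : {ω | Real.exp k - 1 ≤ Real.exp (N ω) - 1} =
      {ω | k ≤ countIn (fun i => X i ω) n A} := by
    ext ω
    simp only [Set.mem_ofPred_eq, hcard, sub_le_sub_iff_right, Real.exp_le_exp]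
  rw [hset, integral_sub hint (integrable_const 1)] at hmarkov
  refine hmarkov.trans ?_
  have h1 : ∫ ω, Real.exp (N ω) ∂P = mgf N P 1 := by simp [mgf]
  rw [h1]
  simp only [integral_const, probReal_univ, smul_eq_mul, mul_one]
  linarith [exp_sub_one_le (2 * n * ν.real A)]

lemma measure_count_cell_le [IsProbabilityMeasure P] (hX : ∀ i, HasLaw (X i) ν P) (hindep : iIndepFun X P) {A : Set ℝ}
    (hA : MeasurableSet A) {n : ℕ} (hn : 2 ≤ n) {B : ℝ} (hB : 0 ≤ B)
    (hν : n * ν.real A ≤ B * Real.log n) :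
    P {ω | (2 * B + 3) * Real.log n ≤ countIn (fun i => X i ω) n A} ≤
      ENNReal.ofReal (4 * (1 / (n : ℝ) ^ 2)) * ν A := by
  have hn' : (2 : ℝ) ≤ n := by exact_mod_cast hn
  have hn0 : (0 : ℝ) < n := by linarith
  set L := Real.log n with hL
  have hL0 : 0 ≤ L := Real.log_nonneg (by linarith)
  have hexpL : Real.exp L = n := Real.exp_log hn0
  have h := measure_count_ge_le hX hindep hA n (k := (2 * B + 3) * L)
  set q := P.real {ω | (2 * B + 3) * L ≤ countIn (fun i => X i ω) n A}
  -- This is the origin of the threshold `(2 * B + 3) * log n`: the part `2 * B` cancels `exp (2 n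
  -- ν(A))`, and the part `3` gives `n ^ 3`, which against the factor `n` leaves a summable `1 / n ^
  -- 2`.
  have hsplit : Real.exp ((2 * B + 3) * L) = Real.exp (2 * B * L) * (n : ℝ) ^ 3 := by
    rw [← hexpL, ← Real.exp_nat_mul, ← Real.exp_add]
    congr 1; push_cast; ring
  have hE1 : 1 ≤ Real.exp (2 * B * L) := Real.one_le_exp (by positivity)
  have hq0 : 0 ≤ q := measureReal_nonneg
  have hν0 : 0 ≤ ν.real A := measureReal_nonneg
  have hup : Real.exp (2 * n * ν.real A) ≤ Real.exp (2 * B * L) := by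
    rw [Real.exp_le_exp]; nlinarith
  have hhalf : Real.exp (2 * B * L) * (n : ℝ) ^ 3 / 2 ≤ Real.exp ((2 * B + 3) * L) - 1 := by
    rw [hsplit]
    have : (2 : ℝ) ≤ (n : ℝ) ^ 3 := by
      calc (2 : ℝ) ≤ 2 ^ 3 := by norm_num
        _ ≤ (n : ℝ) ^ 3 := by gcongr
    nlinarith
  have hq : q ≤ 4 * (1 / (n : ℝ) ^ 2) * ν.real A := by
    have h1 : Real.exp (2 * B * L) * (n : ℝ) ^ 3 / 2 * q ≤
        2 * n * ν.real A * Real.exp (2 * B * L) :=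
      (mul_le_mul_of_nonneg_right hhalf hq0).trans (h.trans (by gcongr))
    have h2 : (n : ℝ) ^ 3 / 2 * q ≤ 2 * n * ν.real A := by
      refine le_of_mul_le_mul_left ?_ (Real.exp_pos (2 * B * L))
      linarith
    have h3 : 4 * (1 / (n : ℝ) ^ 2) * ν.real A = 2 / (n : ℝ) ^ 3 * (2 * n * ν.real A) := by
      field_simp; ring
    rw [h3]
    calc q = 2 / (n : ℝ) ^ 3 * ((n : ℝ) ^ 3 / 2 * q) := by field_simp
      _ ≤ _ := by gcongr
  have hofReal := ENNReal.ofReal_le_ofReal hq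
  rw [ENNReal.ofReal_mul (by positivity), ofReal_measureReal, ofReal_measureReal] at hofReal
  exact hofReal

/-- The union bound over all integers `j` is affordable because the bounds for the single cells are
proportional to masses with total at most `1`. -/
lemma measure_exists_count_cell_le [IsProbabilityMeasure P] (hX : ∀ i, HasLaw (X i) ν P) (hindep : iIndepFun X P) {B : ℝ}
    (hB : 0 ≤ B) (hν : ∀ a b : ℝ, a ≤ b → ν.real (Set.Ico a b) ≤ B * (b - a)) {n : ℕ}
    (hn : 2 ≤ n) :
    P {ω | ∃ j, (2 * B + 3) * Real.log n ≤ countIn (fun i => X i ω) n (cell n j)} ≤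
      ENNReal.ofReal (4 * (1 / (n : ℝ) ^ 2)) := by
  have hn' : (2 : ℝ) ≤ n := by exact_mod_cast hn
  have hh : 0 ≤ Real.log n / n := div_nonneg (Real.log_nonneg (by linarith)) (by linarith)
  have hcell : ∀ j, n * ν.real (cell n j) ≤ B * Real.log n := by
    intro j
    have h1 := hν (j • (Real.log n / n)) ((j + 1) • (Real.log n / n))
      (by rw [add_smul, one_smul]; linarith)
    have h2 : (j + 1) • (Real.log n / n) - j • (Real.log n / n) = Real.log n / n := by
      rw [add_smul, one_smul, add_sub_cancel_left]
    rw [h2] at h1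
    calc n * ν.real (cell n j) ≤ (n : ℝ) * (B * (Real.log n / n)) := by
          rw [cell]; gcongr
      _ = B * Real.log n := by field_simp
  have hset : {ω | ∃ j, (2 * B + 3) * Real.log n ≤ countIn (fun i => X i ω) n (cell n j)} =
      ⋃ j : ℤ, {ω | (2 * B + 3) * Real.log n ≤ countIn (fun i => X i ω) n (cell n j)} := by
    ext ω
    simp only [Set.mem_ofPred_eq, Set.mem_iUnion]
  rw [hset]
  refine (measure_iUnion_le _).trans ((ENNReal.tsum_le_tsum fun j =>
    measure_count_cell_le hX hindep measurableSet_Ico hn hB (hcell j)).trans ?_)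
  rw [ENNReal.tsum_mul_left]
  refine mul_le_of_le_one_right zero_le ?_
  have h3 := measure_iUnion (μ := ν) (Set.pairwise_disjoint_Ico_zsmul (Real.log n / n))
    fun j => measurableSet_Ico
  exact h3.symm.le.trans prob_le_one

lemma ae_eventually_count_cell_lt [IsProbabilityMeasure P] (hX : ∀ i, HasLaw (X i) ν P) (hindep : iIndepFun X P) {B : ℝ}
    (hB : 0 ≤ B) (hν : ∀ a b : ℝ, a ≤ b → ν.real (Set.Ico a b) ≤ B * (b - a)) :
    ∀ᵐ ω ∂P, ∀ᶠ n : ℕ in atTop, ∀ j : ℤ,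
      countIn (fun i => X i ω) n (cell n j) < (2 * B + 3) * Real.log n := by
  set bad : ℕ → Set Ω := fun n => if 2 ≤ n then
    {ω | ∃ j, (2 * B + 3) * Real.log n ≤ countIn (fun i => X i ω) n (cell n j)} else ∅ with hbad
  have hle : ∀ n, P (bad n) ≤ ENNReal.ofReal (4 * (1 / (n : ℝ) ^ 2)) := by
    intro n
    by_cases hn : 2 ≤ n
    · simp only [hbad, hn, if_true]
      exact measure_exists_count_cell_le hX hindep hB hν hn
    · simp [hbad, hn]
  have hsum : ∑' n, P (bad n) ≠ ⊤ := by
    refine ne_top_of_le_ne_top ?_ (ENNReal.tsum_le_tsum hle)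
    exact ((Real.summable_one_div_nat_pow.2 one_lt_two).mul_left 4).tsum_ofReal_ne_top
  filter_upwards [ae_eventually_notMem hsum] with ω hω
  filter_upwards [hω, eventually_ge_atTop 2] with n hn hn2 j
  by_contra! hcon
  refine hn ?_
  simp only [hbad, hn2, if_true]
  exact ⟨j, hcon⟩

/-- A window of radius `w` meets at most `2 * w / h + 2` cells of length `h`. -/
lemma count_window_le {x : ℕ → ℝ} {n : ℕ} {h K : ℝ} (hh : 0 < h) (hK : 0 ≤ K)
    (hcell : ∀ j : ℤ, countIn x n (Set.Ico (j • h) ((j + 1) • h)) < K) (μ : ℝ) {w : ℝ}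
    (hw : 0 ≤ w) : countIn x n {y | |y - μ| ≤ w} ≤ K * (2 * w / h + 2) := by
  classical
  rw [countIn_eq_card]
  simp only [Set.mem_ofPred_eq]
  set S := (Finset.range n).filter fun i => |x i - μ| ≤ w with hS
  have hmaps : ∀ i ∈ S, ⌊x i / h⌋ ∈ Finset.Icc ⌊(μ - w) / h⌋ ⌊(μ + w) / h⌋ := by
    intro i hi
    have hi' := abs_le.1 (Finset.mem_filter.1 hi).2
    rw [Finset.mem_Icc]
    constructor <;> refine Int.floor_le_floor ?_ <;> gcongr <;> linarith
  have hcount := Finset.card_le_mul_card_image_of_maps_to hmaps ⌊K⌋₊ (by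
    intro j _
    have hj := (hcell j).le
    rw [countIn_eq_card] at hj
    refine Nat.le_floor (le_trans ?_ hj)
    rw [Nat.cast_le]
    refine Finset.card_le_card fun i hi => ?_
    rw [Finset.mem_filter, hS, Finset.mem_filter] at hi
    rw [Finset.mem_filter]
    refine ⟨hi.1.1, ?_⟩
    have := Int.floor_eq_iff.1 hi.2
    rw [zsmul_eq_mul, zsmul_eq_mul, Set.mem_Ico]
    push_cast
    rw [le_div_iff₀ hh, div_lt_iff₀ hh] at this
    exact this)
  have hIcc : ((Finset.Icc ⌊(μ - w) / h⌋ ⌊(μ + w) / h⌋).card : ℝ) ≤ 2 * w / h + 2 := by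
    rw [Int.card_Icc]
    have h1 : ⌊(μ - w) / h⌋ ≤ ⌊(μ + w) / h⌋ := Int.floor_le_floor (by gcongr; linarith)
    have h2 : (((⌊(μ + w) / h⌋ + 1 - ⌊(μ - w) / h⌋).toNat : ℤ) : ℝ) =
        ⌊(μ + w) / h⌋ + 1 - ⌊(μ - w) / h⌋ := by
      rw [Int.toNat_of_nonneg (by linarith)]; push_cast; ring
    have h3 := Int.floor_le ((μ + w) / h)
    have h4 := Int.lt_floor_add_one ((μ - w) / h)
    have h5 : (μ + w) / h - (μ - w) / h = 2 * w / h := by ring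
    rw [Int.cast_natCast] at h2
    rw [h2]; linarith
  calc (S.card : ℝ) ≤ ((⌊K⌋₊ * (Finset.Icc ⌊(μ - w) / h⌋ ⌊(μ + w) / h⌋).card : ℕ) : ℝ) := by
        exact_mod_cast hcount
    _ = ⌊K⌋₊ * ((Finset.Icc ⌊(μ - w) / h⌋ ⌊(μ + w) / h⌋).card : ℝ) := by push_cast; ring
    _ ≤ K * (2 * w / h + 2) := by
        gcongr
        exact Nat.floor_le hK

/-- Every interval of radius `w` contains at most `C (n w + log n)` of the first `n` points. -/
def CountBound (x : ℕ → ℝ) : Prop :=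
  ∃ C : ℝ, 0 ≤ C ∧ ∀ᶠ n : ℕ in atTop, ∀ μ w : ℝ, 0 ≤ w →
    countIn x n {y | |y - μ| ≤ w} ≤ C * (n * w + Real.log n)

lemma ae_countBound [IsProbabilityMeasure P] (hX : ∀ i, HasLaw (X i) ν P) (hindep : iIndepFun X P) {B : ℝ}
    (hB : 0 ≤ B) (hν : ∀ a b : ℝ, a ≤ b → ν.real (Set.Ico a b) ≤ B * (b - a)) :
    ∀ᵐ ω ∂P, CountBound fun i => X i ω := by
  filter_upwards [ae_eventually_count_cell_lt hX hindep hB hν] with ω hω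
  refine ⟨2 * (2 * B + 3), by positivity, ?_⟩
  filter_upwards [hω, eventually_ge_atTop 2] with n hn hn2 μ w hw
  have hn' : (2 : ℝ) ≤ n := by exact_mod_cast hn2
  have hL : 0 < Real.log n := Real.log_pos (by linarith)
  refine (count_window_le (div_pos hL (by linarith)) (by positivity) hn μ hw).trans (le_of_eq ?_)
  field_simp

end Count

/-- Half-open intervals of both kinds are covered: the cells are of type `Ico`, increments of the
distribution function of type `Ioc`. -/
lemma Mixture.exists_law_le {p : ℕ} (Ψ : Mixture p) :
    ∃ B, 0 ≤ B ∧ (∀ a b : ℝ, a ≤ b → Ψ.law.real (Set.Ico a b) ≤ B * (b - a)) ∧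
      ∀ a b : ℝ, a ≤ b → Ψ.law.real (Set.Ioc a b) ≤ B * (b - a) := by
  obtain ⟨B, hB, hle⟩ := Ψ.exists_density_le
  have key : ∀ A : Set ℝ, MeasurableSet A → Ψ.law A ≤ ENNReal.ofReal B * volume A := by
    intro A hA
    rw [Mixture.law, withDensity_apply _ hA, ← setLIntegral_const]
    exact lintegral_mono fun x => ENNReal.ofReal_le_ofReal (hle x)
  refine ⟨B, hB.le, fun a b hab => ?_, fun a b hab => ?_⟩ <;>
  refine ENNReal.toReal_le_of_le_ofReal (mul_nonneg hB.le (sub_nonneg.2 hab)) ?_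
  · exact (key _ measurableSet_Ico).trans (by rw [Real.volume_Ico, ENNReal.ofReal_mul hB.le])
  · exact (key _ measurableSet_Ioc).trans (by rw [Real.volume_Ioc, ENNReal.ofReal_mul hB.le])

/-! ### The contribution of components of small scale -/

lemma exp_neg_inv_le {s : ℝ} (hs : 0 < s) : Real.exp (-(1 / (2 * s))) ≤ 8 * s ^ 2 := by
  have hv : 0 < 1 / (2 * s) := by positivity
  have h1 := Real.quadratic_le_exp_of_nonneg hv.le
  rw [Real.exp_neg, inv_le_comm₀ (Real.exp_pos _) (by positivity)]
  refine le_trans (le_of_eq ?_) (le_trans (by linarith : (1 / (2 * s)) ^ 2 / 2 ≤ _) h1)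
  field_simp; norm_num

/-- Within distance `√s` of the centre the spike is bounded by its height `1 / s`. Outside, its
exponential factor is at most `exp (-1 / (2 s)) ≤ 8 s ^ 2`, so the logarithm is `O(s)`. -/
lemma log_one_add_spike_le {A s : ℝ} (hA : 0 < A) (hs : 0 < s) (hs1 : s < 1) (μ x : ℝ) :
    Real.log (1 + A * (1 / s * Real.exp (-(x - μ) ^ 2 / (2 * s ^ 2)))) ≤
      {y | |y - μ| ≤ √s}.indicator (fun _ => (1 : ℝ)) x * (Real.log (1 + A) - Real.log s) +
        8 * A * s := by
  have hpos : 0 ≤ A * (1 / s * Real.exp (-(x - μ) ^ 2 / (2 * s ^ 2))) := by positivity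
  by_cases hx : |x - μ| ≤ √s
  · have hmem : x ∈ {y | |y - μ| ≤ √s} := hx
    rw [Set.indicator_of_mem hmem, one_mul, ← Real.log_div (by positivity) hs.ne']
    have h1 : Real.exp (-(x - μ) ^ 2 / (2 * s ^ 2)) ≤ 1 := by
      rw [Real.exp_le_one_iff, neg_div]
      have : 0 ≤ (x - μ) ^ 2 / (2 * s ^ 2) := by positivity
      linarith
    have h2 : 1 + A * (1 / s * Real.exp (-(x - μ) ^ 2 / (2 * s ^ 2))) ≤ (1 + A) / s := by
      calc _ ≤ 1 / s + A * (1 / s * 1) := by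
            gcongr
            rw [le_div_iff₀ hs]; linarith
        _ = _ := by ring
    have h3 := Real.log_le_log (by positivity) h2
    have : 0 ≤ 8 * A * s := by positivity
    linarith
  · have hmem : x ∉ {y | |y - μ| ≤ √s} := hx
    rw [Set.indicator_of_notMem hmem, zero_mul, zero_add]
    have h1 : s ≤ (x - μ) ^ 2 := by
      rw [← sq_abs, ← Real.sq_sqrt hs.le]
      have := not_le.1 hx
      gcongr
    have h2 : Real.exp (-(x - μ) ^ 2 / (2 * s ^ 2)) ≤ 8 * s ^ 2 := by
      refine le_trans (Real.exp_le_exp.2 ?_) (exp_neg_inv_le hs)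
      rw [neg_div, neg_le_neg_iff, div_le_div_iff₀ (by positivity) (by positivity)]
      nlinarith
    calc _ ≤ A * (1 / s * Real.exp (-(x - μ) ^ 2 / (2 * s ^ 2))) := by
          have := Real.log_le_sub_one_of_pos (by positivity :
            0 < 1 + A * (1 / s * Real.exp (-(x - μ) ^ 2 / (2 * s ^ 2))))
          linarith
      _ ≤ A * (1 / s * (8 * s ^ 2)) := by gcongr
      _ = 8 * A * s := by field_simp

lemma exists_scale_small (C K A : ℝ) {ε : ℝ} (hε : 0 < ε) :
    ∃ s₀, 0 < s₀ ∧ ∀ s, 0 < s → s < s₀ →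
      s < 1 ∧ C * √s * (K - Real.log s) ≤ ε ∧ 8 * A * s ≤ ε := by
  have h1 : Tendsto (fun s : ℝ => C * √s * (K - Real.log s)) (𝓝[>] 0) (𝓝 0) := by
    have h2 : Tendsto (fun s : ℝ => √s) (𝓝[>] 0) (𝓝 0) := by
      have := (Real.continuous_sqrt.tendsto 0).mono_left (nhdsWithin_le_nhds (s := Set.Ioi 0))
      simpa using this
    have h3 := tendsto_log_mul_rpow_nhdsGT_zero (r := 1 / 2) (by norm_num)
    have h4 := (h2.const_mul (C * K)).sub (h3.const_mul C)
    simp only [mul_zero, sub_zero] at h4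
    refine h4.congr fun s => ?_
    rw [← Real.sqrt_eq_rpow]; ring
  have h5 : Tendsto (fun s : ℝ => 8 * A * s) (𝓝[>] 0) (𝓝 0) := by
    have : Tendsto (fun s : ℝ => 8 * A * s) (𝓝 0) (𝓝 (8 * A * 0)) := tendsto_id.const_mul _
    rw [mul_zero] at this
    exact this.mono_left nhdsWithin_le_nhds
  have h6 : ∀ᶠ s : ℝ in 𝓝[>] 0, s < 1 := nhdsWithin_le_nhds (gt_mem_nhds one_pos)
  have hall := h6.and ((h1.eventually (ge_mem_nhds hε)).and (h5.eventually (ge_mem_nhds hε)))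
  obtain ⟨s₀, hs₀, hsub⟩ := mem_nhdsGT_iff_exists_Ioo_subset.1 hall
  exact ⟨s₀, hs₀, fun s hs hs' => hsub ⟨hs, hs'⟩⟩

lemma eventually_log_le (C K : ℝ) {ε : ℝ} (hε : 0 < ε) :
    ∀ᶠ n : ℕ in atTop, C * Real.log n * (K + Real.log n) ≤ ε * n := by
  have h1 : (fun x : ℝ => C * K * Real.log x + C * Real.log x ^ 2) =o[atTop] fun x : ℝ => x :=
    (Real.isLittleO_log_id_atTop.const_mul_left _).add
      (Real.isLittleO_pow_log_id_atTop.const_mul_left _)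
  filter_upwards [(h1.comp_tendsto tendsto_natCast_atTop_atTop).bound hε] with n hn
  simp only [Function.comp_apply, Real.norm_eq_abs, Nat.abs_cast] at hn
  have := (le_abs_self _).trans hn
  linarith

/-- The sharp peaks of components of small scale are offset by the penalty. -/
theorem spike_bound {x : ℕ → ℝ} (hx : CountBound x) {penS : ℕ → ℝ → ℝ} (hC1 : CondC1 penS)
    (hC2 : CondC2 penS) {A ε : ℝ} (hA : 0 < A) (hε : 0 < ε) :
    ∃ s₀, 0 < s₀ ∧ ∀ᶠ n : ℕ in atTop, ∀ μ s : ℝ, 0 < s → s < s₀ →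
      ∑ i ∈ Finset.range n,
        Real.log (1 + A * (1 / s * Real.exp (-(x i - μ) ^ 2 / (2 * s ^ 2)))) + penS n s ≤
        ε * n := by
  obtain ⟨C, hC0, hC⟩ := hx
  set K := Real.log (1 + A) with hK
  have hK0 : 0 ≤ K := Real.log_nonneg (by linarith)
  obtain ⟨s₀, hs₀, hsmall⟩ := exists_scale_small C K A (by linarith : 0 < ε / 4)
  refine ⟨s₀, hs₀, ?_⟩
  have hlog : Tendsto (fun n : ℕ => Real.log n) atTop atTop :=
    Real.tendsto_log_atTop.comp tendsto_natCast_atTop_atTop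
  filter_upwards [hC, eventually_log_le C K (by linarith : 0 < ε / 4),
    hC1.2 (ε / 4) (by linarith), hC2, hlog.eventually_ge_atTop 1, hlog.eventually_ge_atTop C,
    eventually_gt_atTop 0] with n hn hlogn hpen hpen2 hL1 hLC hn0 μ s hs hss₀
  obtain ⟨hs1, hsq, h8⟩ := hsmall s hs hss₀
  have hn0' : (0 : ℝ) < n := by exact_mod_cast hn0
  set L := Real.log n with hL
  have hlogs : Real.log s ≤ 0 := (Real.log_neg hs hs1).le
  have hsum : ∑ i ∈ Finset.range n,
      Real.log (1 + A * (1 / s * Real.exp (-(x i - μ) ^ 2 / (2 * s ^ 2)))) ≤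
      C * (n * √s + L) * (K - Real.log s) + n * (8 * A * s) := by
    refine (Finset.sum_le_sum fun i _ => log_one_add_spike_le hA hs hs1 μ (x i)).trans ?_
    rw [Finset.sum_add_distrib, ← Finset.sum_mul, Finset.sum_const, Finset.card_range, nsmul_eq_mul]
    have := hn μ (√s) (Real.sqrt_nonneg s)
    rw [countIn] at this
    gcongr
    linarith
  have hmain : C * (n * √s) * (K - Real.log s) + n * (8 * A * s) ≤ ε / 2 * n := by nlinarith
  rcases lt_or_ge s (L / n) with hcase | hcase
  · have h1 := hpen2 s hs hcase
    have h2 : C * L * (K - Real.log s) + L ^ 2 * Real.log s ≤ C * L * (K + L) := by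
      have h3 : 0 ≤ L * (L - C) := mul_nonneg (by linarith) (by linarith)
      have h4 : 0 ≤ C * L * L := by positivity
      nlinarith
    nlinarith
  · have h1 := (le_max_right 0 _).trans (hpen s hs)
    have h2 : -Real.log s ≤ L := by
      rw [← Real.log_inv, hL]
      refine Real.log_le_log (inv_pos.2 hs) (inv_le_of_inv_le₀ hn0' (le_trans ?_ hcase))
      rw [inv_eq_one_div]; gcongr
    have h3 : C * L * (K - Real.log s) ≤ C * L * (K + L) := by gcongr; linarith
    nlinarith

/-! ### Uniform laws of large numbers -/

section LLN

variable {Ω : Type*} [MeasurableSpace Ω] {P : Measure Ω} {X : ℕ → Ω → ℝ} {ν : Measure ℝ}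

lemma ae_tendsto_average (hX : ∀ i, HasLaw (X i) ν P) (hindep : iIndepFun X P) {g : ℝ → ℝ}
    (hg : Measurable g) (hint : Integrable g ν) :
    ∀ᵐ ω ∂P, Tendsto (fun n : ℕ => (∑ i ∈ Finset.range n, g (X i ω)) / n) atTop
      (𝓝 (∫ x, g x ∂ν)) := by
  have h := strong_law_ae_real (fun i ω => g (X i ω)) (μ := P)
    (by
      rw [← (hX 0).map_eq] at hint
      exact hint.comp_aemeasurable (hX 0).aemeasurable)
    (fun i j hij => (hindep.indepFun hij).comp hg hg)
    (fun i => IdentDistrib.comp (f := X i) (g := X 0)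
      ⟨(hX i).aemeasurable, (hX 0).aemeasurable, by rw [(hX i).map_eq, (hX 0).map_eq]⟩ hg)
  have h0 : ∫ ω, g (X 0 ω) ∂P = ∫ x, g x ∂ν := by
    rw [← (hX 0).map_eq, integral_map (hX 0).aemeasurable]
    rw [(hX 0).map_eq]
    exact hg.aestronglyMeasurable
  rw [h0] at h
  exact h

end LLN

/-- The empirical measures of `x` converge to `ν` uniformly over upper sets. -/
def UniformLLN (x : ℕ → ℝ) (ν : Measure ℝ) : Prop :=
  ∀ ε, 0 < ε → ∀ᶠ n : ℕ in atTop, ∀ U : Set ℝ, IsUpperSet U →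
    |countIn x n U - n * ν.real U| ≤ ε * n

lemma countIn_mono (x : ℕ → ℝ) (n : ℕ) {A B : Set ℝ} (h : A ⊆ B) :
    countIn x n A ≤ countIn x n B :=
  Finset.sum_le_sum fun _ _ => Set.indicator_le_indicator_of_subset h (fun _ => zero_le_one) _

/-- Glivenko–Cantelli by bracketing: upper sets of `ℝ` are totally ordered by inclusion, so each one
lies between two consecutive grid sets. Upper sets are used, rather than half-lines of one kind,
because superlevel sets of monotone functions may be open or closed. -/
lemma uniformLLN_of_grid {x : ℕ → ℝ} {ν : Measure ℝ} [IsProbabilityMeasure ν]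
    (h : ∀ m : ℕ, 0 < m → ∃ R : ℕ → Set ℝ, R 0 = Set.univ ∧ R m = ∅ ∧
      (∀ k, IsUpperSet (R k)) ∧ (∀ k < m, ν.real (R k) ≤ ν.real (R (k + 1)) + 1 / m) ∧
      ∀ k, Tendsto (fun n : ℕ => countIn x n (R k) / n) atTop (𝓝 (ν.real (R k)))) :
    UniformLLN x ν := by
  intro ε hε
  obtain ⟨m, hm⟩ := exists_nat_gt (2 / ε)
  have hm0 : (0 : ℝ) < m := lt_trans (by positivity) hm
  have hmε : 1 / (m : ℝ) ≤ ε / 2 := by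
    rw [div_lt_iff₀ hε] at hm
    rw [div_le_iff₀ hm0]; linarith
  obtain ⟨R, hR0, hRm, hRup, hRstep, hRlim⟩ := h m (by exact_mod_cast hm0)
  have hclose : ∀ᶠ n : ℕ in atTop, ∀ k ∈ Finset.range (m + 1),
      |countIn x n (R k) / n - ν.real (R k)| < ε / 2 := by
    refine (Finset.eventually_all _).2 fun k _ => ?_
    have := Metric.tendsto_nhds.1 (hRlim k) (ε / 2) (by linarith)
    simpa [Real.dist_eq] using this
  filter_upwards [hclose, eventually_gt_atTop 0] with n hn hn0 U hU
  have hn0' : (0 : ℝ) < n := by exact_mod_cast hn0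
  have hn' : ∀ k ≤ m, |countIn x n (R k) - n * ν.real (R k)| ≤ ε / 2 * n := by
    intro k hk
    have h1 := (hn k (Finset.mem_range.2 (by omega))).le
    have h2 : countIn x n (R k) - n * ν.real (R k) =
        (countIn x n (R k) / n - ν.real (R k)) * n := by field_simp
    rw [h2, abs_mul, abs_of_pos hn0']
    gcongr
  classical
  have hex : ∃ k, R k ⊆ U := ⟨m, by rw [hRm]; exact Set.empty_subset _⟩
  have hfind := Nat.find_spec hex
  have hfindm : Nat.find hex ≤ m := Nat.find_le (by rw [hRm]; exact Set.empty_subset _)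
  rcases hk : Nat.find hex with _ | k
  · rw [hk, hR0] at hfind
    have hUu : U = R 0 := by rw [hR0]; exact Set.univ_subset_iff.1 hfind
    rw [hUu]
    refine (hn' 0 (by omega)).trans ?_
    gcongr; linarith
  · rw [hk] at hfind hfindm
    have hnot : ¬ R k ⊆ U := Nat.find_min hex (by omega)
    have hsub : U ⊆ R k := ((hU.total (hRup k)).resolve_right hnot)
    have h1 := abs_le.1 (hn' k (by omega))
    have h2 := abs_le.1 (hn' (k + 1) hfindm)
    have h3 := countIn_mono x n hsub
    have h4 := countIn_mono x n hfind
    have h5 : ν.real U ≤ ν.real (R k) := measureReal_mono hsub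
    have h6 : ν.real (R (k + 1)) ≤ ν.real U := measureReal_mono hfind
    have h7 := hRstep k (by omega)
    rw [abs_le]
    constructor <;> nlinarith

section LLN

variable {Ω : Type*} [MeasurableSpace Ω] {P : Measure Ω} {X : ℕ → Ω → ℝ} {ν : Measure ℝ}
  [IsProbabilityMeasure ν]

lemma continuous_cdf_of_bound {B : ℝ}
    (hν : ∀ a b : ℝ, a ≤ b → ν.real (Set.Ioc a b) ≤ B * (b - a)) : Continuous (cdf ν) := by
  have key : ∀ a b : ℝ, a ≤ b → |cdf ν b - cdf ν a| ≤ B * |b - a| := by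
    intro a b hab
    rw [abs_of_nonneg (sub_nonneg.2 (monotone_cdf ν hab)), abs_of_nonneg (sub_nonneg.2 hab)]
    refine le_trans (le_of_eq ?_) (hν a b hab)
    have h := measureReal_union (μ := ν)
      (Set.Iic_disjoint_Ioc le_rfl : Disjoint (Set.Iic a) (Set.Ioc a b)) measurableSet_Ioc
    rw [Set.Iic_union_Ioc_eq_Iic hab] at h
    rw [cdf_eq_real, cdf_eq_real]
    linarith
  refine LipschitzWith.continuous (K := B.toNNReal) (LipschitzWith.of_dist_le_mul fun x y => ?_)
  rw [Real.dist_eq, Real.dist_eq]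
  have hB : ∀ z : ℝ, B * |z| ≤ B.toNNReal * |z| := fun z => by
    gcongr; exact Real.le_coe_toNNReal B
  rcases le_total x y with hxy | hxy
  · rw [abs_sub_comm, abs_sub_comm x]; exact (key x y hxy).trans (hB _)
  · exact (key y x hxy).trans (hB _)

/-- Continuity of the distribution function provides exact quantiles of the levels `k / m`. The
values of `t` at other indices are dummies. -/
lemma exists_grid (hc : Continuous (cdf ν)) {m : ℕ} (hm : 0 < m) :
    ∃ R : ℕ → Set ℝ, R 0 = Set.univ ∧ R m = ∅ ∧ (∀ k, IsUpperSet (R k)) ∧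
      (∀ k, MeasurableSet (R k)) ∧ ∀ k < m, ν.real (R k) ≤ ν.real (R (k + 1)) + 1 / m := by
  have hm0 : (0 : ℝ) < m := by exact_mod_cast hm
  have hq : ∀ k : ℕ, ∃ t, 0 < k → k < m → cdf ν t = k / m := by
    intro k
    by_cases hk : 0 < k ∧ k < m
    · have h0 : (0 : ℝ) < k / m := div_pos (by exact_mod_cast hk.1) hm0
      have h1 : (k : ℝ) / m < 1 := by rw [div_lt_one hm0]; exact_mod_cast hk.2
      obtain ⟨a, ha⟩ := ((tendsto_cdf_atBot ν).eventually (gt_mem_nhds h0)).exists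
      obtain ⟨b, hb⟩ := ((tendsto_cdf_atTop ν).eventually (lt_mem_nhds h1)).exists
      obtain ⟨t, ht⟩ := mem_range_of_exists_le_of_exists_ge hc ⟨a, ha.le⟩ ⟨b, hb.le⟩
      exact ⟨t, fun _ _ => ht⟩
    · exact ⟨0, fun h1 h2 => absurd ⟨h1, h2⟩ hk⟩
  choose t ht using hq
  have hval : ∀ k ≤ m, ν.real
      (if k = 0 then Set.univ else if k < m then Set.Ioi (t k) else ∅) = 1 - k / m := by
    intro k hk
    split_ifs with h0 h1
    · simp [h0]
    · rw [← ht k (Nat.pos_of_ne_zero h0) h1, cdf_eq_real,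
        ← probReal_compl_eq_one_sub measurableSet_Iic, Set.compl_Iic]
    · have : k = m := by omega
      rw [this, measureReal_empty, div_self hm0.ne', sub_self]
  refine ⟨fun k => if k = 0 then Set.univ else if k < m then Set.Ioi (t k) else ∅, by simp,
    by simp [hm.ne'], fun k => ?_, fun k => ?_, fun k hk => ?_⟩
  · dsimp only
    split_ifs
    exacts [isUpperSet_univ, isUpperSet_Ioi _, isUpperSet_empty]
  · dsimp only
    split_ifs
    exacts [MeasurableSet.univ, measurableSet_Ioi, MeasurableSet.empty]
  · rw [hval k hk.le, hval (k + 1) hk]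
    push_cast
    refine le_of_eq ?_
    ring

lemma ae_uniformLLN (hX : ∀ i, HasLaw (X i) ν P) (hindep : iIndepFun X P) {B : ℝ}
    (hν : ∀ a b : ℝ, a ≤ b → ν.real (Set.Ioc a b) ≤ B * (b - a)) :
    ∀ᵐ ω ∂P, UniformLLN (fun i => X i ω) ν := by
  have hgrid := fun m : ℕ => exists_grid (continuous_cdf_of_bound hν) m.succ_pos
  choose R hR0 hRm hRup hRmeas hRstep using hgrid
  have hlim : ∀ᵐ ω ∂P, ∀ m k, Tendsto (fun n : ℕ => countIn (fun i => X i ω) n (R m k) / n) atTop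
      (𝓝 (ν.real (R m k))) := by
    refine ae_all_iff.2 fun m => ae_all_iff.2 fun k => ?_
    have h := ae_tendsto_average hX hindep (measurable_const.indicator (hRmeas m k))
      (g := (R m k).indicator fun _ => (1 : ℝ)) ((integrable_const 1).indicator (hRmeas m k))
    filter_upwards [h] with ω hω
    rw [integral_indicator (hRmeas m k)] at hω
    simpa [countIn] using hω
  filter_upwards [hlim] with ω hω
  refine uniformLLN_of_grid fun m hm => ?_
  obtain ⟨m, rfl⟩ := Nat.exists_eq_succ_of_ne_zero hm.ne'
  exact ⟨R m, hR0 m, hRm m, hRup m, hRstep m, hω m⟩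

end LLN

lemma abs_sub_sum_indicator_le {N : ℕ} {y : ℝ} (h0 : 0 ≤ y) (hN : y ≤ N) :
    |y - ∑ k ∈ Finset.range N, if (k : ℝ) + 1 ≤ y then (1 : ℝ) else 0| ≤ 1 := by
  have h1 : ∑ k ∈ Finset.range N, (if (k : ℝ) + 1 ≤ y then (1 : ℝ) else 0) = ⌊y⌋₊ := by
    rw [← Finset.sum_filter, Finset.sum_const, nsmul_eq_mul, mul_one]
    congr 1
    have : (Finset.range N).filter (fun k : ℕ => (k : ℝ) + 1 ≤ y) = Finset.range ⌊y⌋₊ := by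
      ext k
      rw [Finset.mem_filter, Finset.mem_range, Finset.mem_range, ← Nat.succ_le_iff (n := ⌊y⌋₊),
        Nat.le_floor_iff h0]
      push_cast
      refine ⟨fun h => h.2, fun h => ⟨?_, h⟩⟩
      have : (k : ℝ) < N := by linarith
      exact_mod_cast this
    rw [this, Finset.card_range]
  rw [h1, abs_of_nonneg (sub_nonneg.2 (Nat.floor_le h0))]
  linarith [Nat.lt_floor_add_one y]

/-! ### From upper sets to bounded monotone functions and logarithms of their differences. -/

section Uniform

variable {x : ℕ → ℝ} {ν : Measure ℝ} [IsProbabilityMeasure ν]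

/-- A discrete layer-cake formula: `N * g` differs by at most `1` from the number of levels `k + 1 ≤
N` that it reaches, and the superlevel sets of `g` are upper sets. Sum and integral each incur an
error `1 / N` per observation, whence the requirement `4 / ε < N`. -/
lemma UniformLLN.unit_monotone (h : UniformLLN x ν) {ε : ℝ} (hε : 0 < ε) :
    ∀ᶠ n : ℕ in atTop, ∀ g : ℝ → ℝ, Monotone g → (∀ y, 0 ≤ g y) → (∀ y, g y ≤ 1) →
      |∑ i ∈ Finset.range n, g (x i) - n * ∫ y, g y ∂ν| ≤ ε * n := by
  obtain ⟨N, hN⟩ := exists_nat_gt (4 / ε)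
  have hN0 : (0 : ℝ) < N := lt_trans (by positivity) hN
  have hNε : 2 ≤ ε / 2 * N := by rw [div_lt_iff₀ hε] at hN; linarith
  filter_upwards [h (ε / 2) (by linarith)] with n hn g hg hg0 hg1
  set U : ℕ → Set ℝ := fun k => {y | (k : ℝ) + 1 ≤ N * g y} with hU
  have hUup : ∀ k, IsUpperSet (U k) := fun k y z hyz hy => by
    have h1 := hg hyz
    have h2 : (k : ℝ) + 1 ≤ N * g y := hy
    exact h2.trans (by gcongr)
  have hUm : ∀ k, MeasurableSet (U k) := fun k =>
    measurableSet_le measurable_const (hg.measurable.const_mul _)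
  have hind : ∀ y, |N * g y - ∑ k ∈ Finset.range N, (U k).indicator (fun _ => (1 : ℝ)) y| ≤ 1 := by
    intro y
    have h1 := abs_sub_sum_indicator_le (N := N) (y := N * g y) (by have := hg0 y; positivity)
      (mul_le_of_le_one_right hN0.le (hg1 y))
    convert h1 using 4 with k hk
    simp [Set.indicator, hU]
  have hgint : Integrable g ν := Integrable.of_bound hg.measurable.aestronglyMeasurable 1
    (Eventually.of_forall fun y => by rw [Real.norm_of_nonneg (hg0 y)]; exact hg1 y)
  have hUint : ∀ k, Integrable ((U k).indicator fun _ => (1 : ℝ)) ν := fun k =>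
    (integrable_const 1).indicator (hUm k)
  have hsum : |N * ∑ i ∈ Finset.range n, g (x i) - ∑ k ∈ Finset.range N, countIn x n (U k)| ≤ n := by
    simp only [countIn]
    rw [Finset.sum_comm, Finset.mul_sum, ← Finset.sum_sub_distrib]
    refine (Finset.abs_sum_le_sum_abs _ _).trans ?_
    refine (Finset.sum_le_sum fun i _ => hind (x i)).trans ?_
    simp
  have hintg : |N * ∫ y, g y ∂ν - ∑ k ∈ Finset.range N, ν.real (U k)| ≤ 1 := by
    have h1 : N * ∫ y, g y ∂ν - ∑ k ∈ Finset.range N, ν.real (U k) =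
        ∫ y, (N * g y - ∑ k ∈ Finset.range N, (U k).indicator (fun _ => (1 : ℝ)) y) ∂ν := by
      rw [integral_sub (hgint.const_mul _) (integrable_finsetSum _ fun k _ => hUint k),
        integral_const_mul, integral_finsetSum _ fun k _ => hUint k]
      congr 1
      refine Finset.sum_congr rfl fun k _ => ?_
      rw [integral_indicator (hUm k)]; simp
    rw [h1]
    have h2 := norm_integral_le_of_norm_le_const (μ := ν) (C := 1)
      (Eventually.of_forall fun y => by rw [Real.norm_eq_abs]; exact hind y)
    simpa using h2
  have hdiff : |∑ k ∈ Finset.range N, countIn x n (U k) - n * ∑ k ∈ Finset.range N, ν.real (U k)| ≤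
      N * (ε / 2 * n) := by
    rw [Finset.mul_sum, ← Finset.sum_sub_distrib]
    refine (Finset.abs_sum_le_sum_abs _ _).trans ?_
    refine (Finset.sum_le_sum fun k _ => hn (U k) (hUup k)).trans ?_
    simp
  have hn0 : (0 : ℝ) ≤ n := Nat.cast_nonneg n
  have hfin : N * |∑ i ∈ Finset.range n, g (x i) - n * ∫ y, g y ∂ν| ≤ N * (ε * n) := by
    rw [← abs_of_pos hN0, ← abs_mul, abs_of_pos hN0]
    have h1 : N * (∑ i ∈ Finset.range n, g (x i) - n * ∫ y, g y ∂ν) =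
        (N * ∑ i ∈ Finset.range n, g (x i) - ∑ k ∈ Finset.range N, countIn x n (U k)) +
        (∑ k ∈ Finset.range N, countIn x n (U k) - n * ∑ k ∈ Finset.range N, ν.real (U k)) -
        n * (N * ∫ y, g y ∂ν - ∑ k ∈ Finset.range N, ν.real (U k)) := by ring
    rw [h1]
    refine (abs_sub _ _).trans ?_
    refine (add_le_add_left (abs_add_le _ _) _).trans ?_
    rw [abs_mul, abs_of_nonneg hn0]
    have h2 := mul_le_mul_of_nonneg_left hintg hn0
    nlinarith
  exact le_of_mul_le_mul_left hfin hN0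

lemma UniformLLN.monotone (h : UniformLLN x ν) {V ε : ℝ} (hV : 0 < V) (hε : 0 < ε) :
    ∀ᶠ n : ℕ in atTop, ∀ g : ℝ → ℝ, Monotone g → (∀ y, |g y| ≤ V) →
      |∑ i ∈ Finset.range n, g (x i) - n * ∫ y, g y ∂ν| ≤ ε * n := by
  filter_upwards [h.unit_monotone (div_pos hε (by linarith : 0 < 2 * V))] with n hn g hg hgV
  have h1 := hn (fun y => (g y + V) / (2 * V)) (fun y z hyz => by
      have := hg hyz
      dsimp only
      gcongr)
    (fun y => div_nonneg (by linarith [(abs_le.1 (hgV y)).1]) (by linarith))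
    (fun y => by rw [div_le_one (by linarith)]; linarith [(abs_le.1 (hgV y)).2])
  have hgint : Integrable g ν := Integrable.of_bound hg.measurable.aestronglyMeasurable V
    (Eventually.of_forall hgV)
  rw [← Finset.sum_div, Finset.sum_add_distrib, integral_div,
    integral_add hgint (integrable_const V)] at h1
  simp only [Finset.sum_const, Finset.card_range, nsmul_eq_mul, integral_const, probReal_univ,
    smul_eq_mul, one_mul] at h1
  have h2 : (∑ i ∈ Finset.range n, g (x i) + n * V) / (2 * V) -
      n * ((∫ y, g y ∂ν + V) / (2 * V)) =
      (∑ i ∈ Finset.range n, g (x i) - n * ∫ y, g y ∂ν) / (2 * V) := by ring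
  rw [h2, abs_div, abs_of_pos (by linarith : 0 < 2 * V), div_le_iff₀ (by linarith)] at h1
  refine h1.trans (le_of_eq ?_)
  field_simp

lemma abs_log_add_sub_le {δ u v : ℝ} (hδ : 0 < δ) (hu : 0 ≤ u) (hv : 0 ≤ v) :
    |Real.log (u + δ) - Real.log (v + δ)| ≤ 1 / δ * |u - v| := by
  have key : ∀ a b : ℝ, 0 ≤ a → a ≤ b →
      |Real.log (b + δ) - Real.log (a + δ)| ≤ 1 / δ * |b - a| := by
    intro a b ha hab
    rw [abs_of_nonneg (sub_nonneg.2 (Real.log_le_log (by linarith) (by linarith))),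
      abs_of_nonneg (sub_nonneg.2 hab), ← Real.log_div (by linarith) (by linarith)]
    refine (Real.log_le_sub_one_of_pos (div_pos (by linarith) (by linarith))).trans ?_
    have h1 : (b + δ) / (a + δ) - 1 = 1 / (a + δ) * (b - a) := by
      have : a + δ ≠ 0 := by linarith
      field_simp; ring
    rw [h1]
    have : 0 ≤ b - a := by linarith
    gcongr
    linarith
  rcases le_total u v with h | h
  · rw [abs_sub_comm, abs_sub_comm u]; exact key u v hu h
  · exact key v u hv h

/-- A uniform law of large numbers for logarithms of differences of monotone functions. -/
lemma UniformLLN.log_sub (h : UniformLLN x ν) {V δ ε : ℝ} (hV : 0 < V) (hδ : 0 < δ)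
    (hε : 0 < ε) :
    ∀ᶠ n : ℕ in atTop, ∀ p q : ℝ → ℝ, Monotone p → Monotone q → (∀ y, |p y| ≤ V) →
      (∀ y, |q y| ≤ V) → (∀ y, 0 ≤ p y - q y) →
      |∑ i ∈ Finset.range n, Real.log (p (x i) - q (x i) + δ) -
        n * ∫ y, Real.log (p y - q y + δ) ∂ν| ≤ ε * n := by
  set W : ℝ := |Real.log δ| + 1 / δ * (2 * V) + 1 / δ * (2 * V) with hW
  have hWpos : 0 < W := by positivity
  filter_upwards [h.monotone hWpos (by linarith : 0 < ε / 2)] with n hn p q hp hq hpV hqV hpq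
  have hb : ∀ y, |1 / δ * (p y + q y)| ≤ 1 / δ * (2 * V) := by
    intro y
    rw [abs_mul, abs_of_pos (by positivity : 0 < 1 / δ)]
    gcongr
    exact (abs_add_le _ _).trans (by linarith [hpV y, hqV y])
  have hlogb : ∀ y, |Real.log (p y - q y + δ)| ≤ |Real.log δ| + 1 / δ * (2 * V) := by
    intro y
    have h1 := abs_log_add_sub_le hδ (hpq y) le_rfl
    rw [zero_add, sub_zero, abs_of_nonneg (hpq y)] at h1
    have h2 : p y - q y ≤ 2 * V := by
      linarith [(abs_le.1 (hpV y)).2, (abs_le.1 (hqV y)).1]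
    have h3 : 1 / δ * (p y - q y) ≤ 1 / δ * (2 * V) := by gcongr
    have h4 := abs_sub_abs_le_abs_sub (Real.log (p y - q y + δ)) (Real.log δ)
    linarith
  have hg2 : Monotone fun y => 1 / δ * (p y + q y) := fun y z hyz => by
    have := hp hyz
    have := hq hyz
    dsimp only
    gcongr
  -- `log (· + δ)` is Lipschitz with constant `1 / δ` on `[0, ∞)`, and the increments of `p - q` are
  -- bounded by those of `p + q`. Adding `(p + q) / δ` therefore makes the logarithm monotone.
  have hg1 : Monotone fun y => Real.log (p y - q y + δ) + 1 / δ * (p y + q y) := by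
    intro y z hyz
    have h1 := abs_log_add_sub_le hδ (hpq y) (hpq z)
    have hpyz := hp hyz
    have hqyz := hq hyz
    have h2 : |p y - q y - (p z - q z)| ≤ (p z - p y) + (q z - q y) := by
      rw [abs_le]; constructor <;> linarith
    have h3 : 1 / δ * |p y - q y - (p z - q z)| ≤ 1 / δ * ((p z - p y) + (q z - q y)) := by gcongr
    have h4 := (le_abs_self _).trans (h1.trans h3)
    dsimp only
    linarith
  have e1 := hn _ hg1 fun y => (abs_add_le _ _).trans (by
    rw [hW]; linarith [hlogb y, hb y])
  have e2 := hn _ hg2 fun y => (hb y).trans (by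
    rw [hW]
    have : 0 ≤ 1 / δ * (2 * V) := by positivity
    linarith [abs_nonneg (Real.log δ)])
  have hint1 : Integrable (fun y => Real.log (p y - q y + δ)) ν :=
    Integrable.of_bound
      (Real.measurable_log.comp ((hp.measurable.sub hq.measurable).add_const δ)).aestronglyMeasurable
      _ (Eventually.of_forall hlogb)
  have hint2 : Integrable (fun y => 1 / δ * (p y + q y)) ν :=
    Integrable.of_bound hg2.measurable.aestronglyMeasurable _ (Eventually.of_forall hb)
  rw [Finset.sum_add_distrib, integral_add hint1 hint2] at e1
  rw [abs_le] at e1 e2 ⊢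
  constructor <;> linarith

end Uniform

/-! ### Monotone decomposition of skew-normal densities -/

lemma pdf_mono {t u : ℝ} (htu : t ≤ u) (hu : u ≤ 0) : φ t ≤ φ u := by
  rw [pdf_eq, pdf_eq]
  gcongr 1
  rw [Real.exp_le_exp]
  nlinarith

lemma pdf_anti {t u : ℝ} (htu : t ≤ u) (ht : 0 ≤ t) : φ u ≤ φ t := by
  rw [← pdf_neg t, ← pdf_neg u]
  exact pdf_mono (by linarith) (by linarith)

lemma exists_monotone_pdf : ∃ a b : ℝ → ℝ, Monotone a ∧ Monotone b ∧ (∀ t, 0 ≤ a t) ∧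
    (∀ t, 0 ≤ b t) ∧ (∀ t, a t ≤ 1 / 2) ∧ (∀ t, b t ≤ 1 / 2) ∧ ∀ t, φ t = a t - b t := by
  refine ⟨fun t => φ (min t 0), fun t => φ 0 - φ (max t 0), fun t u h => ?_, fun t u h => ?_,
    fun t => (pdf_pos _).le, fun t => ?_, fun t => ?_, fun t => ?_, fun t => ?_⟩
  · exact pdf_mono (min_le_min_right 0 h) (min_le_right _ _)
  · have := pdf_anti (max_le_max_right 0 h) (le_max_right t 0)
    dsimp only
    linarith
  · have := pdf_anti (le_max_right t 0) le_rfl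
    dsimp only
    linarith
  · have := two_mul_pdf_le_one (min t 0)
    dsimp only
    linarith
  · have := two_mul_pdf_le_one 0
    have := pdf_pos (max t 0)
    dsimp only
    linarith
  · rcases le_total t 0 with h | h <;> simp [h]

/-- For `l ≥ 0`, multiply a monotone decomposition `φ = a - b` by the increasing factor `Φ(l t)`.
For `l ≤ 0`, write that factor as `1 - Φ(-l t)` and regroup. The bounds involve neither location nor
shape, which is what makes the law of large numbers uniform. -/
lemma exists_monotone_snDensity (m l : ℝ) {s : ℝ} (hs : 0 < s) :
    ∃ p q : ℝ → ℝ, Monotone p ∧ Monotone q ∧ (∀ x, |p x| ≤ 2 / s) ∧ (∀ x, |q x| ≤ 2 / s) ∧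
      ∀ x, snDensity m s l x = p x - q x := by
  obtain ⟨a, b, ha, hb, ha0, hb0, ha1, hb1, hab⟩ := exists_monotone_pdf
  have hΦ : ∀ l : ℝ, 0 ≤ l → Monotone fun t => Φ (l * t) := fun l hl t u h =>
    monotone_cdf _ (by gcongr)
  have hΦ0 : ∀ t, 0 ≤ Φ t := fun t => (cdf_pos t).le
  have hΦ1 : ∀ t, Φ t ≤ 1 := fun t => (cdf_lt_one t).le
  obtain ⟨P, Q, hP, hQ, hP0, hQ0, hP1, hQ1, hPQ⟩ : ∃ P Q : ℝ → ℝ, Monotone P ∧ Monotone Q ∧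
      (∀ t, 0 ≤ P t) ∧ (∀ t, 0 ≤ Q t) ∧ (∀ t, P t ≤ 1) ∧ (∀ t, Q t ≤ 1) ∧
      ∀ t, φ t * Φ (l * t) = P t - Q t := by
    have hmul : ∀ u v : ℝ, 0 ≤ u → u ≤ 1 / 2 → 0 ≤ v → v ≤ 1 → 0 ≤ u * v ∧ u * v ≤ 1 / 2 :=
      fun u v h1 h2 h3 h4 => ⟨by positivity, by nlinarith⟩
    rcases le_total 0 l with hl | hl
    · refine ⟨fun t => a t * Φ (l * t), fun t => b t * Φ (l * t),
        ha.mul (hΦ l hl) ha0 fun t => hΦ0 _, hb.mul (hΦ l hl) hb0 fun t => hΦ0 _,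
        fun t => (hmul _ _ (ha0 t) (ha1 t) (hΦ0 _) (hΦ1 _)).1,
        fun t => (hmul _ _ (hb0 t) (hb1 t) (hΦ0 _) (hΦ1 _)).1,
        fun t => (hmul _ _ (ha0 t) (ha1 t) (hΦ0 _) (hΦ1 _)).2.trans (by norm_num),
        fun t => (hmul _ _ (hb0 t) (hb1 t) (hΦ0 _) (hΦ1 _)).2.trans (by norm_num),
        fun t => by rw [hab t]; ring⟩
    · have hl' : 0 ≤ -l := by linarith
      have hma : ∀ t, 0 ≤ a t * Φ (-l * t) ∧ a t * Φ (-l * t) ≤ 1 / 2 := fun t =>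
        hmul _ _ (ha0 t) (ha1 t) (hΦ0 _) (hΦ1 _)
      have hmb : ∀ t, 0 ≤ b t * Φ (-l * t) ∧ b t * Φ (-l * t) ≤ 1 / 2 := fun t =>
        hmul _ _ (hb0 t) (hb1 t) (hΦ0 _) (hΦ1 _)
      refine ⟨fun t => a t + b t * Φ (-l * t), fun t => b t + a t * Φ (-l * t),
        ha.add (hb.mul (hΦ _ hl') hb0 fun t => hΦ0 _),
        hb.add (ha.mul (hΦ _ hl') ha0 fun t => hΦ0 _),
        fun t => add_nonneg (ha0 t) (hmb t).1, fun t => add_nonneg (hb0 t) (hma t).1,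
        fun t => by linarith [ha1 t, (hmb t).2], fun t => by linarith [hb1 t, (hma t).2],
        fun t => ?_⟩
      have h1 : Φ (l * t) = 1 - Φ (-l * t) := by
        rw [← cdf_neg]; congr 1; ring
      rw [h1, hab t]; ring
  have hmono : ∀ F : ℝ → ℝ, Monotone F → Monotone fun x => 2 / s * F ((x - m) / s) := by
    intro F hF x y hxy
    have := hF (by gcongr : (x - m) / s ≤ (y - m) / s)
    dsimp only
    gcongr
  have hbd : ∀ F : ℝ → ℝ, (∀ t, 0 ≤ F t) → (∀ t, F t ≤ 1) →
      ∀ x, |2 / s * F ((x - m) / s)| ≤ 2 / s := by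
    intro F h0 h1 x
    have := h0 ((x - m) / s)
    rw [abs_of_nonneg (by positivity)]
    exact mul_le_of_le_one_right (by positivity) (h1 _)
  refine ⟨_, _, hmono P hP, hmono Q hQ, hbd P hP0 hP1, hbd Q hQ0 hQ1, fun x => ?_⟩
  rw [snDensity, mul_assoc, hPQ]; ring

/-! ### A strict form of the information inequality -/

lemma log_sub_log_le {a b : ℝ} (ha : 0 < a) (hb : 0 < b) :
    Real.log a - Real.log b ≤ 2 * (√(a / b) - 1) := by
  have h1 : 0 < √(a / b) := Real.sqrt_pos.2 (div_pos ha hb)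
  have h2 := Real.log_le_sub_one_of_pos h1
  rw [Real.log_sqrt (div_pos ha hb).le, Real.log_div ha.ne' hb.ne'] at h2
  linarith

lemma Mixture.integrable_sqrt_mul {p : ℕ} (Ψ : Mixture p) {f : ℝ → ℝ} {M : ℝ} (hf : Measurable f)
    (hfM : ∀ x, f x ≤ M) : Integrable fun x => √(f x) * √(Ψ.density x) := by
  refine (Ψ.integrable_sqrt_density.const_mul (√M)).mono'
    (hf.sqrt.mul Ψ.continuous_density.measurable.sqrt).aestronglyMeasurable
    (Eventually.of_forall fun x => ?_)
  rw [Real.norm_of_nonneg (by positivity)]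
  gcongr
  exact hfM x

lemma integrable_log_add {ν : Measure ℝ} [IsProbabilityMeasure ν] {f : ℝ → ℝ} {M δ : ℝ}
    (hf : Measurable f) (hf0 : ∀ x, 0 ≤ f x) (hfM : ∀ x, f x ≤ M) (hδ : 0 < δ) :
    Integrable (fun x => Real.log (f x + δ)) ν := by
  refine Integrable.of_bound (Real.measurable_log.comp (hf.add_const δ)).aestronglyMeasurable
    (|Real.log δ| + 1 / δ * M) (Eventually.of_forall fun x => ?_)
  have h1 := abs_log_add_sub_le hδ (hf0 x) le_rfl
  rw [zero_add, sub_zero, abs_of_nonneg (hf0 x)] at h1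
  have h3 : 1 / δ * f x ≤ 1 / δ * M := by gcongr; exact hfM x
  have h4 := abs_sub_abs_le_abs_sub (Real.log (f x + δ)) (Real.log δ)
  rw [Real.norm_eq_abs]
  linarith

/-- A subprobability density whose expected logarithm is at least that of the true density is the
true density. -/
lemma Mixture.ae_eq_density_of_integral_log_le {p : ℕ} (Ψ : Mixture p) {f : ℝ → ℝ} {M : ℝ}
    (hf : Measurable f) (hf0 : ∀ x, 0 ≤ f x) (hfM : ∀ x, f x ≤ M) (hfint : Integrable f)
    (hf1 : ∫ x, f x ≤ 1)
    (h : ∀ δ, 0 < δ →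
      ∫ x, Real.log (Ψ.density x) ∂Ψ.law ≤ ∫ x, Real.log (f x + δ) ∂Ψ.law) :
    ∀ᵐ x, f x = Ψ.density x := by
  set S := ∫ x, √(Ψ.density x) with hS
  have hprod := Ψ.integrable_sqrt_mul hf hfM
  have hpos := Ψ.density_pos
  -- From `log a - log b ≤ 2 (√(a / b) - 1)` the Hellinger affinity of `f + δ` and the true density
  -- is at least `1`. Letting `δ → 0` gives affinity at least `1` for `f`, so `∫ (√f - √f₀) ^ 2 ≤
  -- 0`, where `f₀` denotes the true density.
  have key : ∀ δ, 0 < δ → 1 ≤ (∫ x, √(f x) * √(Ψ.density x)) + √δ * S := by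
    intro δ hδ
    have hprodδ := Ψ.integrable_sqrt_mul (f := fun x => f x + δ) (M := M + δ) (hf.add_const δ)
      fun x => by linarith [hfM x]
    have hmul : ∀ x, Ψ.density x * √((f x + δ) / Ψ.density x) = √(f x + δ) * √(Ψ.density x) := by
      intro x
      rw [Real.sqrt_div (by linarith [hf0 x])]
      have h1 := Real.mul_self_sqrt (hpos x).le
      have h2 := Real.sqrt_pos.2 (hpos x)
      rw [mul_div_assoc', div_eq_iff h2.ne']
      linear_combination -√(f x + δ) * h1
    have hsqrt : Integrable (fun x => √((f x + δ) / Ψ.density x)) Ψ.law := by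
      rw [Ψ.integrable_law_iff]
      simpa only [hmul] using hprodδ
    have h1 : 0 ≤ ∫ x, (Real.log (f x + δ) - Real.log (Ψ.density x)) ∂Ψ.law := by
      rw [integral_sub (integrable_log_add hf hf0 hfM hδ) Ψ.integrable_log_density]
      linarith [h δ hδ]
    have h2 : ∫ x, (Real.log (f x + δ) - Real.log (Ψ.density x)) ∂Ψ.law ≤
        ∫ x, 2 * (√((f x + δ) / Ψ.density x) - 1) ∂Ψ.law := by
      refine integral_mono ((integrable_log_add hf hf0 hfM hδ).sub Ψ.integrable_log_density)
        ((hsqrt.sub (integrable_const 1)).const_mul 2) fun x => ?_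
      exact log_sub_log_le (by linarith [hf0 x]) (hpos x)
    rw [integral_const_mul, integral_sub hsqrt (integrable_const 1),
      Ψ.integral_law fun x => √((f x + δ) / Ψ.density x)] at h2
    simp only [hmul, integral_const, probReal_univ, smul_eq_mul, mul_one] at h2
    have h3 : ∫ x, √(f x + δ) * √(Ψ.density x) ≤
        ∫ x, (√(f x) * √(Ψ.density x) + √δ * √(Ψ.density x)) := by
      refine integral_mono hprodδ (hprod.add (Ψ.integrable_sqrt_density.const_mul _)) fun x => ?_
      dsimp only
      rw [← add_mul]
      gcongr
      exact sqrt_add_le (hf0 x) hδ.le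
    rw [integral_add hprod (Ψ.integrable_sqrt_density.const_mul _), integral_const_mul] at h3
    linarith
  have hle : 1 ≤ ∫ x, √(f x) * √(Ψ.density x) := by
    have hlim : Tendsto (fun δ : ℝ => (∫ x, √(f x) * √(Ψ.density x)) + √δ * S) (𝓝[>] 0)
        (𝓝 ((∫ x, √(f x) * √(Ψ.density x)) + √0 * S)) := by
      refine Tendsto.mono_left ?_ nhdsWithin_le_nhds
      exact ((Real.continuous_sqrt.mul continuous_const).const_add _).tendsto 0
    rw [Real.sqrt_zero, zero_mul, add_zero] at hlim
    exact ge_of_tendsto hlim (by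
      filter_upwards [self_mem_nhdsWithin] with δ hδ using key δ hδ)
  have hsq : ∀ x, (√(f x) - √(Ψ.density x)) ^ 2 =
      f x + Ψ.density x - 2 * (√(f x) * √(Ψ.density x)) := by
    intro x
    have h1 := Real.sq_sqrt (hf0 x)
    have h2 := Real.sq_sqrt (hpos x).le
    linear_combination h1 + h2
  have hsqint : Integrable fun x => (√(f x) - √(Ψ.density x)) ^ 2 := by
    simp only [hsq]
    exact (hfint.add Ψ.integrable_density).sub (hprod.const_mul 2)
  have hzero : ∫ x, (√(f x) - √(Ψ.density x)) ^ 2 = 0 := by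
    refine le_antisymm ?_ (integral_nonneg fun x => sq_nonneg _)
    simp only [hsq]
    have hadd : Integrable fun x => f x + Ψ.density x := hfint.add Ψ.integrable_density
    rw [integral_sub hadd (hprod.const_mul 2),
      integral_add hfint Ψ.integrable_density, Ψ.integral_density, integral_const_mul]
    linarith
  have hae := (integral_eq_zero_iff_of_nonneg (fun x => sq_nonneg _) hsqint).1 hzero
  filter_upwards [hae] with x hx
  have h1 : √(f x) = √(Ψ.density x) := sub_eq_zero.1 (pow_eq_zero_iff two_ne_zero |>.1 hx)
  exact (Real.sqrt_inj (hf0 x) (hpos x).le).1 h1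

/-! ### The limit densities -/

lemma skewFactor_nonneg (l : EReal) (t : ℝ) : 0 ≤ skewFactor l t := by
  unfold skewFactor
  have := (cdf_pos (l.toReal * t)).le
  split_ifs <;> first | exact zero_le_one | exact le_rfl | exact this

lemma skewFactor_le_one (l : EReal) (t : ℝ) : skewFactor l t ≤ 1 := by
  unfold skewFactor
  have := (cdf_lt_one (l.toReal * t)).le
  split_ifs <;> first | exact zero_le_one | exact le_rfl | exact this

lemma measurable_skewFactor (l : EReal) : Measurable (skewFactor l) := by
  have h1 : Measurable fun t : ℝ => Φ (l.toReal * t) :=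
    (continuous_cdf_std.comp (continuous_const.mul continuous_id)).measurable
  unfold skewFactor
  refine Measurable.ite (by simp) (Measurable.ite measurableSet_Ioi measurable_const
    measurable_const) (Measurable.ite (by simp) (Measurable.ite measurableSet_Iio measurable_const
    measurable_const) h1)

lemma measurable_limDensity (θ : EReal × EReal × EReal) : Measurable (limDensity θ) := by
  unfold limDensity
  split_ifs
  · exact measurable_const
  · unfold skewDensity
    have h1 : Measurable fun x : ℝ => (x - θ.1.toReal) / θ.2.1.toReal := by fun_prop
    exact ((continuous_pdf.measurable.comp h1).const_mul _).mul
      ((measurable_skewFactor _).comp h1)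

lemma limDensity_nonneg {θ : EReal × EReal × EReal} (h : 0 < θ.2.1) (x : ℝ) :
    0 ≤ limDensity θ x := by
  unfold limDensity
  split_ifs
  · exact le_rfl
  · unfold skewDensity
    have h1 := EReal.toReal_nonneg h.le
    have h2 := (pdf_pos ((x - θ.1.toReal) / θ.2.1.toReal)).le
    have h3 := skewFactor_nonneg θ.2.2 ((x - θ.1.toReal) / θ.2.1.toReal)
    positivity

lemma limDensity_le {θ : EReal × EReal × EReal} (h : 0 < θ.2.1) (x : ℝ) :
    limDensity θ x ≤ 1 / θ.2.1.toReal := by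
  have h1 := EReal.toReal_nonneg h.le
  unfold limDensity
  split_ifs
  · positivity
  · unfold skewDensity
    set t := (x - θ.1.toReal) / θ.2.1.toReal
    have h2 := (pdf_pos t).le
    have h4 := two_mul_pdf_le_one t
    calc 2 / θ.2.1.toReal * φ t * skewFactor θ.2.2 t ≤ 2 / θ.2.1.toReal * φ t :=
          mul_le_of_le_one_right (by positivity) (skewFactor_le_one _ _)
      _ = 1 / θ.2.1.toReal * (2 * φ t) := by ring
      _ ≤ 1 / θ.2.1.toReal := mul_le_of_le_one_right (by positivity) h4

/-! ### Partial sums of mixture densities -/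

namespace Mixture

variable {p : ℕ}

/-- The part of the mixture density that comes from the components in `N`. -/
noncomputable def partDensity (Ψ : Mixture p) (N : Finset (Fin p)) (x : ℝ) : ℝ :=
  ∑ k ∈ N, Ψ.weight k * snDensity (Ψ.loc k) (Ψ.scale k) (Ψ.shape k) x

lemma partDensity_nonneg (Ψ : Mixture p) (N : Finset (Fin p)) (x : ℝ) :
    0 ≤ Ψ.partDensity N x :=
  Finset.sum_nonneg fun k _ => mul_nonneg (Ψ.weight_nonneg k) (snDensity_pos (Ψ.scale_pos k)).le

lemma partDensity_le (Ψ : Mixture p) (N : Finset (Fin p)) {r : ℝ} (hr : 0 < r)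
    (hN : ∀ k ∈ N, r ≤ Ψ.scale k) (x : ℝ) : Ψ.partDensity N x ≤ 1 / r := by
  have h1 : Ψ.partDensity N x ≤ ∑ k ∈ N, Ψ.weight k * (1 / r) := by
    refine Finset.sum_le_sum fun k hk => ?_
    have h2 := Ψ.weight_nonneg k
    have h3 := hN k hk
    gcongr
    exact (snDensity_le_inv (Ψ.scale_pos k)).trans (by gcongr)
  rw [← Finset.sum_mul] at h1
  refine h1.trans (mul_le_of_le_one_left (by positivity) ?_)
  rw [← Ψ.weight_sum]
  exact Finset.sum_le_sum_of_subset_of_nonneg (Finset.subset_univ N)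
    fun k _ _ => Ψ.weight_nonneg k

lemma continuous_partDensity (Ψ : Mixture p) (N : Finset (Fin p)) :
    Continuous (Ψ.partDensity N) :=
  continuous_finsetSum _ fun _ _ => continuous_const.mul (continuous_snDensity _ _ _)

lemma lintegral_partDensity_le (Ψ : Mixture p) (N : Finset (Fin p)) :
    ∫⁻ x, ENNReal.ofReal (Ψ.partDensity N x) ≤ 1 := by
  have h1 : ∀ x, Ψ.partDensity N x ≤ Ψ.density x := fun x =>
    Finset.sum_le_sum_of_subset_of_nonneg (Finset.subset_univ N) fun k _ _ =>
      mul_nonneg (Ψ.weight_nonneg k) (snDensity_pos (Ψ.scale_pos k)).le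
  refine (lintegral_mono fun x => ENNReal.ofReal_le_ofReal (h1 x)).trans ?_
  rw [← ofReal_integral_eq_lintegral_ofReal Ψ.integrable_density
    (Eventually.of_forall fun x => (Ψ.density_pos x).le), Ψ.integral_density, ENNReal.ofReal_one]

lemma exists_monotone_partDensity (Ψ : Mixture p) (N : Finset (Fin p)) {r : ℝ} (hr : 0 < r)
    (hN : ∀ k ∈ N, r ≤ Ψ.scale k) :
    ∃ P Q : ℝ → ℝ, Monotone P ∧ Monotone Q ∧ (∀ x, |P x| ≤ 2 / r) ∧ (∀ x, |Q x| ≤ 2 / r) ∧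
      ∀ x, Ψ.partDensity N x = P x - Q x := by
  have hdec := fun k => exists_monotone_snDensity (Ψ.loc k) (Ψ.shape k) (Ψ.scale_pos k)
  choose P Q hP hQ hP1 hQ1 hPQ using hdec
  have hmono : ∀ F : Fin p → ℝ → ℝ, (∀ k, Monotone (F k)) →
      Monotone fun x => ∑ k ∈ N, Ψ.weight k * F k x := fun F hF x y hxy =>
    Finset.sum_le_sum fun k _ => mul_le_mul_of_nonneg_left (hF k hxy) (Ψ.weight_nonneg k)
  have hbd : ∀ F : Fin p → ℝ → ℝ, (∀ k x, |F k x| ≤ 2 / Ψ.scale k) →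
      ∀ x, |∑ k ∈ N, Ψ.weight k * F k x| ≤ 2 / r := by
    intro F hF x
    refine (Finset.abs_sum_le_sum_abs _ _).trans ?_
    have h1 : ∑ k ∈ N, |Ψ.weight k * F k x| ≤ ∑ k ∈ N, Ψ.weight k * (2 / r) := by
      refine Finset.sum_le_sum fun k hk => ?_
      have h2 := Ψ.weight_nonneg k
      have h3 := hN k hk
      rw [abs_mul, abs_of_nonneg h2]
      gcongr
      exact (hF k x).trans (by gcongr)
    rw [← Finset.sum_mul] at h1
    refine h1.trans (mul_le_of_le_one_left (by positivity) ?_)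
    rw [← Ψ.weight_sum]
    exact Finset.sum_le_sum_of_subset_of_nonneg (Finset.subset_univ N)
      fun k _ _ => Ψ.weight_nonneg k
  refine ⟨_, _, hmono P hP, hmono Q hQ, hbd P hP1, hbd Q hQ1, fun x => ?_⟩
  simp only [partDensity, hPQ, mul_sub, Finset.sum_sub_distrib]

/-- Expanding the product shows `U + ∑ g_k ≤ (U + δ) ∏ (1 + g_k / δ)` for nonnegative terms. The
logarithm then separates the regular part from the individual spikes, and each spike can be paired
with its own penalty. -/
lemma log_density_le (Ψ : Mixture p) (N : Finset (Fin p)) {δ : ℝ} (hδ : 0 < δ) (x : ℝ) :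
    Real.log (Ψ.density x) ≤ Real.log (Ψ.partDensity N x + δ) +
      ∑ k ∈ Nᶜ, Real.log (1 + 1 / δ *
        (1 / Ψ.scale k * Real.exp (-(x - Ψ.loc k) ^ 2 / (2 * Ψ.scale k ^ 2)))) := by
  set g : Fin p → ℝ := fun k =>
    1 / Ψ.scale k * Real.exp (-(x - Ψ.loc k) ^ 2 / (2 * Ψ.scale k ^ 2)) with hg
  have hg0 : ∀ k, 0 ≤ g k := fun k => by have := Ψ.scale_pos k; positivity
  have hU := Ψ.partDensity_nonneg N x
  have hle : Ψ.density x ≤ Ψ.partDensity N x + ∑ k ∈ Nᶜ, g k := by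
    rw [density, ← Finset.sum_add_sum_compl N]
    refine add_le_add le_rfl (Finset.sum_le_sum fun k _ => ?_)
    exact (mul_le_of_le_one_left (snDensity_pos (Ψ.scale_pos k)).le (Ψ.weight_le_one k)).trans
      (snDensity_le_exp (Ψ.scale_pos k))
  have hprod : ∀ S : Finset (Fin p), 1 + ∑ k ∈ S, 1 / δ * g k ≤ ∏ k ∈ S, (1 + 1 / δ * g k) := by
    intro S
    induction S using Finset.cons_induction with
    | empty => simp
    | cons i S hi ih =>
      rw [Finset.sum_cons, Finset.prod_cons]
      have h1 : 0 ≤ 1 / δ * g i := mul_nonneg (by positivity) (hg0 i)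
      have h2 : 0 ≤ ∑ k ∈ S, 1 / δ * g k :=
        Finset.sum_nonneg fun k _ => mul_nonneg (by positivity) (hg0 k)
      nlinarith
  have h1 : ∀ k, (0 : ℝ) < 1 + 1 / δ * g k := fun k => by have := hg0 k; positivity
  have hle2 : Ψ.density x ≤ (Ψ.partDensity N x + δ) * ∏ k ∈ Nᶜ, (1 + 1 / δ * g k) := by
    refine le_trans (hle.trans ?_) (mul_le_mul_of_nonneg_left (hprod Nᶜ) (by linarith))
    rw [← Finset.mul_sum]
    have h2 : 0 ≤ ∑ k ∈ Nᶜ, g k := Finset.sum_nonneg fun k _ => hg0 k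
    have h3 : (Ψ.partDensity N x + δ) * (1 + 1 / δ * ∑ k ∈ Nᶜ, g k) =
        Ψ.partDensity N x + ∑ k ∈ Nᶜ, g k + (δ + Ψ.partDensity N x * (1 / δ) * ∑ k ∈ Nᶜ, g k) := by
      field_simp; ring
    rw [h3]
    have : 0 ≤ Ψ.partDensity N x * (1 / δ) * ∑ k ∈ Nᶜ, g k := by positivity
    linarith
  rw [← Real.log_prod fun k _ => (h1 k).ne', ← Real.log_mul (by linarith)
    (Finset.prod_pos fun k _ => h1 k).ne']
  exact Real.log_le_log (Ψ.density_pos x) hle2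

end Mixture

namespace Mixture

variable {p : ℕ}

/-! ### Bounds for the penalized likelihood -/

section Likelihood

variable {x : ℕ → ℝ} {ν : Measure ℝ} [IsProbabilityMeasure ν] {penS penL : ℕ → ℝ → ℝ}

lemma eventually_sum_log_partDensity (hx : UniformLLN x ν) {r δ ε : ℝ} (hr : 0 < r) (hδ : 0 < δ)
    (hε : 0 < ε) :
    ∀ᶠ n : ℕ in atTop, ∀ (Ψ : Mixture p) (N : Finset (Fin p)), (∀ k ∈ N, r ≤ Ψ.scale k) →
      ∑ i ∈ Finset.range n, Real.log (Ψ.partDensity N (x i) + δ) ≤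
        n * ∫ y, Real.log (Ψ.partDensity N y + δ) ∂ν + ε * n := by
  filter_upwards [hx.log_sub (by positivity : 0 < 2 / r) hδ hε] with n hn Ψ N hN
  obtain ⟨P, Q, hP, hQ, hP1, hQ1, hPQ⟩ := Ψ.exists_monotone_partDensity N hr hN
  have h := hn P Q hP hQ hP1 hQ1 fun y => by rw [← hPQ]; exact Ψ.partDensity_nonneg N y
  simp only [← hPQ] at h
  linarith [(abs_le.1 h).2]

/-- The threshold `s₀` for spikes is chosen before `r`, the lower bound for the other scales, which
later comes from the limit of a subsequence. The error is one `ε * n` for the law of large numbers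
and one for each component. -/
lemma eventually_penLogLik_le (hx : UniformLLN x ν) (hcount : CountBound x) (hC1 : CondC1 penS)
    (hC2 : CondC2 penS) (hC3 : CondC3 penL) {δ ε : ℝ} (hδ : 0 < δ) (hε : 0 < ε) :
    ∃ s₀, 0 < s₀ ∧ ∀ r, 0 < r → ∀ᶠ n : ℕ in atTop, ∀ (Ψ : Mixture p) (N : Finset (Fin p)),
      (∀ k ∈ N, r ≤ Ψ.scale k) → (∀ k ∉ N, Ψ.scale k < s₀) →
      Ψ.penLogLik penS penL x n ≤
        n * (∫ y, Real.log (Ψ.partDensity N y + δ) ∂ν) + (p + 1) * ε * n := by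
  obtain ⟨s₀, hs₀, hspike⟩ := spike_bound hcount hC1 hC2 (by positivity : 0 < 1 / δ) hε
  refine ⟨s₀, hs₀, fun r hr => ?_⟩
  filter_upwards [hspike, eventually_sum_log_partDensity (p := p) hx hr hδ hε, hC1.2 ε hε, hC3.1]
    with n hn hlog hpen hpenL Ψ N hN hN'
  have h1 : Ψ.logLik x n ≤ n * (∫ y, Real.log (Ψ.partDensity N y + δ) ∂ν) + ε * n +
      ∑ k ∈ Nᶜ, ∑ i ∈ Finset.range n, Real.log (1 + 1 / δ *
        (1 / Ψ.scale k * Real.exp (-(x i - Ψ.loc k) ^ 2 / (2 * Ψ.scale k ^ 2)))) := by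
    refine (Finset.sum_le_sum fun i _ => Ψ.log_density_le N hδ (x i)).trans ?_
    rw [Finset.sum_add_distrib, Finset.sum_comm]
    linarith [hlog Ψ N hN]
  have h2 : ∑ k ∈ Nᶜ, ∑ i ∈ Finset.range n, Real.log (1 + 1 / δ *
        (1 / Ψ.scale k * Real.exp (-(x i - Ψ.loc k) ^ 2 / (2 * Ψ.scale k ^ 2)))) +
      ∑ k, penS n (Ψ.scale k) ≤ ∑ _k : Fin p, ε * n := by
    rw [← Finset.sum_add_sum_compl N fun k => penS n (Ψ.scale k),
      ← Finset.sum_add_sum_compl N fun _ => ε * (n : ℝ), add_left_comm, ← Finset.sum_add_distrib]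
    refine add_le_add (Finset.sum_le_sum fun k _ => ?_) (Finset.sum_le_sum fun k hk => ?_)
    · exact (le_max_right 0 _).trans (hpen _ (Ψ.scale_pos k))
    · exact hn _ _ (Ψ.scale_pos k) (hN' k (Finset.mem_compl.1 hk))
  have h3 : ∑ k, penL n (Ψ.shape k) ≤ 0 :=
    Finset.sum_nonpos fun k _ => (hpenL.2.1 _).trans hpenL.2.2.1.le
  simp only [Finset.sum_const, Finset.card_univ, Fintype.card_fin, nsmul_eq_mul] at h2
  rw [penLogLik]
  linarith

lemma tendsto_penLogLik_div (Ψ : Mixture p) (hC1 : CondC1 penS) (hC3 : CondC3 penL) {E : ℝ}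
    (h : Tendsto (fun n : ℕ => (∑ i ∈ Finset.range n, Real.log (Ψ.density (x i))) / n) atTop
      (𝓝 E)) :
    Tendsto (fun n : ℕ => Ψ.penLogLik penS penL x n / n) atTop (𝓝 E) := by
  have h1 : Tendsto (fun n : ℕ => ∑ k, penS n (Ψ.scale k) / n) atTop (𝓝 (∑ _k : Fin p, 0)) :=
    tendsto_finsetSum _ fun k _ => (hC1.1 _ (Ψ.scale_pos k)).tendsto_div_nhds_zero
  have h2 : Tendsto (fun n : ℕ => ∑ k, penL n (Ψ.shape k) / n) atTop (𝓝 (∑ _k : Fin p, 0)) :=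
    tendsto_finsetSum _ fun k _ => (hC3.2 _).tendsto_div_nhds_zero
  have h3 := h.add (h1.add h2)
  simp only [Finset.sum_const_zero, add_zero] at h3
  refine h3.congr fun n => ?_
  rw [penLogLik, logLik, ← Finset.sum_div, ← Finset.sum_div]
  ring

end Likelihood

/-! ### Extraction of convergent subsequences -/

/-- Compactness of a finite product of copies of `[0, 1]` and of the extended reals. -/
lemma exists_subseq_tendsto (Ψ : ℕ → Mixture p) :
    ∃ (w : Fin p → ℝ) (θ : Fin p → EReal × EReal × EReal) (u : ℕ → ℕ), StrictMono u ∧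
      ∀ k, Tendsto (fun n => (Ψ (u n)).weight k) atTop (𝓝 (w k)) ∧
        Tendsto (fun n => (((Ψ (u n)).loc k : EReal), ((Ψ (u n)).scale k : EReal),
          ((Ψ (u n)).shape k : EReal))) atTop (𝓝 (θ k)) := by
  let f : ℕ → (Fin p → Set.Icc (0 : ℝ) 1) × (Fin p → EReal × EReal × EReal) := fun n =>
    (fun k => ⟨(Ψ n).weight k, (Ψ n).weight_nonneg k, (Ψ n).weight_le_one k⟩,
      fun k => ((Ψ n).loc k, (Ψ n).scale k, (Ψ n).shape k))
  obtain ⟨⟨w, θ⟩, u, hu, hlim⟩ := CompactSpace.tendsto_subseq f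
  refine ⟨fun k => w k, θ, u, hu, fun k => ⟨?_, ?_⟩⟩
  · exact (continuous_subtype_val.comp ((continuous_apply k).comp continuous_fst)).tendsto _
      |>.comp hlim
  · exact ((continuous_apply k).comp continuous_snd).tendsto _ |>.comp hlim

lemma exists_scale_lower_bound {θ : Fin p → EReal × EReal × EReal} :
    ∃ r : ℝ, 0 < r ∧ ∀ k, 0 < (θ k).2.1 → (r : EReal) < (θ k).2.1 := by
  have h : ∀ᶠ r : ℝ in 𝓝[>] 0, ∀ k, 0 < (θ k).2.1 → (r : EReal) < (θ k).2.1 := by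
    refine eventually_all.2 fun k => ?_
    by_cases hk : 0 < (θ k).2.1
    · have h1 : ∀ᶠ r : ℝ in 𝓝 0, (r : EReal) < (θ k).2.1 :=
        (continuous_coe_real_ereal.tendsto 0).eventually (gt_mem_nhds (by simpa using hk))
      filter_upwards [nhdsWithin_le_nhds h1] with r hr _ using hr
    · exact Eventually.of_forall fun r h => absurd h hk
  obtain ⟨r, hr, hr0⟩ := (h.and self_mem_nhdsWithin).exists
  exact ⟨r, hr0, hr⟩

section Limit

variable {Ψ : ℕ → Mixture p} {w : Fin p → ℝ} {θ : Fin p → EReal × EReal × EReal}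

/-- The limit of the densities of the components whose scale does not degenerate. -/
noncomputable def limPart (w : Fin p → ℝ) (θ : Fin p → EReal × EReal × EReal)
    (N : Finset (Fin p)) (x : ℝ) : ℝ :=
  ∑ k ∈ N, w k * limDensity (θ k) x

lemma measurable_limPart (N : Finset (Fin p)) : Measurable (limPart w θ N) :=
  Finset.measurable_fun_sum _ fun k _ => (measurable_limDensity (θ k)).const_mul _

lemma limPart_nonneg {N : Finset (Fin p)} (hw : ∀ k, 0 ≤ w k) (hN : ∀ k ∈ N, 0 < (θ k).2.1)
    (x : ℝ) : 0 ≤ limPart w θ N x :=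
  Finset.sum_nonneg fun k hk => mul_nonneg (hw k) (limDensity_nonneg (hN k hk) x)

lemma limPart_le {N : Finset (Fin p)} (hw : ∀ k, 0 ≤ w k) (hN : ∀ k ∈ N, 0 < (θ k).2.1)
    (x : ℝ) : limPart w θ N x ≤ ∑ k ∈ N, w k * (1 / (θ k).2.1.toReal) :=
  Finset.sum_le_sum fun k hk => mul_le_mul_of_nonneg_left (limDensity_le (hN k hk) x) (hw k)

lemma ae_tendsto_partDensity
    (hw : ∀ k, Tendsto (fun n => (Ψ n).weight k) atTop (𝓝 (w k)))
    (hθ : ∀ k, Tendsto (fun n => (((Ψ n).loc k : EReal), ((Ψ n).scale k : EReal),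
      ((Ψ n).shape k : EReal))) atTop (𝓝 (θ k)))
    {N : Finset (Fin p)} (hN : ∀ k ∈ N, 0 < (θ k).2.1) :
    ∀ᵐ x, Tendsto (fun n => (Ψ n).partDensity N x) atTop (𝓝 (limPart w θ N x)) := by
  have h1 : ∀ᵐ x : ℝ, ∀ k, x ≠ (θ k).1.toReal := by
    refine ae_all_iff.2 fun k => ?_
    exact Set.countable_singleton ((θ k).1.toReal) |>.ae_notMem volume
  filter_upwards [h1] with x hx
  exact tendsto_finsetSum _ fun k hk =>
    (hw k).mul (tendsto_snDensity_limDensity (hN k hk) (hθ k) (hx k))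

/-- By Fatou's lemma; mass may be lost to spikes or to infinity, so only a subprobability results.
-/
lemma lintegral_limPart_le
    (hw : ∀ k, Tendsto (fun n => (Ψ n).weight k) atTop (𝓝 (w k)))
    (hθ : ∀ k, Tendsto (fun n => (((Ψ n).loc k : EReal), ((Ψ n).scale k : EReal),
      ((Ψ n).shape k : EReal))) atTop (𝓝 (θ k)))
    {N : Finset (Fin p)} (hN : ∀ k ∈ N, 0 < (θ k).2.1) :
    ∫⁻ x, ENNReal.ofReal (limPart w θ N x) ≤ 1 := by
  have h1 : ∫⁻ x, ENNReal.ofReal (limPart w θ N x) =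
      ∫⁻ x, liminf (fun n => ENNReal.ofReal ((Ψ n).partDensity N x)) atTop := by
    refine lintegral_congr_ae ?_
    filter_upwards [ae_tendsto_partDensity hw hθ hN] with x hx
    exact ((ENNReal.continuous_ofReal.tendsto _).comp hx).liminf_eq.symm
  rw [h1]
  refine (lintegral_liminf_le fun n =>
    ((Ψ n).continuous_partDensity N).measurable.ennreal_ofReal).trans ?_
  refine (liminf_le_liminf (Eventually.of_forall fun n =>
    (Ψ n).lintegral_partDensity_le N)).trans ?_
  simp

lemma weight_limit_nonneg (hw : ∀ k, Tendsto (fun n => (Ψ n).weight k) atTop (𝓝 (w k)))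
    (k : Fin p) : 0 ≤ w k :=
  ge_of_tendsto' (hw k) fun n => (Ψ n).weight_nonneg k

/-- Dominated convergence with a constant bound: scales at least `r` bound the logarithm above, and
`δ` bounds it below. -/
lemma tendsto_integral_log_partDensity
    (hw : ∀ k, Tendsto (fun n => (Ψ n).weight k) atTop (𝓝 (w k)))
    (hθ : ∀ k, Tendsto (fun n => (((Ψ n).loc k : EReal), ((Ψ n).scale k : EReal),
      ((Ψ n).shape k : EReal))) atTop (𝓝 (θ k)))
    {N : Finset (Fin p)} (hN : ∀ k ∈ N, 0 < (θ k).2.1)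
    {ν : Measure ℝ} [IsProbabilityMeasure ν] (hν : ν ≪ volume) {r δ : ℝ} (hr : 0 < r)
    (hrΨ : ∀ᶠ n in atTop, ∀ k ∈ N, r ≤ (Ψ n).scale k) (hδ : 0 < δ) :
    Tendsto (fun n => ∫ y, Real.log ((Ψ n).partDensity N y + δ) ∂ν) atTop
      (𝓝 (∫ y, Real.log (limPart w θ N y + δ) ∂ν)) := by
  refine tendsto_integral_filter_of_dominated_convergence
    (fun _ => |Real.log δ| + 1 / δ * (1 / r)) ?_ ?_ (integrable_const _) ?_
  · exact Eventually.of_forall fun n => (Real.measurable_log.comp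
      (((Ψ n).continuous_partDensity N).measurable.add_const δ)).aestronglyMeasurable
  · filter_upwards [hrΨ] with n hn
    refine Eventually.of_forall fun y => ?_
    have hU := (Ψ n).partDensity_nonneg N y
    have h1 := abs_log_add_sub_le hδ hU le_rfl
    rw [zero_add, sub_zero, abs_of_nonneg hU] at h1
    have h3 : 1 / δ * (Ψ n).partDensity N y ≤ 1 / δ * (1 / r) := by
      gcongr; exact (Ψ n).partDensity_le N hr hn y
    have h4 := abs_sub_abs_le_abs_sub (Real.log ((Ψ n).partDensity N y + δ)) (Real.log δ)
    rw [Real.norm_eq_abs]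
    linarith
  · filter_upwards [hν.ae_le (ae_tendsto_partDensity hw hθ hN)] with y hy
    have hpos : limPart w θ N y + δ ≠ 0 := by
      have := limPart_nonneg (weight_limit_nonneg hw) hN y
      linarith
    exact (Real.continuousAt_log hpos).tendsto.comp (hy.add_const δ)

end Limit

/-! ### Identification of the limit -/

/-- Only nondegenerate components with finite location and scale contribute to the limit.
Identifiability matches them with all `p` components of `Ψ₀`, so no component can have degenerated
and every limiting shape is finite. -/
lemma exists_perm_of_limPart_eq {Ψ₀ : Mixture p} (h₀ : Ψ₀.IsProper) {w : Fin p → ℝ}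
    {θ : Fin p → EReal × EReal × EReal} {N : Finset (Fin p)} (hw : ∀ k, 0 ≤ w k)
    (hN : ∀ k ∈ N, 0 < (θ k).2.1) (h : ∀ᵐ x, limPart w θ N x = Ψ₀.density x) :
    ∃ τ : Equiv.Perm (Fin p), ∀ k, w (τ k) = Ψ₀.weight k ∧
      θ (τ k) = ((Ψ₀.loc k : EReal), (Ψ₀.scale k : EReal), (Ψ₀.shape k : EReal)) := by
  classical
  set good : Fin p → Prop := fun k => k ∈ N ∧ ¬ ((θ k).1 = ⊤ ∨ (θ k).1 = ⊥ ∨ (θ k).2.1 = ⊤)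
    with hgood
  have hs : ∀ k : {k // good k}, 0 < (θ k).2.1.toReal := fun k => by
    refine EReal.toReal_pos (hN k k.2.1) fun h => k.2.2 (Or.inr (Or.inr h))
  have hsum : ∀ x, ∑ k : {k // good k}, w k * skewDensity (θ k).1.toReal (θ k).2.1.toReal
      (θ k).2.2 x = limPart w θ N x := by
    intro x
    rw [limPart, ← Finset.sum_filter_add_sum_filter_not N
      (fun k => ¬ ((θ k).1 = ⊤ ∨ (θ k).1 = ⊥ ∨ (θ k).2.1 = ⊤))]
    have hz : ∑ k ∈ N.filter (fun k => ¬¬ ((θ k).1 = ⊤ ∨ (θ k).1 = ⊥ ∨ (θ k).2.1 = ⊤)),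
        w k * limDensity (θ k) x = 0 := by
      refine Finset.sum_eq_zero fun k hk => ?_
      rw [limDensity, if_pos (not_not.1 (Finset.mem_filter.1 hk).2), mul_zero]
    rw [hz, add_zero, ← Finset.sum_subtype_of_mem
      (p := good) (fun k => w k * limDensity (θ k) x) fun k hk => Finset.mem_filter.1 hk]
    have huniv : (N.filter fun k => ¬ ((θ k).1 = ⊤ ∨ (θ k).1 = ⊥ ∨ (θ k).2.1 = ⊤)).subtype good =
        Finset.univ := by
      ext k
      simp only [Finset.mem_subtype, Finset.mem_filter, Finset.mem_univ, iff_true]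
      exact k.2
    rw [huniv]
    refine Finset.sum_congr rfl fun k _ => ?_
    rw [limDensity, if_neg k.2.2]
  obtain ⟨e, he⟩ := exists_equiv_of_density_eq (T := {k // good k}) h₀
    ((Fintype.card_subtype_le good).trans (Fintype.card_fin p).le)
    (w := fun k => w k) (m := fun k => (θ k).1.toReal) (s := fun k => (θ k).2.1.toReal)
    (l := fun k => (θ k).2.2) hs (fun k => hw k) (by
      filter_upwards [h] with x hx
      rw [hsum, hx])
  have hinj : Function.Injective fun k => (e k : Fin p) :=
    Subtype.val_injective.comp e.injective
  refine ⟨Equiv.ofBijective _ (Finite.injective_iff_bijective.1 hinj), fun k => ?_⟩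
  obtain ⟨h1, h2, h3, h4⟩ := he k
  have hk := (e k).2.2
  push Not at hk
  have hbot : (θ (e k)).2.1 ≠ ⊥ := (lt_trans EReal.bot_lt_zero (hN _ (e k).2.1)).ne'
  refine ⟨h1, Prod.ext ?_ (Prod.ext ?_ h4)⟩
  · simp only [Equiv.ofBijective_apply]
    rw [← h2, EReal.coe_toReal hk.1 hk.2.1]
  · simp only [Equiv.ofBijective_apply]
    rw [← h3, EReal.coe_toReal hk.2.2 hbot]

end Mixture

namespace Mixture

variable {p : ℕ}

/-! ### Consistency along subsequences -/

section Consistency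

variable {Ψ₀ : Mixture p} {x : ℕ → ℝ} {penS penL : ℕ → ℝ → ℝ}

/-- Convergence of the parameters of the mixtures `Ψ n`, relabelled by `τ`, to those of `Ψ₀`. -/
def ParamsTendsto (Ψ : ℕ → Mixture p) (τ : Equiv.Perm (Fin p)) (Ψ₀ : Mixture p) : Prop :=
  ∀ k, Tendsto (fun n => (Ψ n).weight (τ k)) atTop (𝓝 (Ψ₀.weight k)) ∧
    Tendsto (fun n => (Ψ n).loc (τ k)) atTop (𝓝 (Ψ₀.loc k)) ∧
    Tendsto (fun n => (Ψ n).scale (τ k)) atTop (𝓝 (Ψ₀.scale k)) ∧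
    Tendsto (fun n => (Ψ n).shape (τ k)) atTop (𝓝 (Ψ₀.shape k))

/-- The mixture `Ψ j` is compared at sample size `v j`, so that the result applies along arbitrary
subsequences of the original sequence. -/
lemma exists_subseq_paramsTendsto (h₀ : Ψ₀.IsProper) (hx : UniformLLN x Ψ₀.law)
    (hcount : CountBound x) (hC1 : CondC1 penS) (hC2 : CondC2 penS) (hC3 : CondC3 penL)
    (havg : Tendsto (fun n : ℕ => (∑ i ∈ Finset.range n, Real.log (Ψ₀.density (x i))) / n) atTop
      (𝓝 (∫ y, Real.log (Ψ₀.density y) ∂Ψ₀.law)))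
    {c : ℝ} {Ψ : ℕ → Mixture p} {v : ℕ → ℕ} (hv : Tendsto v atTop atTop)
    (h : ∀ᶠ j in atTop, c ≤ (Ψ j).penLogLik penS penL x (v j) - Ψ₀.penLogLik penS penL x (v j)) :
    ∃ u : ℕ → ℕ, ∃ τ, ParamsTendsto (fun j => Ψ (u j)) τ Ψ₀ := by
  classical
  obtain ⟨w, θ, u, hu, hlim⟩ := exists_subseq_tendsto Ψ
  have hw := fun k => (hlim k).1
  have hθ := fun k => (hlim k).2
  set N : Finset (Fin p) := Finset.univ.filter fun k => 0 < (θ k).2.1 with hNdef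
  have hN : ∀ k ∈ N, 0 < (θ k).2.1 := fun k hk => (Finset.mem_filter.1 hk).2
  have hw0 := weight_limit_nonneg hw
  have hscale : ∀ k, Tendsto (fun n => ((Ψ (u n)).scale k : EReal)) atTop (𝓝 (θ k).2.1) :=
    fun k => ((continuous_fst.comp continuous_snd).tendsto _).comp (hθ k)
  have hzero : ∀ k ∉ N, (θ k).2.1 = 0 := by
    intro k hk
    refine le_antisymm (not_lt.1 fun h => hk (Finset.mem_filter.2 ⟨Finset.mem_univ k, h⟩)) ?_
    exact ge_of_tendsto' (hscale k) fun n => by exact_mod_cast ((Ψ (u n)).scale_pos k).le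
  obtain ⟨r, hr, hrθ⟩ := exists_scale_lower_bound (θ := θ)
  have hrΨ : ∀ᶠ n in atTop, ∀ k ∈ N, r ≤ (Ψ (u n)).scale k := by
    refine (Finset.eventually_all N).2 fun k hk => ?_
    filter_upwards [(hscale k).eventually (lt_mem_nhds (hrθ k (hN k hk)))] with n hn
    exact_mod_cast hn.le
  have hsmall : ∀ s₀ : ℝ, 0 < s₀ → ∀ᶠ n in atTop, ∀ k ∉ N, (Ψ (u n)).scale k < s₀ := by
    intro s₀ hs₀
    have : ∀ᶠ n in atTop, ∀ k, k ∉ N → (Ψ (u n)).scale k < s₀ := by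
      refine eventually_all.2 fun k => ?_
      by_cases hk : k ∈ N
      · exact Eventually.of_forall fun n h => absurd hk h
      · have h1 : (θ k).2.1 < (s₀ : EReal) := by rw [hzero k hk]; exact_mod_cast hs₀
        filter_upwards [(hscale k).eventually (gt_mem_nhds h1)] with n hn _
        exact_mod_cast hn
    exact this
  have hvu : Tendsto (fun n => v (u n)) atTop atTop := hv.comp hu.tendsto_atTop
  have hpen₀ := (tendsto_penLogLik_div (penS := penS) (penL := penL) Ψ₀ hC1 hC3 havg).comp hvu
  set E := ∫ y, Real.log (Ψ₀.density y) ∂Ψ₀.law with hE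
  -- Divide the upper bound for `Ψ (u n)` and the lower bound, `c` plus the value at `Ψ₀`, by the
  -- sample size and let `n → ∞`; the factor `p + 1` in `ε'` compensates the error count.
  have hlog : ∀ δ, 0 < δ → E ≤ ∫ y, Real.log (limPart w θ N y + δ) ∂Ψ₀.law := by
    intro δ hδ
    have hint := tendsto_integral_log_partDensity hw hθ hN Ψ₀.law_absolutelyContinuous hr hrΨ hδ
    refine le_of_forall_pos_le_add fun ε hε => ?_
    set ε' := ε / (p + 1) with hε'
    have hε'pos : 0 < ε' := by positivity
    obtain ⟨s₀, hs₀, hup⟩ := eventually_penLogLik_le (p := p) hx hcount hC1 hC2 hC3 hδ hε'pos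
    have hc : Tendsto (fun n => c / (v (u n) : ℝ)) atTop (𝓝 0) :=
      (tendsto_natCast_atTop_atTop.comp hvu).const_div_atTop c
    have hleft : Tendsto (fun n => c / (v (u n) : ℝ) +
        Ψ₀.penLogLik penS penL x (v (u n)) / (v (u n) : ℝ)) atTop (𝓝 (0 + E)) := hc.add hpen₀
    rw [zero_add] at hleft
    refine le_of_tendsto_of_tendsto hleft (hint.add_const ε) ?_
    filter_upwards [hvu.eventually (hup r hr), hrΨ, hsmall s₀ hs₀, hu.tendsto_atTop.eventually h,
      hvu.eventually_gt_atTop 0] with n h1 h2 h3 h4 h5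
    have h5' : (0 : ℝ) < v (u n) := by exact_mod_cast h5
    have h6 := h1 (Ψ (u n)) N h2 h3
    rw [← add_div, div_le_iff₀ h5']
    have h7 : ((p : ℝ) + 1) * ε' = ε := by rw [hε']; field_simp
    rw [h7] at h6
    linarith
  have hlint := lintegral_limPart_le hw hθ hN
  have hnonneg := limPart_nonneg (θ := θ) (N := N) hw0 hN
  have hmeas := measurable_limPart (w := w) (θ := θ) N
  have hfint : Integrable (limPart w θ N) := by
    refine ⟨hmeas.aestronglyMeasurable, ?_⟩
    rw [hasFiniteIntegral_iff_ofReal (Eventually.of_forall hnonneg)]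
    exact hlint.trans_lt ENNReal.one_lt_top
  have hf1 : ∫ y, limPart w θ N y ≤ 1 := by
    rw [integral_eq_lintegral_of_nonneg_ae (Eventually.of_forall hnonneg)
      hmeas.aestronglyMeasurable]
    exact ENNReal.toReal_le_of_le_ofReal zero_le_one (by rw [ENNReal.ofReal_one]; exact hlint)
  have heq := Ψ₀.ae_eq_density_of_integral_log_le hmeas hnonneg
    (limPart_le (θ := θ) (N := N) hw0 hN) hfint hf1 hlog
  obtain ⟨τ, hτ⟩ := exists_perm_of_limPart_eq h₀ hw0 hN heq
  refine ⟨u, τ, fun k => ?_⟩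
  obtain ⟨h1, h2⟩ := hτ k
  have h3 := hθ (τ k)
  rw [h2] at h3
  refine ⟨h1 ▸ hw (τ k), EReal.tendsto_coe.1 ?_, EReal.tendsto_coe.1 ?_, EReal.tendsto_coe.1 ?_⟩
  · exact (continuous_fst.tendsto _).comp h3
  · exact ((continuous_fst.comp continuous_snd).tendsto _).comp h3
  · exact ((continuous_snd.comp continuous_snd).tendsto _).comp h3

end Consistency

/-! ### Convergence of mixtures -/

/-- The `ℓ¹` distance of the parameters of `Ψ`, relabelled by `τ`, from those of `Ψ₀`. -/
noncomputable def paramDist (Ψ Ψ₀ : Mixture p) (τ : Equiv.Perm (Fin p)) : ℝ :=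
  ∑ k, (|Ψ.weight (τ k) - Ψ₀.weight k| + |Ψ.loc (τ k) - Ψ₀.loc k| +
    |Ψ.scale (τ k) - Ψ₀.scale k| + |Ψ.shape (τ k) - Ψ₀.shape k|)

lemma paramDist_nonneg (Ψ Ψ₀ : Mixture p) (τ : Equiv.Perm (Fin p)) : 0 ≤ Ψ.paramDist Ψ₀ τ :=
  Finset.sum_nonneg fun _ _ => by positivity

lemma ParamsTendsto.paramDist {Ψ : ℕ → Mixture p} {Ψ₀ : Mixture p} {τ : Equiv.Perm (Fin p)}
    (h : ParamsTendsto Ψ τ Ψ₀) : Tendsto (fun n => (Ψ n).paramDist Ψ₀ τ) atTop (𝓝 0) := by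
  have key : ∀ {f : ℕ → ℝ} {a : ℝ}, Tendsto f atTop (𝓝 a) →
      Tendsto (fun n => |f n - a|) atTop (𝓝 0) := fun {_ a} hf => by
    simpa using (hf.sub_const a).abs
  have h1 : Tendsto (fun n => (Ψ n).paramDist Ψ₀ τ) atTop (𝓝 (∑ _k : Fin p, (0 + 0 + 0 + 0))) :=
    tendsto_finsetSum _ fun k _ => (((key (h k).1).add (key (h k).2.1)).add
      (key (h k).2.2.1)).add (key (h k).2.2.2)
  simpa using h1

lemma integral_mixing (Ψ : Mixture p) (f : BoundedContinuousFunction (ℝ × ℝ × ℝ) ℝ) :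
    ∫ y, f y ∂(Ψ.mixing : Measure (ℝ × ℝ × ℝ)) =
      ∑ k, Ψ.weight k * f (Ψ.loc k, Ψ.scale k ^ 2, Ψ.shape k) := by
  have h0 : (Ψ.mixing : Measure (ℝ × ℝ × ℝ)) = Ψ.mixingMeasure := rfl
  rw [h0, mixingMeasure, integral_finsetSum_measure]
  · refine Finset.sum_congr rfl fun k _ => ?_
    rw [integral_smul_measure, integral_dirac, ENNReal.toReal_ofReal (Ψ.weight_nonneg k),
      smul_eq_mul]
  · intro k _
    exact (f.integrable _).smul_measure ENNReal.ofReal_ne_top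

lemma convergesTo_of_paramDist {Ψ : ℕ → Mixture p} {Ψ₀ : Mixture p} {τ : ℕ → Equiv.Perm (Fin p)}
    (h : Tendsto (fun n => (Ψ n).paramDist Ψ₀ (τ n)) atTop (𝓝 0)) : ConvergesTo Ψ Ψ₀ := by
  have key : ∀ {f : ℕ → ℝ} {a : ℝ}, (∀ n, |f n - a| ≤ (Ψ n).paramDist Ψ₀ (τ n)) →
      Tendsto f atTop (𝓝 a) := fun hf =>
    tendsto_iff_dist_tendsto_zero.2 (squeeze_zero (fun _ => dist_nonneg) hf h)
  have hterm : ∀ n k, |(Ψ n).weight (τ n k) - Ψ₀.weight k| + |(Ψ n).loc (τ n k) - Ψ₀.loc k| +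
      |(Ψ n).scale (τ n k) - Ψ₀.scale k| + |(Ψ n).shape (τ n k) - Ψ₀.shape k| ≤
      (Ψ n).paramDist Ψ₀ (τ n) := fun n k =>
    Finset.single_le_sum (f := fun k => |(Ψ n).weight (τ n k) - Ψ₀.weight k| +
      |(Ψ n).loc (τ n k) - Ψ₀.loc k| + |(Ψ n).scale (τ n k) - Ψ₀.scale k| +
      |(Ψ n).shape (τ n k) - Ψ₀.shape k|) (fun _ _ => by positivity) (Finset.mem_univ k)
  have hparams : ∀ k, Tendsto (fun n => (Ψ n).weight (τ n k)) atTop (𝓝 (Ψ₀.weight k)) ∧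
      Tendsto (fun n => (Ψ n).loc (τ n k)) atTop (𝓝 (Ψ₀.loc k)) ∧
      Tendsto (fun n => (Ψ n).scale (τ n k)) atTop (𝓝 (Ψ₀.scale k)) ∧
      Tendsto (fun n => (Ψ n).shape (τ n k)) atTop (𝓝 (Ψ₀.shape k)) := by
    intro k
    have habs : ∀ a b c d e : ℝ, |a| + |b| + |c| + |d| ≤ e →
        |a| ≤ e ∧ |b| ≤ e ∧ |c| ≤ e ∧ |d| ≤ e := fun a b c d e he => by
      have := abs_nonneg a
      have := abs_nonneg b
      have := abs_nonneg c
      have := abs_nonneg d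
      refine ⟨?_, ?_, ?_, ?_⟩ <;> linarith
    exact ⟨key fun n => (habs _ _ _ _ _ (hterm n k)).1,
      key fun n => (habs _ _ _ _ _ (hterm n k)).2.1,
      key fun n => (habs _ _ _ _ _ (hterm n k)).2.2.1,
      key fun n => (habs _ _ _ _ _ (hterm n k)).2.2.2⟩
  refine ⟨?_, τ, hparams⟩
  rw [ProbabilityMeasure.tendsto_iff_forall_integral_tendsto]
  intro f
  simp only [integral_mixing]
  have h1 : ∀ n, ∑ k, (Ψ n).weight k * f ((Ψ n).loc k, (Ψ n).scale k ^ 2, (Ψ n).shape k) =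
      ∑ k, (Ψ n).weight (τ n k) *
        f ((Ψ n).loc (τ n k), (Ψ n).scale (τ n k) ^ 2, (Ψ n).shape (τ n k)) := fun n =>
    (Equiv.sum_comp (τ n) _).symm
  simp only [h1]
  refine tendsto_finsetSum _ fun k _ => ?_
  obtain ⟨hw, hm, hs, hl⟩ := hparams k
  exact hw.mul ((f.continuous.tendsto _).comp (hm.prodMk_nhds ((hs.pow 2).prodMk_nhds hl)))

theorem convergesTo_of_penLogLik {Ψ₀ : Mixture p} {x : ℕ → ℝ} {penS penL : ℕ → ℝ → ℝ}
    (h₀ : Ψ₀.IsProper) (hx : UniformLLN x Ψ₀.law)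
    (hcount : CountBound x) (hC1 : CondC1 penS) (hC2 : CondC2 penS) (hC3 : CondC3 penL)
    (havg : Tendsto (fun n : ℕ => (∑ i ∈ Finset.range n, Real.log (Ψ₀.density (x i))) / n) atTop
      (𝓝 (∫ y, Real.log (Ψ₀.density y) ∂Ψ₀.law)))
    {c : ℝ} {Ψ : ℕ → Mixture p}
    (h : ∀ᶠ n in atTop, c ≤ (Ψ n).penLogLik penS penL x n - Ψ₀.penLogLik penS penL x n) :
    ConvergesTo Ψ Ψ₀ := by
  -- The relabelling obtained from compactness depends on the subsequence. Minimizing the parameter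
  -- distance over all permutations for each `n` gives one choice that is at least as good along
  -- every subsequence.
  choose τ hτ using fun n => Finite.exists_min fun τ => (Ψ n).paramDist Ψ₀ τ
  refine convergesTo_of_paramDist (τ := τ) (tendsto_of_subseq_tendsto fun v hv => ?_)
  obtain ⟨u, σ, hσ⟩ := exists_subseq_paramsTendsto (Ψ := fun j => Ψ (v j)) h₀ hx hcount hC1 hC2
    hC3 havg hv (hv.eventually h)
  exact ⟨u, squeeze_zero (fun n => paramDist_nonneg _ _ _) (fun n => hτ _ σ) hσ.paramDist⟩

end Mixture

end SkewNormal

/-! ### The almost sure events and the consistency theorem. -/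

theorem theorem4 {Ω : Type*} [MeasurableSpace Ω] (P : Measure Ω) [IsProbabilityMeasure P]
    (p₀ : ℕ) (Ψ₀ : SkewNormal.Mixture p₀) (hΨ₀ : Ψ₀.IsProper)
    (X : ℕ → Ω → ℝ) (hlaw : ∀ i, HasLaw (X i) Ψ₀.law P) (hindep : iIndepFun X P)
    -- the penalties may depend on the sample
    (penS penL : Ω → ℕ → ℝ → ℝ)
    (hC1 : ∀ᵐ ω ∂P, SkewNormal.CondC1 (penS ω))
    (hC2 : ∀ᵐ ω ∂P, SkewNormal.CondC2 (penS ω))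
    (hC3 : ∀ᵐ ω ∂P, SkewNormal.CondC3 (penL ω)) :
    -- almost surely, every (data-dependent) sequence whose penalized log-likelihood stays within
    -- a constant of that of `Ψ₀` converges to `Ψ₀`
    (∀ᵐ ω ∂P, ∀ (c : ℝ) (Ψ : ℕ → SkewNormal.Mixture p₀),
      (∀ᶠ n in atTop,
        c ≤ (Ψ n).penLogLik (penS ω) (penL ω) (fun i => X i ω) n
          - Ψ₀.penLogLik (penS ω) (penL ω) (fun i => X i ω) n) →
      SkewNormal.Mixture.ConvergesTo Ψ Ψ₀) ∧
    -- in particular, penalized maximum likelihood estimators are strongly consistent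
    (∀ᵐ ω ∂P, ∀ Ψ : ℕ → SkewNormal.Mixture p₀,
      (∀ᶠ n in atTop, ∀ Ψ' : SkewNormal.Mixture p₀,
        Ψ'.penLogLik (penS ω) (penL ω) (fun i => X i ω) n
          ≤ (Ψ n).penLogLik (penS ω) (penL ω) (fun i => X i ω) n) →
      SkewNormal.Mixture.ConvergesTo Ψ Ψ₀) := by
  have hmain : ∀ᵐ ω ∂P, ∀ (c : ℝ) (Ψ : ℕ → SkewNormal.Mixture p₀),
      (∀ᶠ n in atTop,
        c ≤ (Ψ n).penLogLik (penS ω) (penL ω) (fun i => X i ω) n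
          - Ψ₀.penLogLik (penS ω) (penL ω) (fun i => X i ω) n) →
      SkewNormal.Mixture.ConvergesTo Ψ Ψ₀ := by
    obtain ⟨B, hB, hIco, hIoc⟩ := Ψ₀.exists_law_le
    have hlogm : Measurable fun y => Real.log (Ψ₀.density y) :=
      Real.measurable_log.comp Ψ₀.continuous_density.measurable
    -- The exceptional null set is fixed before `c` and `Ψ` are chosen, so the sequence may depend
    -- on the sample in any way, measurably or not.
    filter_upwards [hC1, hC2, hC3, SkewNormal.ae_countBound hlaw hindep hB hIco,
      SkewNormal.ae_uniformLLN hlaw hindep hIoc,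
      SkewNormal.ae_tendsto_average hlaw hindep hlogm Ψ₀.integrable_log_density]
      with ω h1 h2 h3 h4 h5 h6 c Ψ h
    exact SkewNormal.Mixture.convergesTo_of_penLogLik hΨ₀ h5 h4 h1 h2 h3 h6 h
  refine ⟨hmain, ?_⟩
  filter_upwards [hmain] with ω hω Ψ h
  refine hω 0 Ψ ?_
  filter_upwards [h] with n hn
  exact sub_nonneg.2 (hn Ψ₀)
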